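/- **Setting.** An episodic two-player zero-sum Markov game has $H\ge 1$ steps, finite state sets $\mathcal S_1,\dots,\mathcal S_{H+1}$ with $|\mathcal S_h|\le S$, finite action sets $\mathcal A_h$ of the max-player and $\mathcal B_h$ of the min-player with $|\mathcal A_h|\le A$, $|\mathcal B_h|\le B$ for $h\in[H]$ (all nonempty), unknown transition probabilities $\mathbb P_h(\cdot\mid s,a,b)$ on $\mathcal S_{h+1}$, and unknown deterministic rewards $r_h(s,a,b)\in[0,1]$. It is *turn-based* if $[H]$ is partitioned into $\mathcal H_{\max}$ and $\mathcal H_{\min}$ with $|\mathcal A_h|=1$ for $h\in\mathcal H_{\min}$ and $|\mathcal B_h|=1$ for $h\in\mathcal H_{\max}$. For policies $\mu=(\mu_h(\cdot|s))$, $\nu=(\nu_h(\cdot|s))$ let $V_h^{\mu,\nu}(s)$ be the expected sum of the rewards from step $h$ to the end of the episode, starting from $s_h=s$, and put $V_h^{\dagger,\nu}=\sup_\mu V_h^{\mu,\nu}$ and $V_h^{\mu,\dagger}=\inf_\nu V_h^{\mu,\nu}$. If $K\ge1$ episodes are played with initial states $s_1^k$ and deployed policies $(\mu^k,\nu^k)$,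 then $\mathrm{Regret}(K)=\sum_{k=1}^K\big[V_1^{\dagger,\nu^k}(s_1^k)-V_1^{\mu^k,\dagger}(s_1^k)\big]$. The initial states are chosen by an adversary, possibly at random and depending on the past. Let $T=KH$, $0<p<1$, $\iota=\log(SABT/p)$. **Algorithm (VI-ULCB).** It uses the bonus $\beta_t=c\sqrt{H^2S\iota/t}$. Let $N_h(s,a,b)$ and $N_h(s,a,b,s')$ be the numbers of earlier visits and transitions, $\hat{\mathbb P}_h(s'|s,a,b)=N_h(s,a,b,s')/N_h(s,a,b)$, and $\hat r_h(s,a,b)$ the last reward observed at $(h,s,a,b)$. Before each episode, with $V^{\rm up}_{H+1}=V^{\rm low}_{H+1}=0$, for $h=H,\dots,1$ set, with $t=N_h(s,a,b)$, $$Q_h^{\rm up}(s,a,b)=\min\{\hat r_h+\hat{\mathbb P}_hV^{\rm up}_{h+1}+\beta_t,\;H\},\qquad Q_h^{\rm low}(s,a,b)=\max\{\hat r_h+\hat{\mathbb P}_hV^{\rm low}_{h+1}-\beta_t,\;0\}$$ if $t>0$, and $Q_h^{\rm up}=H$, $Q_h^{\rm low}=0$ if $t=0$. Let $(\mu_h(\cdot|s),\nu_h(\cdot|s))=\textsc{Nash}(Q_h^{\rm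 up}(s,\cdot,\cdot),Q_h^{\rm low}(s,\cdot,\cdot))$, and $V_h^{\rm up}(s)=\mu_h^\top Q_h^{\rm up}\nu_h$, $V_h^{\rm low}(s)=\mu_h^\top Q_h^{\rm low}\nu_h$ at $s$. Then the episode is played with $(\mu,\nu)$. Here $\textsc{Nash}(\mathbf P,\mathbf Q)$ returns $(\phi,\psi)$ with $\phi^\top\mathbf P\psi=\max_{\tilde\phi}\tilde\phi^\top\mathbf P\psi$ and $\phi^\top\mathbf Q\psi=\min_{\tilde\psi}\phi^\top\mathbf Q\tilde\psi$. **Statement.** 1. If $\mathbf P,\mathbf Q$ are $m\times1$, then $(\phi,\psi)$ is a Nash equilibrium if and only if $\phi$ maximizes $\tilde\phi^\top\mathbf P\psi$ over $\tilde\phi$, and $\phi=e_{a^\star}$ with any $a^\star\in\arg\max_a\mathbf P_a$ is a solution; if they are $1\times n$, then $(\phi,\psi)$ is one if and only if $\psi$ minimizes $\phi^\top\mathbf Q\tilde\psi$ over $\tilde\psi$, and $\psi=e_{b^\star}$ with any $b^\star\in\arg\min_b\mathbf Q_b$ is a solution. So for turn-based games the subroutine $\textsc{Nash}$ reduces to taking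 an argmax (argmin) over a vector. 2. With this subroutine (ties being broken by the least index), for every $c>0$, VI-ULCB runs on turn-based games in time $\mathrm{poly}(S,A,B,T)$: there are one program for a real random access machine (unit-cost arithmetic, comparison, square root and logarithm of reals, no rounding; addition and subtraction of natural numbers) and one polynomial $q$, such that for every turn-based game the program carries out VI-ULCB for $K$ episodes and makes at most $q(S,A,B,T)$ elementary steps, whatever states and rewards it encounters. 3. There is an absolute constant $c_0>0$, and for every $c\ge c_0$ a constant $C$ that depends only on $c$, such that for every turn-based game, every adversary, every $K\ge1$ and every $p\in(0,1)$, VI-ULCB, with any subroutine that returns Nash equilibria of $m\times1$ and $1\times n$ games, satisfies with probability at least $1-p$ $$\mathrm{Regret}(K)\le C\sqrt{H^3S^2(A+B)T\iota}.$$ -/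

import Mathlib

/-! ## Episodic two-player zero-sum Markov games -/

namespace MG

/-- The sizes of a tabular episodic Markov game, which the players know. Steps are numbered
`0, …, H - 1`. The state set at step `h ≤ H` is `Fin (nS h)`, and the action sets of the
max-player and of the min-player at step `h < H` are `Fin (nA h)` and `Fin (nB h)`.
Entries beyond the horizon play no role. -/
structure Dims where
  H : ℕ
  nS : ℕ → ℕ
  nA : ℕ → ℕ
  nB : ℕ → ℕ
  H_pos : 0 < H
  nS_pos : ∀ h, 0 < nS h
  nA_pos : ∀ h, 0 < nA h
  nB_pos : ∀ h, 0 < nB h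

instance (D : Dims) (h : ℕ) : NeZero (D.nS h) := ⟨(D.nS_pos h).ne'⟩
instance (D : Dims) (h : ℕ) : NeZero (D.nA h) := ⟨(D.nA_pos h).ne'⟩
instance (D : Dims) (h : ℕ) : NeZero (D.nB h) := ⟨(D.nB_pos h).ne'⟩

/-- The steps are partitioned into those where only the max-player acts and those where only the
min-player acts; the other player has a single dummy action. -/
def Dims.TurnBased (D : Dims) : Prop :=
  ∃ Hmax Hmin : Finset ℕ, Disjoint Hmax Hmin ∧ Hmax ∪ Hmin = Finset.range D.H ∧
    (∀ h ∈ Hmin, D.nA h = 1) ∧ (∀ h ∈ Hmax, D.nB h = 1)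

/-- `S`, `A`, `B` bound the numbers of states and of actions of the two players at every step. -/
def Dims.BoundedBy (D : Dims) (S A B : ℕ) : Prop :=
  (∀ h ≤ D.H, D.nS h ≤ S) ∧ (∀ h < D.H, D.nA h ≤ A) ∧ (∀ h < D.H, D.nB h ≤ B)

/-- The (unknown) dynamics: transition probabilities and deterministic rewards in `[0, 1]`. -/
structure Game (D : Dims) where
  P : ∀ h, Fin (D.nS h) → Fin (D.nA h) → Fin (D.nB h) → PMF (Fin (D.nS (h + 1)))
  r : ∀ h, Fin (D.nS h) → Fin (D.nA h) → Fin (D.nB h) → ℝ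
  r_mem : ∀ h s a b, r h s a b ∈ Set.Icc (0 : ℝ) 1

/-- Policies of the max-player. -/
abbrev MaxPolicy (D : Dims) : Type := ∀ h, Fin (D.nS h) → PMF (Fin (D.nA h))

/-- Policies of the min-player. -/
abbrev MinPolicy (D : Dims) : Type := ∀ h, Fin (D.nS h) → PMF (Fin (D.nB h))

/-- What is observed in one step of play: the step number, the state, the two actions,
the reward, and the next state. -/
structure Obs where
  h : ℕ
  s : ℕ
  a : ℕ
  b : ℕ
  r : ℝ
  s' : ℕ

noncomputable section

/-- The law of the play from state `s` at step `h` for the next `n` steps under `(μ, ν)`. -/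
def rollout {D : Dims} (G : Game D) (μ : MaxPolicy D) (ν : MinPolicy D) :
    (n h : ℕ) → Fin (D.nS h) → PMF (List Obs)
  | 0, _, _ => PMF.pure []
  | n + 1, h, s =>
    (μ h s).bind fun a => (ν h s).bind fun b => (G.P h s a b).bind fun s' =>
      (rollout G μ ν n (h + 1) s').map fun τ => ⟨h, s, a, b, G.r h s a b, s'⟩ :: τ

/-- Sum of the rewards of a play. -/
def totalReward (τ : List Obs) : ℝ := (τ.map Obs.r).sum

/-- `V_h^{μ,ν}(s)`: the expected sum of the rewards from step `h` to the end of the episode.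
(The law of the play has finite support, so the series is a finite sum.) -/
def value {D : Dims} (G : Game D) (μ : MaxPolicy D) (ν : MinPolicy D) (h : ℕ)
    (s : Fin (D.nS h)) : ℝ :=
  ∑' τ : List Obs, (rollout G μ ν (D.H - h) h s τ).toReal * totalReward τ

/-- `V_h^{†,ν}(s)`: value of the best response of the max-player to `ν`. -/
def bestMax {D : Dims} (G : Game D) (ν : MinPolicy D) (h : ℕ) (s : Fin (D.nS h)) : ℝ :=
  ⨆ μ : MaxPolicy D, value G μ ν h s

/-- `V_h^{μ,†}(s)`: value of the best response of the min-player to `μ`. -/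
def bestMin {D : Dims} (G : Game D) (μ : MaxPolicy D) (h : ℕ) (s : Fin (D.nS h)) : ℝ :=
  ⨅ ν : MinPolicy D, value G μ ν h s

/-! ## Playing several episodes, and the regret -/

/-- One episode: its initial state and its `H` observed steps. -/
structure Episode (D : Dims) where
  s₁ : Fin (D.nS 0)
  steps : List Obs

/-- A self-play algorithm: from everything observed in the earlier episodes (in order of time)
it determines the pair of policies to deploy in the next episode. -/
abbrev Learner (D : Dims) : Type := List Obs → MaxPolicy D × MinPolicy D

/-- The adversary that picks the initial states, adaptively and possibly at random.
(A learner is a function of the past, so the adversary may use the policies about to be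
deployed.) -/
abbrev Adversary (D : Dims) : Type := List (Episode D) → PMF (Fin (D.nS 0))

/-- All steps observed in a list of episodes. -/
def allSteps {D : Dims} (hist : List (Episode D)) : List Obs := hist.flatMap Episode.steps

/-- The law of the first `K` episodes. -/
def law {D : Dims} (G : Game D) (alg : Learner D) (adv : Adversary D) :
    ℕ → PMF (List (Episode D))
  | 0 => PMF.pure []
  | K + 1 =>
    (law G alg adv K).bind fun hist => (adv hist).bind fun s =>
      (rollout G (alg (allSteps hist)).1 (alg (allSteps hist)).2 D.H 0 s).map fun τ =>
        hist ++ [⟨s, τ⟩]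

/-- `Regret = ∑_k [V_1^{†,ν^k}(s_1^k) - V_1^{μ^k,†}(s_1^k)]`, the sum being over the
episodes of `hist`, with `(μ^k, ν^k)` the policies deployed in episode `k`. -/
def regret {D : Dims} (G : Game D) (alg : Learner D) (hist : List (Episode D)) : ℝ :=
  ∑ k : Fin hist.length,
    (bestMax G (alg (allSteps (hist.take k))).2 0 (hist.get k).s₁ -
      bestMin G (alg (allSteps (hist.take k))).1 0 (hist.get k).s₁)

/-! ## One-step general-sum games -/

/-- `φᵀ M ψ`. -/
def payoff {m n : ℕ} (φ : PMF (Fin m)) (M : Fin m → Fin n → ℝ) (ψ : PMF (Fin n)) : ℝ :=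
  ∑ a, ∑ b, (φ a).toReal * (ψ b).toReal * M a b

/-- `(φ, ψ)` is a Nash equilibrium of the general-sum game in which the first player maximizes
`P` and the second player minimizes `Q`. -/
def IsNash {m n : ℕ} (P Q : Fin m → Fin n → ℝ) (φ : PMF (Fin m)) (ψ : PMF (Fin n)) : Prop :=
  (∀ φ', payoff φ' P ψ ≤ payoff φ P ψ) ∧ (∀ ψ', payoff φ Q ψ ≤ payoff φ Q ψ')

/-- A subroutine that takes two payoff matrices and returns a pair of mixed strategies. -/
abbrev Subroutine : Type :=
  ∀ (m n : ℕ) [NeZero m] [NeZero n], (Fin m → Fin n → ℝ) → (Fin m → Fin n → ℝ) →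
    PMF (Fin m) × PMF (Fin n)

/-- The subroutine returns a Nash equilibrium of every vector game, that is, whenever one of the
players has a single action. -/
def SolvesVectorGames (nash : Subroutine) : Prop :=
  ∀ (m n : ℕ) [NeZero m] [NeZero n], (m = 1 ∨ n = 1) → ∀ P Q : Fin m → Fin n → ℝ,
    IsNash P Q (nash m n P Q).1 (nash m n P Q).2

open Classical in
theorem maximizers_nonempty {n : ℕ} [NeZero n] (f : Fin n → ℝ) :
    (Finset.univ.filter fun a => ∀ a', f a' ≤ f a).Nonempty := by
  obtain ⟨a, -, ha⟩ := Finset.exists_max_image Finset.univ f ⟨0, Finset.mem_univ 0⟩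
  exact ⟨a, Finset.mem_filter.2 ⟨Finset.mem_univ a, fun a' => ha a' (Finset.mem_univ a')⟩⟩

open Classical in
/-- The first index at which the vector `f` is maximal. -/
def argmax {n : ℕ} [NeZero n] (f : Fin n → ℝ) : Fin n :=
  (Finset.univ.filter fun a => ∀ a', f a' ≤ f a).min' (maximizers_nonempty f)

/-- The first index at which the vector `f` is minimal. -/
def argmin {n : ℕ} [NeZero n] (f : Fin n → ℝ) : Fin n := argmax fun a => -f a

/-- The subroutine for vector games: the max-player plays an argmax of `P` (a column, if the
min-player has a single action), the min-player an argmin of `Q` (a row, if the max-player has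
a single action). -/
def vectorNash : Subroutine := fun _ _ _ _ P Q =>
  (PMF.pure (argmax fun a => P a 0), PMF.pure (argmin fun b => Q 0 b))

/-! ## Value iteration with upper and lower confidence bounds -/

/-- The statistics kept by the algorithm: visit counts `N_h(s,a,b)`, transition counts
`N_h(s,a,b,s')`, and the last observed reward. -/
structure Stats where
  N : ℕ → ℕ → ℕ → ℕ → ℕ
  Ntr : ℕ → ℕ → ℕ → ℕ → ℕ → ℕ
  rhat : ℕ → ℕ → ℕ → ℕ → ℝ

def Stats.init : Stats := ⟨fun _ _ _ _ => 0, fun _ _ _ _ _ => 0, fun _ _ _ _ => 0⟩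

/-- Update after one step of play. -/
def Stats.observe (d : Stats) (x : Obs) : Stats where
  N h s a b := if h = x.h ∧ s = x.s ∧ a = x.a ∧ b = x.b then d.N h s a b + 1 else d.N h s a b
  Ntr h s a b s' :=
    if h = x.h ∧ s = x.s ∧ a = x.a ∧ b = x.b ∧ s' = x.s' then d.Ntr h s a b s' + 1
    else d.Ntr h s a b s'
  rhat h s a b := if h = x.h ∧ s = x.s ∧ a = x.a ∧ b = x.b then x.r else d.rhat h s a b

/-- The statistics after a sequence of observed steps. -/
def statsOf (l : List Obs) : Stats := l.foldl Stats.observe Stats.init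

/-- The empirical transition probability (used only where `N_h(s,a,b) > 0`). -/
def Stats.Phat (d : Stats) (h s a b s' : ℕ) : ℝ := (d.Ntr h s a b s' : ℝ) / (d.N h s a b : ℝ)

/-- The upper update of `Q` at step `h`, given the upper values `V` at step `h + 1`. -/
def updUp (D : Dims) (β : ℕ → ℝ) (d : Stats) (h : ℕ) (V : Fin (D.nS (h + 1)) → ℝ)
    (s : Fin (D.nS h)) (a : Fin (D.nA h)) (b : Fin (D.nB h)) : ℝ :=
  if d.N h s a b = 0 then (D.H : ℝ)
  else min (d.rhat h s a b + ∑ s' : Fin (D.nS (h + 1)), d.Phat h s a b s' * V s' + β (d.N h s a b)) D.H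

/-- The lower update of `Q` at step `h`, given the lower values `V` at step `h + 1`. -/
def updLow (D : Dims) (β : ℕ → ℝ) (d : Stats) (h : ℕ) (V : Fin (D.nS (h + 1)) → ℝ)
    (s : Fin (D.nS h)) (a : Fin (D.nA h)) (b : Fin (D.nB h)) : ℝ :=
  if d.N h s a b = 0 then 0
  else max (d.rhat h s a b + ∑ s' : Fin (D.nS (h + 1)), d.Phat h s a b s' * V s' - β (d.N h s a b)) 0

/-- The upper and the lower values at step `h` when `n` steps remain. -/
def values (D : Dims) (β : ℕ → ℝ) (nash : Subroutine) (d : Stats) :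
    (n h : ℕ) → (Fin (D.nS h) → ℝ) × (Fin (D.nS h) → ℝ)
  | 0, _ => (fun _ => 0, fun _ => 0)
  | n + 1, h =>
    let up := updUp D β d h (values D β nash d n (h + 1)).1
    let low := updLow D β d h (values D β nash d n (h + 1)).2
    (fun s => payoff (nash _ _ (up s) (low s)).1 (up s) (nash _ _ (up s) (low s)).2,
     fun s => payoff (nash _ _ (up s) (low s)).1 (low s) (nash _ _ (up s) (low s)).2)

/-- `V_h^up`, with `V_{H}^up = 0` after the last step. -/
def Vup (D : Dims) (β : ℕ → ℝ) (nash : Subroutine) (d : Stats) (h : ℕ) : Fin (D.nS h) → ℝ :=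
  (values D β nash d (D.H - h) h).1

/-- `V_h^low`, with `V_{H}^low = 0` after the last step. -/
def Vlow (D : Dims) (β : ℕ → ℝ) (nash : Subroutine) (d : Stats) (h : ℕ) : Fin (D.nS h) → ℝ :=
  (values D β nash d (D.H - h) h).2

/-- `Q_h^up`. -/
def Qup (D : Dims) (β : ℕ → ℝ) (nash : Subroutine) (d : Stats) (h : ℕ) :
    Fin (D.nS h) → Fin (D.nA h) → Fin (D.nB h) → ℝ :=
  updUp D β d h (Vup D β nash d (h + 1))

/-- `Q_h^low`. -/
def Qlow (D : Dims) (β : ℕ → ℝ) (nash : Subroutine) (d : Stats) (h : ℕ) :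
    Fin (D.nS h) → Fin (D.nA h) → Fin (D.nB h) → ℝ :=
  updLow D β d h (Vlow D β nash d (h + 1))

/-- VI-ULCB with bonus `β` and a given subroutine for general-sum games: the policies deployed
after the steps `l` have been observed. -/
def viULCB (D : Dims) (β : ℕ → ℝ) (nash : Subroutine) : Learner D := fun l =>
  (fun h s => (nash _ _ (Qup D β nash (statsOf l) h s) (Qlow D β nash (statsOf l) h s)).1,
   fun h s => (nash _ _ (Qup D β nash (statsOf l) h s) (Qlow D β nash (statsOf l) h s)).2)

/-- `ι = log (S A B T / p)`, where `T = K H`. -/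
def iota (D : Dims) (S A B K : ℕ) (p : ℝ) : ℝ :=
  Real.log ((S : ℝ) * A * B * ((K : ℝ) * D.H) / p)

/-- The bonus `β_t = c √(H² S ι / t)`. -/
def bonus (D : Dims) (S A B K : ℕ) (c p : ℝ) (t : ℕ) : ℝ :=
  c * Real.sqrt ((D.H : ℝ) ^ 2 * S * iota D S A B K p / t)

/-! ## A real random access machine that plays a game

The memory consists of arrays of natural numbers and arrays of real numbers; array names are
natural numbers, an array is indexed by finite lists of natural numbers, and a scalar variable is
an array entry with the empty index. In programs, an index is a list of names of scalar
natural-number variables. Every elementary operation, and every index used to address an array,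
costs one step. Natural numbers can only be added, subtracted and compared; the operations on
real numbers are those needed to evaluate the bonus, and no rounding is available.
The only loops are loops of a length that is fixed when the loop is entered. -/

/-- Expressions for natural numbers. -/
inductive NExp where
  | const (n : ℕ)
  | get (arr : ℕ) (idx : List ℕ)
  | add (e f : NExp)
  | sub (e f : NExp)

/-- Expressions for real numbers. -/
inductive RExp where
  | ofNat (e : NExp)
  | get (arr : ℕ) (idx : List ℕ)
  | add (e f : RExp)
  | sub (e f : RExp)
  | mul (e f : RExp)
  | div (e f : RExp)
  | sqrt (e : RExp)
  | log (e : RExp)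

/-- Tests. -/
inductive Test where
  | nle (e f : NExp)
  | rle (e f : RExp)

/-- Programs. `loop i e c` runs `c` with the scalar `i` set to `0, 1, …, e - 1` in turn.
`start x` begins a new episode and puts the initial state into the scalar `x`. `play a b y x`
lets the two players take the actions given by the scalars `a` and `b`, and puts the reward into
the real scalar `y` and the next state into the scalar `x`. -/
inductive Prog where
  | skip
  | nset (arr : ℕ) (idx : List ℕ) (e : NExp)
  | rset (arr : ℕ) (idx : List ℕ) (e : RExp)
  | seq (c d : Prog)
  | ite (t : Test) (c d : Prog)
  | loop (i : ℕ) (e : NExp) (c : Prog)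
  | start (x : ℕ)
  | play (a b y x : ℕ)

/-- The memory. -/
structure Mem where
  nat : ℕ → List ℕ → ℕ
  real : ℕ → List ℕ → ℝ

def Mem.scalar (M : Mem) (i : ℕ) : ℕ := M.nat i []

def Mem.index (M : Mem) (idx : List ℕ) : List ℕ := idx.map M.scalar

def Mem.setNat (M : Mem) (arr : ℕ) (i : List ℕ) (v : ℕ) : Mem :=
  { M with nat := fun arr' i' => if arr' = arr ∧ i' = i then v else M.nat arr' i' }

def Mem.setReal (M : Mem) (arr : ℕ) (i : List ℕ) (v : ℝ) : Mem :=
  { M with real := fun arr' i' => if arr' = arr ∧ i' = i then v else M.real arr' i' }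

def NExp.eval (M : Mem) : NExp → ℕ
  | .const n => n
  | .get arr idx => M.nat arr (M.index idx)
  | .add e f => e.eval M + f.eval M
  | .sub e f => e.eval M - f.eval M

def NExp.cost : NExp → ℕ
  | .const _ => 1
  | .get _ idx => 1 + idx.length
  | .add e f => 1 + e.cost + f.cost
  | .sub e f => 1 + e.cost + f.cost

def RExp.eval (M : Mem) : RExp → ℝ
  | .ofNat e => (e.eval M : ℝ)
  | .get arr idx => M.real arr (M.index idx)
  | .add e f => e.eval M + f.eval M
  | .sub e f => e.eval M - f.eval M
  | .mul e f => e.eval M * f.eval M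
  | .div e f => e.eval M / f.eval M
  | .sqrt e => Real.sqrt (e.eval M)
  | .log e => Real.log (e.eval M)

def RExp.cost : RExp → ℕ
  | .ofNat e => 1 + e.cost
  | .get _ idx => 1 + idx.length
  | .add e f => 1 + e.cost + f.cost
  | .sub e f => 1 + e.cost + f.cost
  | .mul e f => 1 + e.cost + f.cost
  | .div e f => 1 + e.cost + f.cost
  | .sqrt e => 1 + e.cost
  | .log e => 1 + e.cost

def Test.holds (M : Mem) : Test → Prop
  | .nle e f => e.eval M ≤ f.eval M
  | .rle e f => e.eval M ≤ f.eval M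

def Test.cost : Test → ℕ
  | .nle e f => 1 + e.cost + f.cost
  | .rle e f => 1 + e.cost + f.cost

/-- What the machine plays against. The responses may depend on everything observed so far:
`first l` is the initial state of the next episode, and `next l h s a b` is the reward and the
next state when the actions `a`, `b` are taken in state `s` at step `h`. -/
structure Env where
  first : List Obs → ℕ
  next : List Obs → ℕ → ℕ → ℕ → ℕ → ℝ × ℕ

/-- The states produced by `E` belong to the state sets given by `D`. -/
def Env.Legal (D : Dims) (E : Env) : Prop :=
  (∀ l, E.first l < D.nS 0) ∧ ∀ l, ∀ h < D.H, ∀ s a b, (E.next l h s a b).2 < D.nS (h + 1)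

/-- A configuration: memory, number of elementary steps made, current state and step number of
the game, the record of all plays, and the record of the memory contents at each start of an
episode. The program can read only the memory. -/
structure Config where
  mem : Mem
  time : ℕ
  cur : ℕ
  step : ℕ
  log : List Obs
  starts : List Mem

open Classical in
/-- Execution of a program. -/
def exec (E : Env) : Prog → Config → Config
  | .skip, σ => { σ with time := σ.time + 1 }
  | .nset arr idx e, σ =>
    { σ with
      mem := σ.mem.setNat arr (σ.mem.index idx) (e.eval σ.mem)
      time := σ.time + 1 + idx.length + e.cost }
  | .rset arr idx e, σ =>
    { σ with
      mem := σ.mem.setReal arr (σ.mem.index idx) (e.eval σ.mem)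
      time := σ.time + 1 + idx.length + e.cost }
  | .seq c d, σ => exec E d (exec E c σ)
  | .ite t c d, σ =>
    if t.holds σ.mem then exec E c { σ with time := σ.time + 1 + t.cost }
    else exec E d { σ with time := σ.time + 1 + t.cost }
  | .loop i e c, σ =>
    (List.range (e.eval σ.mem)).foldl
      (fun σ' j => exec E c { σ' with mem := σ'.mem.setNat i [] j, time := σ'.time + 1 })
      { σ with time := σ.time + 1 + e.cost }
  | .start x, σ =>
    { mem := σ.mem.setNat x [] (E.first σ.log)
      time := σ.time + 1
      cur := E.first σ.log
      step := 0
      log := σ.log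
      starts := σ.starts ++ [σ.mem] }
  | .play a b y x, σ =>
    let va := σ.mem.scalar a
    let vb := σ.mem.scalar b
    let res := E.next σ.log σ.step σ.cur va vb
    { mem := (σ.mem.setReal y [] res.1).setNat x [] res.2
      time := σ.time + 1
      cur := res.2
      step := σ.step + 1
      log := σ.log ++ [⟨σ.step, σ.cur, va, vb, res.1, res.2⟩]
      starts := σ.starts }

/-- The input: the numbers `H`, `K`, `S`, `A`, `B` are the natural scalars `0, …, 4`, the sizes
of the state and action sets are the natural arrays `5, 6, 7`, and `c`, `p` are the real scalars
`0`, `1`. Everything else is zero. -/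
def inputMem (D : Dims) (S A B K : ℕ) (c p : ℝ) : Mem where
  nat
    | 0, [] => D.H
    | 1, [] => K
    | 2, [] => S
    | 3, [] => A
    | 4, [] => B
    | 5, [h] => if h ≤ D.H then D.nS h else 0
    | 6, [h] => if h < D.H then D.nA h else 0
    | 7, [h] => if h < D.H then D.nB h else 0
    | _, _ => 0
  real
    | 0, [] => c
    | 1, [] => p
    | _, _ => 0

def inputConfig (D : Dims) (S A B K : ℕ) (c p : ℝ) : Config :=
  ⟨inputMem D S A B K c p, 0, 0, 0, [], []⟩

/-- The memory `M` holds all that VI-ULCB computes before an episode, when the steps `l` have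
been observed: `Q^up`, `Q^low`, `V^up`, `V^low` in the real arrays `2, 3, 4, 5`, and the
(deterministic) policies in the natural arrays `8, 9`. -/
def Holds (D : Dims) (β : ℕ → ℝ) (nash : Subroutine) (l : List Obs) (M : Mem) : Prop :=
  ∀ h < D.H, ∀ s : Fin (D.nS h),
    (∀ (a : Fin (D.nA h)) (b : Fin (D.nB h)),
      M.real 2 [h, s, a, b] = Qup D β nash (statsOf l) h s a b ∧
      M.real 3 [h, s, a, b] = Qlow D β nash (statsOf l) h s a b) ∧
    M.real 4 [h, s] = Vup D β nash (statsOf l) h s ∧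
    M.real 5 [h, s] = Vlow D β nash (statsOf l) h s ∧
    (∃ a : Fin (D.nA h), (viULCB D β nash l).1 h s = PMF.pure a ∧ M.nat 8 [h, s] = a) ∧
    (∃ b : Fin (D.nB h), (viULCB D β nash l).2 h s = PMF.pure b ∧ M.nat 9 [h, s] = b)

/-- The execution that ends in `σ` was a run of VI-ULCB for `K` episodes: it consists of exactly
`K` episodes of `H` steps each; when episode `k` starts, the memory holds all that VI-ULCB
computes from the observations of the earlier episodes; and at every step of the episode the
actions are those of the policies that VI-ULCB deploys (which are deterministic). -/
def RunsVIULCB (D : Dims) (β : ℕ → ℝ) (nash : Subroutine) (K : ℕ) (σ : Config) : Prop :=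
  σ.log.length = K * D.H ∧ σ.starts.length = K ∧
  ∀ k < K,
    (∃ M, σ.starts[k]? = some M ∧ Holds D β nash (σ.log.take (k * D.H)) M) ∧
    ∀ h < D.H, ∃ (s : Fin (D.nS h)) (a : Fin (D.nA h)) (b : Fin (D.nB h)) (r : ℝ) (s' : ℕ),
      σ.log[k * D.H + h]? = some ⟨h, s, a, b, r, s'⟩ ∧
      (viULCB D β nash (σ.log.take (k * D.H))).1 h s = PMF.pure a ∧
      (viULCB D β nash (σ.log.take (k * D.H))).2 h s = PMF.pure b

end

end MG

namespace MG

/-! ## Vector games -/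

/-! A player with one action has one mixed strategy. In a vector game one Nash condition is
therefore vacuous, and the other is the optimization of a linear function over a simplex, which is
solved at a vertex.

The regret bound is optimism followed by a counting of visits. Suppose that at every visited cell
the empirical and the true transition vectors are so close in ℓ¹ that they integrate functions
bounded by `H` to within the bonus (`Stats.Accurate`). Backward induction then shows that the upper
value dominates the return of every max-policy against the deployed min-policy, and that the lower
value is dominated by the return of the deployed max-policy against every min-policy
(`values_optimistic`). The two Nash conditions are what allows an arbitrary response to be exchanged
for the deployed one, step by step. So the regret of an episode is at most the gap of the two
values. Both are payoffs under the same deployed pair, hence the gap obeys a Bellman inequality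
whose local term is `min H (3 * β t)` (`values_gap_le`), and it is at most the expected sum of these
widths along the play. Azuma's inequality (`prob_pastSum_expReturn_sub_ge_le`) replaces expected
widths by realized ones. Those depend only on visit counts, and `∑ 1 / √t` with Cauchy-Schwarz
bounds their total by a multiple of `√(cells * T)` (`potential_le`). In a turn-based game there are
at most `H * S * (A + B)` cells, because one factor of `nA h * nB h` is `1`.

Accuracy holds with high probability because, for each cell and each choice of signs, the
exponential of the signed count deviation minus a multiple of the visit count is a supermartingale
along the whole adaptive interaction (`lexpect_exp_deviation_le_one`). The union bound runs over
cells, `2 ^ S` sign vectors, visit counts and episodes. The factor `2 ^ S` is the reason for the `S`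
in the bonus.

For the running time an explicit program is verified by loop invariants on the memory, with two
frame rules, by array name (`Prog.run_nat`, `Prog.run_real`) and by index prefix
(`Prog.sameOff_run`). All loop lengths are read from input arrays that are never overwritten, so the
time is bounded by a polynomial obtained by recursion on the program text (`exec_time_le`). -/

theorem PMF_eq_of_subsingleton {α : Type*} [Subsingleton α] (p q : PMF α) : p = q := by
  obtain ⟨a, ha⟩ := p.support_nonempty
  have h : ∀ r : PMF α, r a = 1 := fun r => by
    rw [PMF.apply_eq_one_iff]
    ext x
    rw [Subsingleton.elim x a]
    obtain ⟨y, hy⟩ := r.support_nonempty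
    rw [Subsingleton.elim y a] at hy
    simp [(PMF.mem_support_iff _ _).1 hy]
  ext x
  rw [Subsingleton.elim x a, h p, h q]

theorem sum_toReal_eq_one {α : Type*} [Fintype α] (p : PMF α) : ∑ a, (p a).toReal = 1 := by
  rw [← ENNReal.toReal_sum fun a _ => p.apply_ne_top a, ← tsum_fintype (L := .unconditional α),
    p.tsum_coe, ENNReal.toReal_one]

theorem sum_toReal_mul_le {α : Type*} [Fintype α] (p : PMF α) (f : α → ℝ) (C : ℝ)
    (h : ∀ a, f a ≤ C) : ∑ a, (p a).toReal * f a ≤ C := by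
  calc ∑ a, (p a).toReal * f a ≤ ∑ a, (p a).toReal * C :=
        Finset.sum_le_sum fun a _ => mul_le_mul_of_nonneg_left (h a) ENNReal.toReal_nonneg
    _ = C := by rw [← Finset.sum_mul, sum_toReal_eq_one, one_mul]

theorem le_sum_toReal_mul {α : Type*} [Fintype α] (p : PMF α) (f : α → ℝ) (C : ℝ)
    (h : ∀ a, C ≤ f a) : C ≤ ∑ a, (p a).toReal * f a := by
  calc C = ∑ a, (p a).toReal * C := by rw [← Finset.sum_mul, sum_toReal_eq_one, one_mul]
    _ ≤ _ := Finset.sum_le_sum fun a _ => mul_le_mul_of_nonneg_left (h a) ENNReal.toReal_nonneg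

theorem sum_pure_toReal_mul {α : Type*} [Fintype α] [DecidableEq α] (a : α) (f : α → ℝ) :
    ∑ x, ((PMF.pure a : PMF α) x).toReal * f x = f a := by
  rw [Finset.sum_eq_single a] <;> simp +contextual [PMF.pure_apply]

theorem payoff_eq_sum_sum {m n : ℕ} (φ : PMF (Fin m)) (M : Fin m → Fin n → ℝ)
    (ψ : PMF (Fin n)) :
    payoff φ M ψ = ∑ a, (φ a).toReal * ∑ b, (ψ b).toReal * M a b := by
  simp only [payoff, Finset.mul_sum, mul_assoc]

theorem payoff_mono {m n : ℕ} (φ : PMF (Fin m)) (ψ : PMF (Fin n)) {M M' : Fin m → Fin n → ℝ}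
    (h : ∀ a b, M a b ≤ M' a b) : payoff φ M ψ ≤ payoff φ M' ψ :=
  Finset.sum_le_sum fun a _ => Finset.sum_le_sum fun b _ =>
    mul_le_mul_of_nonneg_left (h a b) (by positivity)

theorem payoff_sub {m n : ℕ} (φ : PMF (Fin m)) (ψ : PMF (Fin n)) (M M' : Fin m → Fin n → ℝ) :
    payoff φ (fun a b => M a b - M' a b) ψ = payoff φ M ψ - payoff φ M' ψ := by
  simp only [payoff, mul_sub, Finset.sum_sub_distrib]

theorem payoff_const {m n : ℕ} (φ : PMF (Fin m)) (ψ : PMF (Fin n)) (C : ℝ) :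
    payoff φ (fun _ _ => C) ψ = C := by
  simp only [payoff_eq_sum_sum, ← Finset.sum_mul, sum_toReal_eq_one, one_mul]

theorem payoff_pure_pure {m n : ℕ} (a : Fin m) (b : Fin n) (M : Fin m → Fin n → ℝ) :
    payoff (PMF.pure a) M (PMF.pure b) = M a b := by
  rw [payoff_eq_sum_sum, sum_pure_toReal_mul, sum_pure_toReal_mul]

/-- The min-player has only one mixed strategy, so any deviation equals the strategy itself. -/
theorem isNash_column_iff {m : ℕ} (P Q : Fin m → Fin 1 → ℝ) (φ : PMF (Fin m))
    (ψ : PMF (Fin 1)) : IsNash P Q φ ψ ↔ ∀ φ', payoff φ' P ψ ≤ payoff φ P ψ :=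
  ⟨fun h => h.1, fun h => ⟨h, fun ψ' => by rw [PMF_eq_of_subsingleton ψ' ψ]⟩⟩

theorem isNash_row_iff {n : ℕ} (P Q : Fin 1 → Fin n → ℝ) (φ : PMF (Fin 1))
    (ψ : PMF (Fin n)) : IsNash P Q φ ψ ↔ ∀ ψ', payoff φ Q ψ ≤ payoff φ Q ψ' :=
  ⟨fun h => h.2, fun h => ⟨fun φ' => by rw [PMF_eq_of_subsingleton φ' φ], h⟩⟩

/-- The payoff is an average of the column entries with weights `φ'`, hence at most the largest
entry. -/
theorem isNash_pure_column {m : ℕ} (P Q : Fin m → Fin 1 → ℝ) (a : Fin m)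
    (h : ∀ a', P a' 0 ≤ P a 0) : IsNash P Q (PMF.pure a) (PMF.pure 0) := by
  rw [isNash_column_iff]
  intro φ'
  rw [payoff_pure_pure, payoff_eq_sum_sum]
  refine sum_toReal_mul_le _ _ _ fun a' => ?_
  rw [sum_pure_toReal_mul]
  exact h a'

theorem isNash_pure_row {n : ℕ} (P Q : Fin 1 → Fin n → ℝ) (b : Fin n)
    (h : ∀ b', Q 0 b ≤ Q 0 b') : IsNash P Q (PMF.pure 0) (PMF.pure b) := by
  rw [isNash_row_iff]
  intro ψ'
  rw [payoff_pure_pure, payoff_eq_sum_sum, sum_pure_toReal_mul]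
  exact le_sum_toReal_mul _ _ _ fun b' => h b'

theorem argmax_spec {n : ℕ} [NeZero n] (f : Fin n → ℝ) (a : Fin n) : f a ≤ f (argmax f) := by
  classical
  exact (Finset.mem_filter.1 (Finset.min'_mem _ (maximizers_nonempty f))).2 a

theorem argmin_spec {n : ℕ} [NeZero n] (f : Fin n → ℝ) (b : Fin n) : f (argmin f) ≤ f b :=
  neg_le_neg_iff.1 (argmax_spec (fun b => -f b) b)

theorem solvesVectorGames_vectorNash : SolvesVectorGames vectorNash := by
  rintro m n _ _ (rfl | rfl) P Q
  · rw [PMF_eq_of_subsingleton (vectorNash 1 n P Q).1 (PMF.pure 0)]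
    exact isNash_pure_row P Q _ (argmin_spec _)
  · rw [PMF_eq_of_subsingleton (vectorNash m 1 P Q).2 (PMF.pure 0)]
    exact isNash_pure_column P Q _ (argmax_spec _)

noncomputable section

/-! ## Expectations -/

/-- The expectation of a nonnegative function. -/
def lexpect {α : Type*} (p : PMF α) (f : α → ENNReal) : ENNReal := ∑' x, p x * f x

/-- The expectation of a real function (meant for laws of finite support). -/
def expect {α : Type*} (p : PMF α) (f : α → ℝ) : ℝ := ∑' x, (p x).toReal * f x

theorem lexpect_pure {α : Type*} (a : α) (f : α → ENNReal) : lexpect (PMF.pure a) f = f a := by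
  classical
  rw [lexpect, tsum_eq_single a] <;> simp +contextual [PMF.pure_apply]

theorem lexpect_bind {α β : Type*} (p : PMF α) (q : α → PMF β) (f : β → ENNReal) :
    lexpect (p.bind q) f = lexpect p fun a => lexpect (q a) f := by
  simp only [lexpect, PMF.bind_apply, ← ENNReal.tsum_mul_right, ← ENNReal.tsum_mul_left]
  rw [ENNReal.tsum_comm]
  simp only [mul_assoc]

theorem lexpect_map {α β : Type*} (p : PMF α) (g : α → β) (f : β → ENNReal) :
    lexpect (p.map g) f = lexpect p fun a => f (g a) := by
  rw [← PMF.bind_pure_comp, lexpect_bind]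
  simp only [Function.comp, lexpect_pure]

theorem lexpect_mono {α : Type*} (p : PMF α) {f g : α → ENNReal}
    (h : ∀ x ∈ p.support, f x ≤ g x) : lexpect p f ≤ lexpect p g := by
  refine ENNReal.tsum_le_tsum fun x => ?_
  by_cases hx : p x = 0
  · simp [hx]
  · gcongr
    exact h x hx

theorem lexpect_const {α : Type*} (p : PMF α) (c : ENNReal) : lexpect p (fun _ => c) = c := by
  rw [lexpect, ENNReal.tsum_mul_right, p.tsum_coe, one_mul]

theorem lexpect_const_mul {α : Type*} (p : PMF α) (c : ENNReal) (f : α → ENNReal) :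
    lexpect p (fun x => c * f x) = c * lexpect p f := by
  simp only [lexpect, ← ENNReal.tsum_mul_left, mul_left_comm]

theorem lexpect_le {α : Type*} (p : PMF α) {f : α → ENNReal} {c : ENNReal}
    (h : ∀ x ∈ p.support, f x ≤ c) : lexpect p f ≤ c :=
  (lexpect_mono p h).trans_eq (lexpect_const p c)

theorem lexpect_add {α : Type*} (p : PMF α) (f g : α → ENNReal) :
    lexpect p (fun x => f x + g x) = lexpect p f + lexpect p g := by
  simp only [lexpect, mul_add, ENNReal.tsum_add]

theorem lexpect_sum {α κ : Type*} (p : PMF α) (s : Finset κ) (f : κ → α → ENNReal) :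
    lexpect p (fun x => ∑ i ∈ s, f i x) = ∑ i ∈ s, lexpect p (f i) := by
  simp only [lexpect, Finset.mul_sum]
  exact Summable.tsum_finsetSum fun _ _ => ENNReal.summable

/-! ### Probabilities of events: union bounds and Chernoff's bound. -/

open Classical in
/-- The probability of an event. -/
def prob {α : Type*} (p : PMF α) (E : α → Prop) : ENNReal :=
  lexpect p fun x => if E x then 1 else 0

theorem toOuterMeasure_eq_prob {α : Type*} (p : PMF α) (E : α → Prop) :
    p.toOuterMeasure {x | E x} = prob p E := by
  classical
  rw [PMF.toOuterMeasure_apply, prob, lexpect]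
  refine tsum_congr fun x => ?_
  by_cases h : E x <;> simp [h]

theorem prob_mono {α : Type*} (p : PMF α) {E F : α → Prop} (h : ∀ x ∈ p.support, E x → F x) :
    prob p E ≤ prob p F := by
  classical
  refine lexpect_mono p fun x hx => ?_
  by_cases hE : E x
  · simp [hE, h x hx hE]
  · simp [hE]

theorem prob_or_le {α : Type*} (p : PMF α) (E F : α → Prop) :
    prob p (fun x => E x ∨ F x) ≤ prob p E + prob p F := by
  classical
  rw [prob, prob, prob, ← lexpect_add]
  refine lexpect_mono p fun x _ => ?_
  by_cases hE : E x <;> by_cases hF : F x <;> simp [hE, hF]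

theorem one_le_prob_add_prob_not {α : Type*} (p : PMF α) (E : α → Prop) :
    1 ≤ prob p E + prob p fun x => ¬E x := by
  classical
  rw [prob, prob, ← lexpect_add, ← lexpect_const p 1]
  refine lexpect_mono p fun x _ => ?_
  by_cases hE : E x <;> simp [hE, lexpect_const]

theorem prob_exists_le {α κ : Type*} (p : PMF α) (s : Finset κ) (E : κ → α → Prop) :
    prob p (fun x => ∃ i ∈ s, E i x) ≤ ∑ i ∈ s, prob p (E i) := by
  classical
  simp only [prob]
  rw [← lexpect_sum]
  refine lexpect_mono p fun x _ => ?_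
  split_ifs with h
  · obtain ⟨i, hi, hE⟩ := h
    refine le_trans ?_ (Finset.single_le_sum (fun _ _ => zero_le) hi)
    simp [hE]
  · exact zero_le

/-- Chernoff's bound. -/
theorem prob_le_exp_neg {α : Type*} (p : PMF α) (Y : α → ℝ) (L : ℝ)
    (h : lexpect p (fun x => ENNReal.ofReal (Real.exp (Y x))) ≤ 1) :
    prob p (fun x => L ≤ Y x) ≤ ENNReal.ofReal (Real.exp (-L)) := by
  classical
  calc prob p (fun x => L ≤ Y x)
      ≤ lexpect p fun x =>
          ENNReal.ofReal (Real.exp (-L)) * ENNReal.ofReal (Real.exp (Y x)) := by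
        refine lexpect_mono p fun x _ => ?_
        split_ifs with hx
        · rw [← ENNReal.ofReal_mul (Real.exp_nonneg _), ← Real.exp_add]
          rw [← ENNReal.ofReal_one]
          exact ENNReal.ofReal_le_ofReal (Real.one_le_exp (by linarith))
        · exact zero_le
    _ ≤ _ := by
        rw [lexpect_const_mul]
        exact mul_le_of_le_one_right' h

theorem expect_eq_sum {α : Type*} (p : PMF α) (hp : p.support.Finite) (f : α → ℝ) :
    expect p f = ∑ x ∈ hp.toFinset, (p x).toReal * f x := by
  refine tsum_eq_sum fun x hx => ?_
  simp only [Set.Finite.mem_toFinset, PMF.mem_support_iff, not_not] at hx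
  simp [hx]

theorem expect_fintype {α : Type*} [Fintype α] (p : PMF α) (f : α → ℝ) :
    expect p f = ∑ x, (p x).toReal * f x := tsum_fintype _

theorem sum_support_toReal {α : Type*} (p : PMF α) (hp : p.support.Finite) :
    ∑ x ∈ hp.toFinset, (p x).toReal = 1 := by
  rw [← ENNReal.toReal_sum fun a _ => p.apply_ne_top a,
    ← tsum_eq_sum (L := .unconditional α) fun x hx => by simpa using hx, p.tsum_coe,
    ENNReal.toReal_one]

theorem expect_const {α : Type*} (p : PMF α) (hp : p.support.Finite) (c : ℝ) :
    expect p (fun _ => c) = c := by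
  rw [expect_eq_sum p hp, ← Finset.sum_mul, sum_support_toReal, one_mul]

theorem expect_add {α : Type*} (p : PMF α) (hp : p.support.Finite) (f g : α → ℝ) :
    expect p (fun x => f x + g x) = expect p f + expect p g := by
  simp only [expect_eq_sum p hp, mul_add, Finset.sum_add_distrib]

theorem expect_const_mul {α : Type*} (p : PMF α) (c : ℝ) (f : α → ℝ) :
    expect p (fun x => c * f x) = c * expect p f := by
  simp only [expect, ← tsum_mul_left, mul_left_comm]

theorem expect_mono {α : Type*} (p : PMF α) (hp : p.support.Finite) {f g : α → ℝ}
    (h : ∀ x ∈ p.support, f x ≤ g x) : expect p f ≤ expect p g := by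
  rw [expect_eq_sum p hp, expect_eq_sum p hp]
  exact Finset.sum_le_sum fun x hx =>
    mul_le_mul_of_nonneg_left (h x (by simpa using hx)) ENNReal.toReal_nonneg

theorem expect_pure {α : Type*} (a : α) (f : α → ℝ) : expect (PMF.pure a) f = f a := by
  classical
  rw [expect, tsum_eq_single a] <;> simp +contextual [PMF.pure_apply]

/-- The finite supports give the summability needed to exchange the series over `β` with the sum
over `α`. -/
theorem expect_bind {α β : Type*} [Fintype α] (p : PMF α) (q : α → PMF β)
    (hq : ∀ a, (q a).support.Finite) (f : β → ℝ) :
    expect (p.bind q) f = ∑ a, (p a).toReal * expect (q a) f := by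
  have key : ∀ x, ((p.bind q) x).toReal * f x
      = ∑ a, (p a).toReal * ((q a x).toReal * f x) := fun x => by
    rw [PMF.bind_apply, tsum_fintype, ENNReal.toReal_sum, Finset.sum_mul]
    · simp only [ENNReal.toReal_mul, mul_assoc]
    · exact fun a _ => ENNReal.mul_ne_top (p.apply_ne_top a) ((q a).apply_ne_top x)
  simp only [expect, key]
  rw [Summable.tsum_finsetSum]
  · simp only [tsum_mul_left]
  · intro a _
    refine (summable_of_hasFiniteSupport ((hq a).subset fun x hx => ?_)).mul_left _
    rw [PMF.mem_support_iff]
    intro h0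
    simp [h0] at hx

theorem expect_map {α β : Type*} (p : PMF α) (g : α → β) (hg : g.Injective) (f : β → ℝ) :
    expect (p.map g) f = expect p fun a => f (g a) := by
  have hpg : ∀ a, (p.map g) (g a) = p a := fun a => by
    rw [PMF.map_apply, tsum_eq_single a] <;> simp +contextual [hg.eq_iff, eq_comm]
  rw [expect, ← hg.tsum_eq]
  · simp only [hpg]; rfl
  · intro x hx
    have : x ∈ (p.map g).support := by
      rw [PMF.mem_support_iff]
      intro h0
      exact hx (by simp only [h0, ENNReal.toReal_zero, zero_mul])
    obtain ⟨a, -, rfl⟩ := (PMF.mem_support_map_iff _ _ _).1 this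
    exact ⟨a, rfl⟩

/-- The bridge between the two expectations: moment generating functions are bounded with
real-valued `expect`, while supermartingales live in `lexpect`, where no summability has to be
checked. -/
theorem lexpect_ofReal {α : Type*} (p : PMF α) (hp : p.support.Finite) (f : α → ℝ)
    (hf : ∀ x, 0 ≤ f x) :
    lexpect p (fun x => ENNReal.ofReal (f x)) = ENNReal.ofReal (expect p f) := by
  rw [expect, ENNReal.ofReal_tsum_of_nonneg]
  · refine tsum_congr fun x => ?_
    rw [ENNReal.ofReal_mul ENNReal.toReal_nonneg, ENNReal.ofReal_toReal (p.apply_ne_top x)]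
  · exact fun x => mul_nonneg ENNReal.toReal_nonneg (hf x)
  · refine summable_of_hasFiniteSupport (hp.subset fun x hx => ?_)
    rw [PMF.mem_support_iff]
    intro h0
    simp [h0] at hx

/-- For `|y| ≤ 1` this follows from `exp y ≤ 1 + y + y ^ 2`, for `y > 1` from `y ≤ y ^ 2`, and for
`y < -1` from `exp y ≤ 1`. The linear term disappears when a centred variable is averaged, which
gives a Hoeffding-type bound without a convexity argument. -/
theorem exp_le_add_exp_sq (y : ℝ) : Real.exp y ≤ y + Real.exp (y ^ 2) := by
  have hsq := Real.add_one_le_exp (y ^ 2)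
  rcases le_or_gt |y| 1 with h | h
  · have := (abs_le.1 (Real.abs_exp_sub_one_sub_id_le h)).2
    linarith
  · rcases lt_abs.1 h with h | h
    · have : Real.exp y ≤ Real.exp (y ^ 2) := Real.exp_le_exp.2 (by nlinarith)
      linarith
    · have : Real.exp y ≤ 1 := Real.exp_le_one_iff.2 (by linarith)
      nlinarith

/-- A bound for the moment generating function of a bounded centred variable. -/
theorem expect_exp_le {α : Type*} (p : PMF α) (hp : p.support.Finite) (X : α → ℝ) (M lam : ℝ)
    (hX : ∀ x ∈ p.support, |X x - expect p X| ≤ M) :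
    expect p (fun x => Real.exp (lam * (X x - expect p X))) ≤ Real.exp (lam ^ 2 * M ^ 2) := by
  set m := expect p X with hm
  calc expect p (fun x => Real.exp (lam * (X x - m)))
      ≤ expect p (fun x => lam * (X x + -m) + Real.exp (lam ^ 2 * M ^ 2)) := by
        refine expect_mono p hp fun x hx => (exp_le_add_exp_sq _).trans ?_
        rw [← sub_eq_add_neg]
        gcongr
        rw [mul_pow]
        exact mul_le_mul_of_nonneg_left (sq_le_sq' (abs_le.1 (hX x hx)).1 (abs_le.1 (hX x hx)).2)
          (sq_nonneg _)
    _ = _ := by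
        rw [expect_add p hp, expect_const_mul, expect_add p hp, expect_const p hp,
          expect_const p hp, ← hm]
        ring

/-! ## Plays -/

section Rollout

variable {D : Dims} (G : Game D) (μ : MaxPolicy D) (ν : MinPolicy D)

/-- What is observed when the actions `a`, `b` are taken at `(h, s)` and the next state is `s'`. -/
def Game.obs (h : ℕ) (s : Fin (D.nS h)) (a : Fin (D.nA h)) (b : Fin (D.nB h))
    (s' : Fin (D.nS (h + 1))) : Obs := ⟨h, s, a, b, G.r h s a b, s'⟩

theorem mem_support_rollout_succ {n h : ℕ} {s : Fin (D.nS h)} {τ : List Obs}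
    (hτ : τ ∈ (rollout G μ ν (n + 1) h s).support) :
    ∃ a b s' τ', τ = G.obs h s a b s' :: τ' ∧ τ' ∈ (rollout G μ ν n (h + 1) s').support := by
  rw [rollout, PMF.mem_support_bind_iff] at hτ
  obtain ⟨a, -, hτ⟩ := hτ
  rw [PMF.mem_support_bind_iff] at hτ
  obtain ⟨b, -, hτ⟩ := hτ
  rw [PMF.mem_support_bind_iff] at hτ
  obtain ⟨s', -, hτ⟩ := hτ
  rw [PMF.mem_support_map_iff] at hτ
  obtain ⟨τ', h', rfl⟩ := hτ
  exact ⟨a, b, s', τ', rfl, h'⟩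

theorem eq_nil_of_mem_support_rollout_zero {h : ℕ} {s : Fin (D.nS h)} {τ : List Obs}
    (hτ : τ ∈ (rollout G μ ν 0 h s).support) : τ = [] := by
  simpa [rollout] using hτ

theorem finite_support_rollout (n h : ℕ) (s : Fin (D.nS h)) :
    (rollout G μ ν n h s).support.Finite := by
  induction n generalizing h with
  | zero => simp [rollout]
  | succ n ih =>
    simp only [rollout, PMF.support_bind, PMF.support_map]
    exact (Set.toFinite _).biUnion fun a _ => (Set.toFinite _).biUnion fun b _ =>
      (Set.toFinite _).biUnion fun s' _ => (ih _ _).image _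

theorem length_of_mem_support_rollout {n h : ℕ} {s : Fin (D.nS h)} {τ : List Obs}
    (hτ : τ ∈ (rollout G μ ν n h s).support) : τ.length = n := by
  induction n generalizing h τ with
  | zero => simp [eq_nil_of_mem_support_rollout_zero G μ ν hτ]
  | succ n ih =>
    obtain ⟨a, b, s', τ', rfl, h'⟩ := mem_support_rollout_succ G μ ν hτ
    simp [ih h']

/-- The observation is in agreement with the rewards of the game. -/
def Game.Produces (x : Obs) : Prop := ∃ h s a b s', x = G.obs h s a b s'

theorem produces_of_mem_rollout {n h : ℕ} {s : Fin (D.nS h)} {τ : List Obs}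
    (hτ : τ ∈ (rollout G μ ν n h s).support) : ∀ x ∈ τ, G.Produces x := by
  induction n generalizing h τ with
  | zero => simp [eq_nil_of_mem_support_rollout_zero G μ ν hτ]
  | succ n ih =>
    obtain ⟨a, b, s', τ', rfl, h'⟩ := mem_support_rollout_succ G μ ν hτ
    simp only [List.mem_cons, forall_eq_or_imp]
    exact ⟨⟨h, s, a, b, s', rfl⟩, ih h'⟩

/-- The expected sum of `φ` over a play of `n` steps. -/
def expReturn (φ : Obs → ℝ) (n h : ℕ) (s : Fin (D.nS h)) : ℝ :=
  expect (rollout G μ ν n h s) fun τ => (τ.map φ).sum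

theorem expReturn_zero (φ : Obs → ℝ) (h : ℕ) (s : Fin (D.nS h)) :
    expReturn G μ ν φ 0 h s = 0 := by
  simp [expReturn, rollout, expect_pure]

/-- The Bellman recursion. It unfolds the three random choices of one step, and `expect_bind` needs
the finiteness of the support at each level. -/
theorem expReturn_succ (φ : Obs → ℝ) (n h : ℕ) (s : Fin (D.nS h)) :
    expReturn G μ ν φ (n + 1) h s = payoff (μ h s) (fun a b => ∑ s', (G.P h s a b s').toReal *
      (φ (G.obs h s a b s') + expReturn G μ ν φ n (h + 1) s')) (ν h s) := by
  have hfin := finite_support_rollout G μ ν n (h + 1)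
  have h3 : ∀ a b s', ((rollout G μ ν n (h + 1) s').map
      fun τ => G.obs h s a b s' :: τ).support.Finite := fun a b s' => by
    rw [PMF.support_map]; exact (hfin s').image _
  have h2 : ∀ a b, ((G.P h s a b).bind fun s' => (rollout G μ ν n (h + 1) s').map
      fun τ => G.obs h s a b s' :: τ).support.Finite := fun a b => by
    rw [PMF.support_bind]; exact (Set.toFinite _).biUnion fun s' _ => h3 a b s'
  have h1 : ∀ a, ((ν h s).bind fun b => (G.P h s a b).bind fun s' =>
      (rollout G μ ν n (h + 1) s').map
      fun τ => G.obs h s a b s' :: τ).support.Finite := fun a => by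
    rw [PMF.support_bind]; exact (Set.toFinite _).biUnion fun b _ => h2 a b
  rw [payoff_eq_sum_sum, expReturn]
  refine (expect_bind _ _ h1 _).trans (Finset.sum_congr rfl fun a _ => ?_)
  congr 1
  refine (expect_bind _ _ (h2 a) _).trans (Finset.sum_congr rfl fun b _ => ?_)
  congr 1
  refine (expect_bind _ _ (h3 a b) _).trans (Finset.sum_congr rfl fun s' _ => ?_)
  congr 1
  rw [expect_map _ _ List.cons_injective]
  simp only [List.map_cons, List.sum_cons]
  rw [expect_add _ (hfin s'), expect_const _ (hfin s')]
  rfl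

theorem expReturn_mem_Icc (φ : Obs → ℝ) (M : ℝ)
    (hφ : ∀ h s a b s', φ (G.obs h s a b s') ∈ Set.Icc 0 M) (n h : ℕ) (s : Fin (D.nS h)) :
    expReturn G μ ν φ n h s ∈ Set.Icc 0 (n * M) := by
  induction n generalizing h with
  | zero => simp [expReturn_zero]
  | succ n ih =>
    rw [expReturn_succ]
    constructor
    · rw [← payoff_const (μ h s) (ν h s) 0]
      exact payoff_mono _ _ fun a b => le_sum_toReal_mul _ _ _ fun s' =>
        add_nonneg (hφ h s a b s').1 (ih _ s').1
    · rw [← payoff_const (μ h s) (ν h s) (((n + 1 : ℕ) : ℝ) * M)]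
      refine payoff_mono _ _ fun a b => sum_toReal_mul_le _ _ _ fun s' => ?_
      have h1 := (hφ h s a b s').2
      have h2 := (ih _ s').2
      push_cast
      linarith

theorem expReturn_reward_mem_Icc (n h : ℕ) (s : Fin (D.nS h)) :
    expReturn G μ ν Obs.r n h s ∈ Set.Icc (0 : ℝ) n := by
  simpa using expReturn_mem_Icc G μ ν Obs.r 1 (fun h s a b s' => G.r_mem h s a b) n h s

theorem expReturn_reward_succ (n h : ℕ) (s : Fin (D.nS h)) :
    expReturn G μ ν Obs.r (n + 1) h s = payoff (μ h s) (fun a b => G.r h s a b +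
      ∑ s', (G.P h s a b s').toReal * expReturn G μ ν Obs.r n (h + 1) s') (ν h s) := by
  rw [expReturn_succ]
  congr
  ext a b
  simp only [mul_add, Finset.sum_add_distrib]
  congr 1
  change ∑ s', (G.P h s a b s').toReal * G.r h s a b = _
  rw [← Finset.sum_mul, sum_toReal_eq_one, one_mul]

theorem sum_map_mem_Icc_of_mem_rollout (φ : Obs → ℝ) (M : ℝ)
    (hφ : ∀ h s a b s', φ (G.obs h s a b s') ∈ Set.Icc 0 M) {n h : ℕ} {s : Fin (D.nS h)}
    {τ : List Obs} (hτ : τ ∈ (rollout G μ ν n h s).support) :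
    (τ.map φ).sum ∈ Set.Icc 0 (n * M) := by
  induction n generalizing h τ with
  | zero => simp [eq_nil_of_mem_support_rollout_zero G μ ν hτ]
  | succ n ih =>
    obtain ⟨a, b, s', τ', rfl, h'⟩ := mem_support_rollout_succ G μ ν hτ
    have h1 := hφ h s a b s'
    have h2 := ih h'
    simp only [List.map_cons, List.sum_cons, Nat.cast_succ]
    exact ⟨add_nonneg h1.1 h2.1, by linarith [h1.2, h2.2]⟩

theorem bestMax_le {h : ℕ} {s : Fin (D.nS h)} {C : ℝ}
    (hC : ∀ μ, value G μ ν h s ≤ C) : bestMax G ν h s ≤ C :=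
  haveI : Nonempty (MaxPolicy D) := ⟨fun _ _ => PMF.pure 0⟩
  ciSup_le hC

theorem le_bestMin {h : ℕ} {s : Fin (D.nS h)} {C : ℝ}
    (hC : ∀ ν, C ≤ value G μ ν h s) : C ≤ bestMin G μ h s :=
  haveI : Nonempty (MinPolicy D) := ⟨fun _ _ => PMF.pure 0⟩
  le_ciInf hC

theorem expReturn_reward_congr_of_unique (hA : ∀ h < D.H, D.nA h = 1)
    (hB : ∀ h < D.H, D.nB h = 1) (μ' : MaxPolicy D) (ν' : MinPolicy D) (n h : ℕ)
    (hn : h + n ≤ D.H) (s : Fin (D.nS h)) :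
    expReturn G μ ν Obs.r n h s = expReturn G μ' ν' Obs.r n h s := by
  induction n generalizing h with
  | zero => simp [expReturn_zero]
  | succ n ih =>
    have : Subsingleton (Fin (D.nA h)) := by rw [hA h (by omega)]; infer_instance
    have : Subsingleton (Fin (D.nB h)) := by rw [hB h (by omega)]; infer_instance
    rw [expReturn_reward_succ, expReturn_reward_succ, PMF_eq_of_subsingleton (μ h s) (μ' h s),
      PMF_eq_of_subsingleton (ν h s) (ν' h s)]
    simp only [fun s' => ih (h + 1) (by omega) s']

/-- When neither player has a choice there is no regret. -/
theorem regret_nonpos_of_unique (hA : ∀ h < D.H, D.nA h = 1) (hB : ∀ h < D.H, D.nB h = 1)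
    (alg : Learner D) (hist : List (Episode D)) : regret G alg hist ≤ 0 := by
  refine Finset.sum_nonpos fun k _ => sub_nonpos.2 ?_
  refine bestMax_le G _ fun μ => le_bestMin G _ fun ν => le_of_eq ?_
  exact expReturn_reward_congr_of_unique G _ _ hA hB _ _ _ _ (by omega) _

end Rollout

/-! ## Optimism -/

section Optimism

variable {D : Dims} (G : Game D)

/-- The statistics determine the rewards, and the empirical transition probabilities are close to
the true ones. -/
def Stats.Accurate (β : ℕ → ℝ) (d : Stats) : Prop :=
  ∀ h < D.H, ∀ (s : Fin (D.nS h)) (a : Fin (D.nA h)) (b : Fin (D.nB h)), d.N h s a b ≠ 0 →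
    d.rhat h s a b = G.r h s a b ∧ ∀ f : Fin (D.nS (h + 1)) → ℝ, (∀ s', |f s'| ≤ D.H) →
      |∑ s' : Fin (D.nS (h + 1)), d.Phat h s a b s' * f s' -
        ∑ s', (G.P h s a b s').toReal * f s'| ≤ β (d.N h s a b)

theorem Dims.TurnBased.eq_one_or_eq_one (hD : D.TurnBased) {h : ℕ} (hh : h < D.H) :
    D.nA h = 1 ∨ D.nB h = 1 := by
  obtain ⟨Hmax, Hmin, -, hu, h1, h2⟩ := hD
  rcases Finset.mem_union.1 (hu ▸ Finset.mem_range.2 hh) with h' | h'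
  · exact Or.inr (h2 h h')
  · exact Or.inl (h1 h h')

variable {nash : Subroutine} {β : ℕ → ℝ}

/-- The comparison is with best responses to the deployed policies, not with the value of the game.
The range bounds belong to the same induction, since accuracy may be applied only to functions
bounded by `H`. It is uniform over such functions, so it does not matter that the value estimates
depend on the data. -/
theorem values_optimistic (hnash : SolvesVectorGames nash) (hD : D.TurnBased) (l : List Obs)
    (hl : (statsOf l).Accurate G β) (n h : ℕ) (hn : h + n = D.H) (s : Fin (D.nS h)) :
    (∀ μ, expReturn G μ (viULCB D β nash l).2 Obs.r n h s
      ≤ (values D β nash (statsOf l) n h).1 s) ∧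
    (values D β nash (statsOf l) n h).1 s ≤ D.H ∧
    (∀ ν, (values D β nash (statsOf l) n h).2 s
      ≤ expReturn G (viULCB D β nash l).1 ν Obs.r n h s) ∧
    0 ≤ (values D β nash (statsOf l) n h).2 s := by
  induction n generalizing h with
  | zero => simp [expReturn_zero, values]
  | succ n ih =>
    have ih := ih (h + 1) (by omega)
    set V := values D β nash (statsOf l) n (h + 1) with hV
    have hn' : D.H - (h + 1) = n := by omega
    have hup : Qup D β nash (statsOf l) h = updUp D β (statsOf l) h V.1 := by
      rw [Qup, Vup, hn']
    have hlow : Qlow D β nash (statsOf l) h = updLow D β (statsOf l) h V.2 := by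
      rw [Qlow, Vlow, hn']
    have hN := hnash _ _ (hD.eq_one_or_eq_one (h := h) (by omega))
      (updUp D β (statsOf l) h V.1 s) (updLow D β (statsOf l) h V.2 s)
    have hμ : (viULCB D β nash l).1 h s = (nash _ _ (updUp D β (statsOf l) h V.1 s)
        (updLow D β (statsOf l) h V.2 s)).1 := by simp only [viULCB, hup, hlow]
    have hν : (viULCB D β nash l).2 h s = (nash _ _ (updUp D β (statsOf l) h V.1 s)
        (updLow D β (statsOf l) h V.2 s)).2 := by simp only [viULCB, hup, hlow]
    rw [← hμ, ← hν] at hN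
    have hnH : ((n : ℝ) + 1) ≤ D.H := by
      exact_mod_cast (by omega : n + 1 ≤ D.H)
    have hval := fun μ ν s' => expReturn_reward_mem_Icc G μ ν n (h + 1) s'
    have hr := fun a b => G.r_mem h s a b
    -- The lower half of this bound is itself a consequence of optimism, as returns are nonnegative.
    have hVup : ∀ s', |V.1 s'| ≤ D.H := fun s' => abs_le.2
      ⟨by linarith [(ih s').1 (viULCB D β nash l).1,
        (hval (viULCB D β nash l).1 (viULCB D β nash l).2 s').1, Nat.cast_nonneg (α := ℝ) D.H],
        (ih s').2.1⟩
    have hVlow : ∀ s', |V.2 s'| ≤ D.H := fun s' => abs_le.2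
      ⟨by linarith [(ih s').2.2.2, Nat.cast_nonneg (α := ℝ) D.H],
        by linarith [(ih s').2.2.1 (viULCB D β nash l).2,
          (hval (viULCB D β nash l).1 (viULCB D β nash l).2 s').2]⟩
    have e1 : (values D β nash (statsOf l) (n + 1) h).1 s = payoff ((viULCB D β nash l).1 h s)
        (updUp D β (statsOf l) h V.1 s) ((viULCB D β nash l).2 h s) := by rw [hμ, hν]; rfl
    have e2 : (values D β nash (statsOf l) (n + 1) h).2 s = payoff ((viULCB D β nash l).1 h s)
        (updLow D β (statsOf l) h V.2 s) ((viULCB D β nash l).2 h s) := by rw [hμ, hν]; rfl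
    rw [e1, e2]
    refine ⟨fun μ => ?_, ?_, fun ν => ?_, ?_⟩
    · rw [expReturn_reward_succ]
      -- Entry by entry the one-step return is at most the upper `Q`; the Nash condition of the
      -- max-player then exchanges `μ` for the deployed policy. The truncation at `H` does no harm
      -- because `n + 1 ≤ H` rewards remain.
      refine (payoff_mono _ _ fun a b => ?_).trans (hN.1 (μ h s))
      have hP : ∑ s', (G.P h s a b s').toReal *
          expReturn G μ (viULCB D β nash l).2 Obs.r n (h + 1) s' ≤ n :=
        sum_toReal_mul_le _ _ _ fun s' => (hval _ _ s').2
      have hP' : ∑ s', (G.P h s a b s').toReal *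
          expReturn G μ (viULCB D β nash l).2 Obs.r n (h + 1) s' ≤
          ∑ s', (G.P h s a b s').toReal * V.1 s' := Finset.sum_le_sum fun s' _ =>
        mul_le_mul_of_nonneg_left ((ih s').1 μ) ENNReal.toReal_nonneg
      rw [updUp]
      split_ifs with h0
      · linarith [(hr a b).2]
      · obtain ⟨h1, h2⟩ := hl h (by omega) s a b h0
        have := (abs_le.1 (h2 _ hVup)).1
        rw [h1]
        exact le_min (by linarith) (by linarith [(hr a b).2])
    · rw [← payoff_const ((viULCB D β nash l).1 h s) ((viULCB D β nash l).2 h s) D.H]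
      refine payoff_mono _ _ fun a b => ?_
      rw [updUp]
      split_ifs
      · exact le_rfl
      · exact min_le_right _ _
    · rw [expReturn_reward_succ]
      refine (hN.2 (ν h s)).trans (payoff_mono _ _ fun a b => ?_)
      have hP : 0 ≤ ∑ s', (G.P h s a b s').toReal *
          expReturn G (viULCB D β nash l).1 ν Obs.r n (h + 1) s' :=
        le_sum_toReal_mul _ _ _ fun s' => (hval _ _ s').1
      have hP' : ∑ s', (G.P h s a b s').toReal * V.2 s' ≤ ∑ s', (G.P h s a b s').toReal *
          expReturn G (viULCB D β nash l).1 ν Obs.r n (h + 1) s' := Finset.sum_le_sum fun s' _ =>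
        mul_le_mul_of_nonneg_left ((ih s').2.2.1 ν) ENNReal.toReal_nonneg
      rw [updLow]
      split_ifs with h0
      · linarith [(hr a b).1]
      · obtain ⟨h1, h2⟩ := hl h (by omega) s a b h0
        have := (abs_le.1 (h2 _ hVlow)).2
        rw [h1]
        exact max_le (by linarith) (by linarith [(hr a b).1])
    · rw [← payoff_const ((viULCB D β nash l).1 h s) ((viULCB D β nash l).2 h s) 0]
      refine payoff_mono _ _ fun a b => ?_
      rw [updLow]
      split_ifs
      · exact le_rfl
      · exact le_max_right _ _

/-- Both values are payoffs under the deployed pair, so their difference satisfies a Bellman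
inequality for exactly this pair. A visited cell contributes at most `3 * β`: two bonuses, plus one
error of the empirical transitions applied to the difference of the two values, which lies in `[0,
H]`. -/
theorem values_gap_le (hnash : SolvesVectorGames nash) (hD : D.TurnBased) (l : List Obs)
    (hl : (statsOf l).Accurate G β) (g : ℕ → ℝ) (hg0 : (D.H : ℝ) ≤ g 0)
    (hg : ∀ t ≠ 0, min (D.H : ℝ) (3 * β t) ≤ g t) (n h : ℕ) (hn : h + n = D.H)
    (s : Fin (D.nS h)) :
    (values D β nash (statsOf l) n h).1 s - (values D β nash (statsOf l) n h).2 s ≤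
      expReturn G (viULCB D β nash l).1 (viULCB D β nash l).2
        (fun x => g ((statsOf l).N x.h x.s x.a x.b)) n h s := by
  induction n generalizing h with
  | zero => simp [expReturn_zero, values]
  | succ n ih =>
    have ih := ih (h + 1) (by omega)
    have hopt := values_optimistic G hnash hD l hl n (h + 1) (by omega)
    set V := values D β nash (statsOf l) n (h + 1) with hV
    have hn' : D.H - (h + 1) = n := by omega
    have hup : Qup D β nash (statsOf l) h = updUp D β (statsOf l) h V.1 := by
      rw [Qup, Vup, hn']
    have hlow : Qlow D β nash (statsOf l) h = updLow D β (statsOf l) h V.2 := by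
      rw [Qlow, Vlow, hn']
    have hμ : (viULCB D β nash l).1 h s = (nash _ _ (updUp D β (statsOf l) h V.1 s)
        (updLow D β (statsOf l) h V.2 s)).1 := by simp only [viULCB, hup, hlow]
    have hν : (viULCB D β nash l).2 h s = (nash _ _ (updUp D β (statsOf l) h V.1 s)
        (updLow D β (statsOf l) h V.2 s)).2 := by simp only [viULCB, hup, hlow]
    have e1 : (values D β nash (statsOf l) (n + 1) h).1 s = payoff ((viULCB D β nash l).1 h s)
        (updUp D β (statsOf l) h V.1 s) ((viULCB D β nash l).2 h s) := by rw [hμ, hν]; rfl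
    have e2 : (values D β nash (statsOf l) (n + 1) h).2 s = payoff ((viULCB D β nash l).1 h s)
        (updLow D β (statsOf l) h V.2 s) ((viULCB D β nash l).2 h s) := by rw [hμ, hν]; rfl
    rw [e1, e2, ← payoff_sub, expReturn_succ]
    refine payoff_mono _ _ fun a b => ?_
    have hgap0 : ∀ s', 0 ≤ V.1 s' - V.2 s' := fun s' => sub_nonneg.2
      (((hopt s').2.2.1 _).trans ((hopt s').1 (viULCB D β nash l).1))
    have hgapH : ∀ s', |V.1 s' - V.2 s'| ≤ D.H := fun s' => by
      rw [abs_of_nonneg (hgap0 s')]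
      linarith [(hopt s').2.1, (hopt s').2.2.2]
    have hP0 : 0 ≤ ∑ s', (G.P h s a b s').toReal * (V.1 s' - V.2 s') :=
      le_sum_toReal_mul _ _ _ hgap0
    have hR : g ((statsOf l).N h s a b) + ∑ s', (G.P h s a b s').toReal * (V.1 s' - V.2 s') ≤
        ∑ s', (G.P h s a b s').toReal * (g ((statsOf l).N h s a b) +
          expReturn G (viULCB D β nash l).1 (viULCB D β nash l).2
            (fun x => g ((statsOf l).N x.h x.s x.a x.b)) n (h + 1) s') := by
      simp only [mul_add, Finset.sum_add_distrib]
      rw [← Finset.sum_mul, sum_toReal_eq_one, one_mul]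
      gcongr with s' _
      exact ih s'
    refine le_trans ?_ hR
    rw [updUp, updLow]
    split_ifs with h0
    · rw [h0]; linarith
    · have hpair := (abs_le.1 ((hl h (by omega) s a b h0).2 _ hgapH)).2
      have hsplit : ∑ s' : Fin (D.nS (h + 1)), (statsOf l).Phat h s a b s' * (V.1 s' - V.2 s') =
          ∑ s' : Fin (D.nS (h + 1)), (statsOf l).Phat h s a b s' * V.1 s' -
          ∑ s' : Fin (D.nS (h + 1)), (statsOf l).Phat h s a b s' * V.2 s' := by
        simp only [mul_sub, Finset.sum_sub_distrib]
      rw [hsplit] at hpair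
      have hgt := hg _ h0
      have u1 := min_le_left ((statsOf l).rhat h s a b + ∑ s' : Fin (D.nS (h + 1)),
        (statsOf l).Phat h s a b s' * V.1 s' + β ((statsOf l).N h s a b)) D.H
      have u2 := min_le_right ((statsOf l).rhat h s a b + ∑ s' : Fin (D.nS (h + 1)),
        (statsOf l).Phat h s a b s' * V.1 s' + β ((statsOf l).N h s a b)) D.H
      have l1 := le_max_left ((statsOf l).rhat h s a b + ∑ s' : Fin (D.nS (h + 1)),
        (statsOf l).Phat h s a b s' * V.2 s' - β ((statsOf l).N h s a b)) 0
      have l2 := le_max_right ((statsOf l).rhat h s a b + ∑ s' : Fin (D.nS (h + 1)),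
        (statsOf l).Phat h s a b s' * V.2 s' - β ((statsOf l).N h s a b)) 0
      -- If `H ≤ g t`, the truncations bound the gap by `H`, and the transition term is nonnegative;
      -- otherwise the untruncated expressions differ by the empirical transition term plus `2 * β`.
      rcases min_le_iff.1 hgt with h1 | h1 <;> linarith

/-- The regret of an episode is at most the expected sum of the confidence widths. -/
theorem regret_term_le (hnash : SolvesVectorGames nash) (hD : D.TurnBased) (l : List Obs)
    (hl : (statsOf l).Accurate G β) (g : ℕ → ℝ) (hg0 : (D.H : ℝ) ≤ g 0)
    (hg : ∀ t ≠ 0, min (D.H : ℝ) (3 * β t) ≤ g t) (s : Fin (D.nS 0)) :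
    bestMax G (viULCB D β nash l).2 0 s - bestMin G (viULCB D β nash l).1 0 s ≤
      expReturn G (viULCB D β nash l).1 (viULCB D β nash l).2
        (fun x => g ((statsOf l).N x.h x.s x.a x.b)) D.H 0 s := by
  have h1 := values_optimistic G hnash hD l hl D.H 0 (by omega) s
  refine le_trans ?_ (values_gap_le G hnash hD l hl g hg0 hg D.H 0 (by omega) s)
  -- `value` at step `0` unfolds to `expReturn` of the reward over `D.H - 0` steps, which reduces to
  -- `D.H`.
  exact sub_le_sub (bestMax_le G _ h1.1)
    (le_bestMin G _ h1.2.2.1)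

end Optimism

/-! ## Statistics -/

section Statistics

theorem statsOf_append_singleton (l : List Obs) (x : Obs) :
    statsOf (l ++ [x]) = (statsOf l).observe x := by
  simp [statsOf, List.foldl_append]

theorem Stats.observe_N_of_ne {d : Stats} {x : Obs} {h s a b : ℕ}
    (hc : ¬(h = x.h ∧ s = x.s ∧ a = x.a ∧ b = x.b)) : (d.observe x).N h s a b = d.N h s a b :=
  if_neg hc

theorem Stats.observe_Ntr_of_ne {d : Stats} {x : Obs} {h s a b s' : ℕ}
    (hc : ¬(h = x.h ∧ s = x.s ∧ a = x.a ∧ b = x.b ∧ s' = x.s')) :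
    (d.observe x).Ntr h s a b s' = d.Ntr h s a b s' :=
  if_neg hc

theorem N_statsOf_le_length (l : List Obs) (h s a b : ℕ) : (statsOf l).N h s a b ≤ l.length := by
  induction l using List.reverseRecOn with
  | nil => simp [statsOf, Stats.init]
  | append_singleton l x ih =>
    rw [statsOf_append_singleton, Stats.observe, List.length_append]
    simp only [List.length_cons, List.length_nil]
    split_ifs <;> omega

variable {D : Dims} (G : Game D)

theorem rhat_statsOf {l : List Obs} (hl : ∀ x ∈ l, G.Produces x) (h : ℕ) (s : Fin (D.nS h))
    (a : Fin (D.nA h)) (b : Fin (D.nB h)) (hN : (statsOf l).N h s a b ≠ 0) :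
    (statsOf l).rhat h s a b = G.r h s a b := by
  induction l using List.reverseRecOn with
  | nil => simp [statsOf, Stats.init] at hN
  | append_singleton l x ih =>
    obtain ⟨h', s', a', b', s'', hx⟩ := hl x (by simp)
    rw [statsOf_append_singleton, Stats.observe] at hN ⊢
    dsimp only at hN ⊢
    split_ifs at hN ⊢ with hc
    · rw [hx] at hc ⊢
      obtain ⟨h1, h2, h3, h4⟩ := hc
      simp only [Game.obs] at h1
      subst h1
      simp only [Game.obs] at h2 h3 h4 ⊢
      rw [Fin.ext h2, Fin.ext h3, Fin.ext h4]
    · exact ih (fun y hy => hl y (by simp [hy])) hN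

/-- Hölder's inequality: the error is at most the ℓ¹ distance times `H`, that is `8 * H * √(w / N)`.
This is where the threshold `8` for the constant of the bonus comes from. -/
theorem accurate_of_sum_abs_le {d : Stats} {β : ℕ → ℝ} {w c : ℝ} (hw : 0 ≤ w) (hc : 8 ≤ c)
    (hβ : ∀ t, β t = c * √((D.H : ℝ) ^ 2 * w / t))
    (hr : ∀ h (s : Fin (D.nS h)) (a : Fin (D.nA h)) (b : Fin (D.nB h)), d.N h s a b ≠ 0 →
      d.rhat h s a b = G.r h s a b)
    (hd : ∀ h < D.H, ∀ (s : Fin (D.nS h)) (a : Fin (D.nA h)) (b : Fin (D.nB h)),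
      d.N h s a b ≠ 0 → ∑ s' : Fin (D.nS (h + 1)), |(d.Ntr h s a b s' : ℝ) -
        d.N h s a b * (G.P h s a b s').toReal| ≤ 8 * √(w * d.N h s a b)) :
    d.Accurate G β := by
  intro h hh s a b hN
  refine ⟨hr h s a b hN, fun f hf => ?_⟩
  have hpos : (0 : ℝ) < d.N h s a b := by exact_mod_cast Nat.pos_of_ne_zero hN
  set N : ℝ := (d.N h s a b : ℝ) with hNdef
  have e : ∑ s' : Fin (D.nS (h + 1)), d.Phat h s a b s' * f s' -
      ∑ s', (G.P h s a b s').toReal * f s' = (∑ s' : Fin (D.nS (h + 1)),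
        ((d.Ntr h s a b s' : ℝ) - N * (G.P h s a b s').toReal) * f s') / N := by
    rw [← Finset.sum_sub_distrib, Finset.sum_div]
    refine Finset.sum_congr rfl fun s' _ => ?_
    rw [Stats.Phat, ← hNdef]
    field_simp
  have hsq : √(w * N) = √(w / N) * N := by
    rw [show w * N = w / N * N ^ 2 by field_simp, Real.sqrt_mul (by positivity),
      Real.sqrt_sq hpos.le]
  rw [e, abs_div, abs_of_pos hpos, div_le_iff₀ hpos, hβ]
  calc |∑ s' : Fin (D.nS (h + 1)), ((d.Ntr h s a b s' : ℝ) - N * (G.P h s a b s').toReal) * f s'|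
      ≤ ∑ s' : Fin (D.nS (h + 1)),
          |(d.Ntr h s a b s' : ℝ) - N * (G.P h s a b s').toReal| * D.H := by
        refine (Finset.abs_sum_le_sum_abs _ _).trans (Finset.sum_le_sum fun s' _ => ?_)
        rw [abs_mul]
        exact mul_le_mul_of_nonneg_left (hf s') (abs_nonneg _)
    _ ≤ 8 * √(w * N) * D.H := by
        rw [← Finset.sum_mul]
        exact mul_le_mul_of_nonneg_right (hd h hh s a b hN) (Nat.cast_nonneg _)
    _ = 8 * √((D.H : ℝ) ^ 2 * w / N) * N := by
        rw [hsq, mul_div_assoc, Real.sqrt_mul (sq_nonneg (D.H : ℝ)),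
          Real.sqrt_sq (Nat.cast_nonneg _)]
        ring
    _ ≤ _ := by gcongr

/-- A step, a state and a pair of actions. -/
abbrev Cell (D : Dims) : Type :=
  (h : Fin D.H) × (Fin (D.nS h) × Fin (D.nA h) × Fin (D.nB h))

/-- The number of visits to a cell. -/
def Stats.visits (d : Stats) (i : Cell D) : ℕ := d.N i.1 i.2.1 i.2.2.1 i.2.2.2

/-- The sum of `g` over all visits, where the `t`-th visit to a cell counts `g t`. -/
def Stats.potential (D : Dims) (g : ℕ → ℝ) (d : Stats) : ℝ :=
  ∑ i : Cell D, ∑ t ∈ Finset.range (d.visits i), g t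

theorem potential_observe (g : ℕ → ℝ) (d : Stats) {h : ℕ} (hh : h < D.H) (s : Fin (D.nS h))
    (a : Fin (D.nA h)) (b : Fin (D.nB h)) (s' : Fin (D.nS (h + 1))) :
    (d.observe (G.obs h s a b s')).potential D g = d.potential D g + g (d.N h s a b) := by
  have key : ∀ i : Cell D, ∑ t ∈ Finset.range ((d.observe (G.obs h s a b s')).visits i), g t =
      ∑ t ∈ Finset.range (d.visits i), g t +
        if i = ⟨⟨h, hh⟩, s, a, b⟩ then g (d.visits i) else 0 := by
    rintro ⟨⟨h', hh'⟩, s₁, a₁, b₁⟩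
    by_cases hi : (⟨⟨h', hh'⟩, s₁, a₁, b₁⟩ : Cell D) = ⟨⟨h, hh⟩, s, a, b⟩
    · rw [if_pos hi]
      cases hi
      simp [Stats.visits, Stats.observe, Game.obs, Finset.sum_range_succ]
    · rw [if_neg hi, add_zero]
      rw [Stats.visits, Stats.visits, Stats.observe_N_of_ne]
      rintro ⟨h1, h2, h3, h4⟩
      obtain rfl : h' = h := h1
      obtain rfl : s₁ = s := Fin.ext h2
      obtain rfl : a₁ = a := Fin.ext h3
      obtain rfl : b₁ = b := Fin.ext h4
      exact hi rfl
  simp only [Stats.potential, key, Finset.sum_add_distrib, Finset.sum_ite_eq', Finset.mem_univ,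
    if_true]
  rfl

/-- The steps of an episode have distinct numbers, so no cell is visited twice in it. The count of a
cell when it is visited is therefore the count at the start of the episode, and widths evaluated
with frozen statistics add up to the exact growth of the potential. -/
theorem potential_rollout (μ : MaxPolicy D) (ν : MinPolicy D) (g : ℕ → ℝ) (d : Stats) {n h : ℕ}
    (hn : h + n ≤ D.H) {s : Fin (D.nS h)} {τ : List Obs}
    (hτ : τ ∈ (rollout G μ ν n h s).support) (l : List Obs)
    (hl : ∀ h' ≥ h, ∀ s a b, (statsOf l).N h' s a b = d.N h' s a b) :
    (statsOf (l ++ τ)).potential D g =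
      (statsOf l).potential D g + (τ.map fun x => g (d.N x.h x.s x.a x.b)).sum := by
  induction n generalizing h τ l with
  | zero => simp [eq_nil_of_mem_support_rollout_zero G μ ν hτ]
  | succ n ih =>
    obtain ⟨a, b, s', τ', rfl, h'⟩ := mem_support_rollout_succ G μ ν hτ
    rw [List.append_cons, ih (by omega) h', statsOf_append_singleton,
      potential_observe G g _ (by omega), List.map_cons, List.sum_cons, hl h le_rfl]
    · rw [add_assoc]; rfl
    · intro h'' hh'' s a b
      rw [statsOf_append_singleton, ← hl h'' (by omega)]
      refine Stats.observe_N_of_ne fun hc => ?_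
      have : h'' = h := hc.1
      omega

end Statistics

/-! ## The law of several episodes -/

section Law

variable {D : Dims} (G : Game D) (alg : Learner D) (adv : Adversary D)

theorem mem_support_law_succ {K : ℕ} {hist : List (Episode D)}
    (h : hist ∈ (law G alg adv (K + 1)).support) :
    ∃ hist' s τ, hist' ∈ (law G alg adv K).support ∧
      τ ∈ (rollout G (alg (allSteps hist')).1 (alg (allSteps hist')).2 D.H 0 s).support ∧
      hist = hist' ++ [⟨s, τ⟩] := by
  rw [law, PMF.mem_support_bind_iff] at h
  obtain ⟨hist', h1, h⟩ := h
  rw [PMF.mem_support_bind_iff] at h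
  obtain ⟨s, -, h⟩ := h
  rw [PMF.mem_support_map_iff] at h
  obtain ⟨τ, h2, rfl⟩ := h
  exact ⟨hist', s, τ, h1, h2, rfl⟩

theorem allSteps_append_singleton (hist : List (Episode D)) (e : Episode D) :
    allSteps (hist ++ [e]) = allSteps hist ++ e.steps := by
  simp [allSteps]

theorem length_allSteps_of_mem_law {K : ℕ} {hist : List (Episode D)}
    (h : hist ∈ (law G alg adv K).support) : (allSteps hist).length = K * D.H := by
  induction K generalizing hist with
  | zero =>
    obtain rfl : hist = [] := by simpa [law] using h
    simp [allSteps]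
  | succ K ih =>
    obtain ⟨hist', s, τ, h1, h2, rfl⟩ := mem_support_law_succ G alg adv h
    rw [allSteps_append_singleton, List.length_append, ih h1,
      length_of_mem_support_rollout _ _ _ h2]
    ring

theorem produces_of_mem_law {K : ℕ} {hist : List (Episode D)}
    (h : hist ∈ (law G alg adv K).support) : ∀ x ∈ allSteps hist, G.Produces x := by
  induction K generalizing hist with
  | zero =>
    obtain rfl : hist = [] := by simpa [law] using h
    simp [allSteps]
  | succ K ih =>
    obtain ⟨hist', s, τ, h1, h2, rfl⟩ := mem_support_law_succ G alg adv h
    rw [allSteps_append_singleton]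
    intro x hx
    rcases List.mem_append.1 hx with hx | hx
    · exact ih h1 x hx
    · exact produces_of_mem_rollout _ _ _ h2 x hx

theorem lexpect_law_succ (K : ℕ) (F : List (Episode D) → ENNReal) :
    lexpect (law G alg adv (K + 1)) F = lexpect (law G alg adv K) fun hist =>
      lexpect (adv hist) fun s => lexpect (rollout G (alg (allSteps hist)).1
        (alg (allSteps hist)).2 D.H 0 s) fun τ => F (hist ++ [⟨s, τ⟩]) := by
  simp only [law, lexpect_bind, lexpect_map]

theorem lexpect_rollout_le {F : List Obs → ENNReal}
    (hF : ∀ l h s a b, lexpect (G.P h s a b) (fun s' => F (l ++ [G.obs h s a b s'])) ≤ F l)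
    (μ : MaxPolicy D) (ν : MinPolicy D) (n h : ℕ) (s : Fin (D.nS h)) (l : List Obs) :
    lexpect (rollout G μ ν n h s) (fun τ => F (l ++ τ)) ≤ F l := by
  induction n generalizing h l with
  | zero => simp [rollout, lexpect_pure]
  | succ n ih =>
    simp only [rollout, lexpect_bind, lexpect_map]
    refine lexpect_le _ fun a _ => lexpect_le _ fun b _ =>
      (lexpect_mono _ fun s' _ => ?_).trans (hF l h s a b)
    simpa [Game.obs] using ih (h + 1) s' (l ++ [G.obs h s a b s'])

/-- A process that does not increase in expectation at any step starts above its final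
expectation. -/
theorem lexpect_law_le {F : List Obs → ENNReal}
    (hF : ∀ l h s a b, lexpect (G.P h s a b) (fun s' => F (l ++ [G.obs h s a b s'])) ≤ F l)
    (K : ℕ) : lexpect (law G alg adv K) (fun hist => F (allSteps hist)) ≤ F [] := by
  induction K with
  | zero => simp [law, lexpect_pure, allSteps]
  | succ K ih =>
    rw [lexpect_law_succ]
    refine (lexpect_mono _ fun hist _ => lexpect_le _ fun s _ => ?_).trans ih
    simpa only [allSteps_append_singleton] using lexpect_rollout_le G hF _ _ _ _ _ _

/-- The first `k` episodes of a longer history are distributed as `law G alg adv k`. Peeling off the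
last episode in the induction builds this into the union bound. Only proper prefixes occur: they are
the pasts from which the deployed policies are computed. -/
theorem prob_law_exists_prefix_le (Bad : List (Episode D) → Prop) (K : ℕ) :
    prob (law G alg adv K) (fun hist => ∃ k < hist.length, Bad (hist.take k)) ≤
      ∑ k ∈ Finset.range K, prob (law G alg adv k) Bad := by
  classical
  induction K with
  | zero => simp [law, prob, lexpect_pure]
  | succ K ih =>
    rw [Finset.sum_range_succ]
    refine le_trans ?_ (add_le_add_left ih _)
    refine le_trans ?_ (prob_or_le _ _ _)
    simp only [prob]
    rw [lexpect_law_succ]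
    refine lexpect_mono _ fun hist _ => lexpect_le _ fun s _ => lexpect_le _ fun τ _ => ?_
    split_ifs with h1 h2
    · exact le_rfl
    · exfalso
      obtain ⟨k, hk, hB⟩ := h1
      simp only [List.length_append, List.length_cons, List.length_nil] at hk
      rw [List.take_append_of_le_length (by omega)] at hB
      rcases lt_or_eq_of_le (show k ≤ hist.length by omega) with hk' | rfl
      · exact h2 (Or.inl ⟨k, hk', hB⟩)
      · exact h2 (Or.inr (by simpa using hB))
    · exact zero_le
    · exact le_rfl

/-- The sum over the episodes of a function of the episode and its past. -/
def pastSum (f : List (Episode D) → Episode D → ℝ) (hist : List (Episode D)) : ℝ :=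
  ∑ k : Fin hist.length, f (hist.take k) (hist.get k)

theorem pastSum_append_singleton (f : List (Episode D) → Episode D → ℝ)
    (hist : List (Episode D)) (e : Episode D) :
    pastSum f (hist ++ [e]) = pastSum f hist + f hist e := by
  have : ∀ (l : List (Episode D)), pastSum f l =
      ∑ k ∈ Finset.range l.length, if h : k < l.length then f (l.take k) l[k] else 0 := by
    intro l
    rw [Finset.sum_range]
    exact Finset.sum_congr rfl fun k _ => by simp
  have hlen : (hist ++ [e]).length = hist.length + 1 := by simp
  rw [this, this, Finset.sum_congr (congrArg Finset.range hlen) fun _ _ => rfl,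
    Finset.sum_range_succ]
  congr 1
  · refine Finset.sum_congr rfl fun k hk => ?_
    have hk := Finset.mem_range.1 hk
    rw [dif_pos hk, dif_pos (by simp; omega), List.take_append_of_le_length hk.le,
      List.getElem_append_left hk]
  · simp

theorem pastSum_mono {f g : List (Episode D) → Episode D → ℝ} {hist : List (Episode D)}
    (h : ∀ k < hist.length, ∀ e, f (hist.take k) e ≤ g (hist.take k) e) :
    pastSum f hist ≤ pastSum g hist :=
  Finset.sum_le_sum fun k _ => h k k.2 _

theorem pastSum_sub (f g : List (Episode D) → Episode D → ℝ) (hist : List (Episode D)) :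
    pastSum (fun l e => f l e - g l e) hist = pastSum f hist - pastSum g hist :=
  Finset.sum_sub_distrib _ _

theorem regret_eq_pastSum (hist : List (Episode D)) :
    regret G alg hist = pastSum (fun l e => bestMax G (alg (allSteps l)).2 0 e.s₁ -
      bestMin G (alg (allSteps l)).1 0 e.s₁) hist := rfl

/-- The realized sum of widths depends only on the final visit counts, which opens the way to a
pigeonhole estimate over cells. -/
theorem pastSum_eq_potential (g : ℕ → ℝ) {K : ℕ} {hist : List (Episode D)}
    (h : hist ∈ (law G alg adv K).support) :
    pastSum (fun l e => (e.steps.map fun x => g ((statsOf (allSteps l)).N x.h x.s x.a x.b)).sum)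
      hist = (statsOf (allSteps hist)).potential D g := by
  induction K generalizing hist with
  | zero =>
    obtain rfl : hist = [] := by simpa [law] using h
    simp [allSteps, pastSum, Stats.potential, statsOf, Stats.init, Stats.visits]
  | succ K ih =>
    obtain ⟨hist', s, τ, h1, h2, rfl⟩ := mem_support_law_succ G alg adv h
    rw [pastSum_append_singleton, ih h1, allSteps_append_singleton,
      potential_rollout G _ _ g (statsOf (allSteps hist')) (by omega) h2 _ fun _ _ _ _ _ => rfl]

theorem pastSum_length {K : ℕ} {hist : List (Episode D)}
    (h : hist ∈ (law G alg adv K).support) :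
    pastSum (fun _ e => (e.steps.length : ℝ)) hist = K * D.H := by
  induction K generalizing hist with
  | zero =>
    obtain rfl : hist = [] := by simpa [law] using h
    simp [pastSum]
  | succ K ih =>
    obtain ⟨hist', s, τ, h1, h2, rfl⟩ := mem_support_law_succ G alg adv h
    rw [pastSum_append_singleton, ih h1, length_of_mem_support_rollout _ _ _ h2]
    push_cast
    ring

theorem sum_visits {K : ℕ} {hist : List (Episode D)} (h : hist ∈ (law G alg adv K).support) :
    ∑ i : Cell D, ((statsOf (allSteps hist)).visits i : ℝ) = K * D.H := by
  rw [← pastSum_length G alg adv h]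
  have := pastSum_eq_potential G alg adv (fun _ => 1) h
  simp only [List.map_const', List.sum_replicate, Stats.potential, Finset.sum_const,
    Finset.card_range, nsmul_eq_mul, mul_one] at this
  exact this.symm

/-- Azuma's inequality for the sums of bounded functions over the episodes. -/
theorem prob_pastSum_expReturn_sub_ge_le (φ : List Obs → Obs → ℝ) (M : ℝ) (hM : 0 < M)
    (hφ : ∀ l h s a b s', φ l (G.obs h s a b s') ∈ Set.Icc 0 M) {K : ℕ} (hK : 0 < K) {L : ℝ}
    (hL : 0 ≤ L) :
    prob (law G alg adv K) (fun hist => 2 * (D.H * M) * √(K * L) ≤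
      pastSum (fun l e => expReturn G (alg (allSteps l)).1 (alg (allSteps l)).2 (φ (allSteps l))
        D.H 0 e.s₁ - (e.steps.map (φ (allSteps l))).sum) hist) ≤
      ENNReal.ofReal (Real.exp (-L)) := by
  set f : List (Episode D) → Episode D → ℝ := fun l e =>
    expReturn G (alg (allSteps l)).1 (alg (allSteps l)).2 (φ (allSteps l))
        D.H 0 e.s₁ - (e.steps.map (φ (allSteps l))).sum with hf
  have hH : (0 : ℝ) < D.H := by exact_mod_cast D.H_pos
  set W : ℝ := D.H * M with hW
  have hWpos : 0 < W := by positivity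
  have hK' : (0 : ℝ) < K := by exact_mod_cast hK
  -- Given the past and the initial state, the reward-like sum of the episode and its mean both lie
  -- in `[0, W]`, so each episode multiplies the exponential moment by at most `exp (lam ^ 2 * W ^
  -- 2)`.
  have step : ∀ lam : ℝ, ∀ J : ℕ, lexpect (law G alg adv J) (fun hist =>
      ENNReal.ofReal (Real.exp (lam * pastSum f hist - J * (lam ^ 2 * W ^ 2)))) ≤ 1 := by
    intro lam J
    induction J with
    | zero => simp [law, lexpect_pure, pastSum]
    | succ J ih =>
      rw [lexpect_law_succ]
      refine (lexpect_mono _ fun hist _ => lexpect_le _ fun s _ => ?_).trans ih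
      set μ := (alg (allSteps hist)).1
      set ν := (alg (allSteps hist)).2
      have hfin := finite_support_rollout G μ ν D.H 0 s
      -- The past factors out. The remaining parameter is `-lam` because `f` is the mean minus the
      -- realized sum.
      have e : ∀ τ, ENNReal.ofReal (Real.exp (lam * pastSum f (hist ++ [⟨s, τ⟩]) -
          ((J + 1 : ℕ) : ℝ) * (lam ^ 2 * W ^ 2))) =
          ENNReal.ofReal (Real.exp (lam * pastSum f hist - J * (lam ^ 2 * W ^ 2))) *
          (ENNReal.ofReal (Real.exp (-(lam ^ 2 * W ^ 2))) * ENNReal.ofReal (Real.exp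
            (-lam * ((τ.map (φ (allSteps hist))).sum - expect (rollout G μ ν D.H 0 s)
              fun τ => (τ.map (φ (allSteps hist))).sum)))) := by
        intro τ
        rw [← ENNReal.ofReal_mul (Real.exp_nonneg _), ← Real.exp_add,
          ← ENNReal.ofReal_mul (Real.exp_nonneg _), ← Real.exp_add, pastSum_append_singleton]
        congr 2
        simp only [hf, expReturn]
        push_cast
        ring
      simp only [e, lexpect_const_mul]
      refine mul_le_of_le_one_right' ?_
      rw [lexpect_ofReal _ hfin _ fun _ => Real.exp_nonneg _,
        ← ENNReal.ofReal_mul (Real.exp_nonneg _), ← ENNReal.ofReal_one]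
      refine ENNReal.ofReal_le_ofReal ?_
      have hb := expect_exp_le (rollout G μ ν D.H 0 s) hfin
        (fun τ => (τ.map (φ (allSteps hist))).sum) W (-lam) fun τ hτ => by
          have h1 := sum_map_mem_Icc_of_mem_rollout G μ ν (φ (allSteps hist)) M (hφ _) hτ
          have h2 := expReturn_mem_Icc G μ ν (φ (allSteps hist)) M (hφ _) D.H 0 s
          rw [abs_le]
          rw [expReturn] at h2
          constructor <;> linarith [h1.1, h1.2, h2.1, h2.2]
      refine (mul_le_mul_of_nonneg_left hb (Real.exp_nonneg _)).trans ?_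
      rw [← Real.exp_add]
      simp
  -- With this choice the threshold contributes `2 * L` to the exponent and the compensator takes
  -- away `L`.
  set lam := √(L / K) / W with hlam
  have hsq : lam ^ 2 * W ^ 2 = L / K := by
    rw [hlam, div_pow, Real.sq_sqrt (by positivity)]
    field_simp
  have hLK : √(L / K) * √(K * L) = L := by
    rw [← Real.sqrt_mul (by positivity), show L / K * (K * L) = L ^ 2 by field_simp,
      Real.sqrt_sq hL]
  refine le_trans (prob_mono _ fun hist _ h => ?_) (prob_le_exp_neg _ _ L (step lam K))
  have h1 : lam * (2 * W * √(K * L)) ≤ lam * pastSum f hist :=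
    mul_le_mul_of_nonneg_left h (by positivity)
  have h2 : lam * (2 * W * √(K * L)) = 2 * L := by
    rw [hlam, div_mul_eq_mul_div, div_eq_iff hWpos.ne']
    linear_combination 2 * W * hLK
  have h3 : (K : ℝ) * (lam ^ 2 * W ^ 2) = L := by
    rw [hsq]
    field_simp
  linarith

/-! ## Concentration of the empirical transition probabilities -/

/-- The sign that is `1` on `X` and `-1` elsewhere. -/
def sgn {n : ℕ} (X : Finset (Fin n)) (i : Fin n) : ℝ := if i ∈ X then 1 else -1

/-- The difference of transition counts and their compensators, summed with the given signs. -/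
def deviation (h : ℕ) (s : Fin (D.nS h)) (a : Fin (D.nA h)) (b : Fin (D.nB h))
    (X : Finset (Fin (D.nS (h + 1)))) (d : Stats) : ℝ :=
  ∑ s' : Fin (D.nS (h + 1)), sgn X s' *
    ((d.Ntr h s a b s' : ℝ) - d.N h s a b * (G.P h s a b s').toReal)

/-- An ℓ¹ norm is attained at one of `2 ^ n` sign vectors. It is thus enough to control finitely
many scalar martingales. -/
theorem sum_abs_eq_sum_sgn {n : ℕ} (f : Fin n → ℝ) : ∃ X, ∑ i, |f i| = ∑ i, sgn X i * f i := by
  refine ⟨Finset.univ.filter fun i => 0 ≤ f i, Finset.sum_congr rfl fun i _ => ?_⟩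
  by_cases hi : 0 ≤ f i
  · simp [sgn, hi, abs_of_nonneg]
  · simp [sgn, hi, abs_of_neg (not_le.1 hi)]

theorem deviation_observe_self (h : ℕ) (s : Fin (D.nS h)) (a : Fin (D.nA h)) (b : Fin (D.nB h))
    (X : Finset (Fin (D.nS (h + 1)))) (d : Stats) (s' : Fin (D.nS (h + 1))) :
    deviation G h s a b X (d.observe (G.obs h s a b s')) =
      deviation G h s a b X d + (sgn X s' - expect (G.P h s a b) (sgn X)) := by
  have e : ∀ s'' : Fin (D.nS (h + 1)), (((d.observe (G.obs h s a b s')).Ntr h s a b s'' : ℕ) : ℝ)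
      = d.Ntr h s a b s'' + if s'' = s' then 1 else 0 := fun s'' => by
    by_cases hs : s'' = s'
    · simp [Stats.observe, Game.obs, hs]
    · simp [Stats.observe, Game.obs, hs, Fin.val_inj]
  have e' : (((d.observe (G.obs h s a b s')).N h s a b : ℕ) : ℝ) = d.N h s a b + 1 := by
    simp [Stats.observe, Game.obs]
  rw [deviation, deviation, expect_fintype]
  simp only [e, e', mul_sub, mul_add, add_mul, mul_ite, mul_one, mul_zero, one_mul,
    Finset.sum_sub_distrib, Finset.sum_add_distrib, Finset.sum_ite_eq', Finset.mem_univ, if_true]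
  rw [Finset.sum_congr rfl fun x _ => mul_comm (G.P h s a b x).toReal (sgn X x)]
  ring

/-- A visit to the cell adds a centred increment of size at most `2`, which the compensator `4 * lam
^ 2` per visit pays for; any other step changes nothing. No stopping times or independence of
samples are needed, even though the number of visits is random and the play adaptive. -/
theorem lexpect_exp_deviation_le_one (h : ℕ) (s : Fin (D.nS h)) (a : Fin (D.nA h))
    (b : Fin (D.nB h)) (X : Finset (Fin (D.nS (h + 1)))) (lam : ℝ) (K : ℕ) :
    lexpect (law G alg adv K) (fun hist => ENNReal.ofReal (Real.exp
      (lam * deviation G h s a b X (statsOf (allSteps hist)) -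
        4 * lam ^ 2 * (statsOf (allSteps hist)).N h s a b))) ≤ 1 := by
  refine (lexpect_law_le G alg adv (F := fun l => ENNReal.ofReal (Real.exp
      (lam * deviation G h s a b X (statsOf l) - 4 * lam ^ 2 * (statsOf l).N h s a b))) ?_
    K).trans_eq ?_
  · intro l h₁ s₁ a₁ b₁
    simp only [statsOf_append_singleton]
    set d := statsOf l
    by_cases hc : h = h₁ ∧ (s : ℕ) = s₁ ∧ (a : ℕ) = a₁ ∧ (b : ℕ) = b₁
    · obtain ⟨rfl, h2, h3, h4⟩ := hc
      obtain rfl := Fin.ext h2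
      obtain rfl := Fin.ext h3
      obtain rfl := Fin.ext h4
      have e : ∀ s', ENNReal.ofReal (Real.exp
          (lam * deviation G h s a b X (d.observe (G.obs h s a b s')) -
            4 * lam ^ 2 * (d.observe (G.obs h s a b s')).N h s a b)) =
          ENNReal.ofReal (Real.exp (lam * deviation G h s a b X d - 4 * lam ^ 2 * d.N h s a b)) *
          (ENNReal.ofReal (Real.exp (-(lam ^ 2 * 2 ^ 2))) * ENNReal.ofReal (Real.exp
            (lam * (sgn X s' - expect (G.P h s a b) (sgn X))))) := by
        intro s'
        rw [← ENNReal.ofReal_mul (Real.exp_nonneg _), ← Real.exp_add,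
          ← ENNReal.ofReal_mul (Real.exp_nonneg _), ← Real.exp_add, deviation_observe_self]
        congr 2
        have : (((d.observe (G.obs h s a b s')).N h s a b : ℕ) : ℝ) = d.N h s a b + 1 := by
          simp [Stats.observe, Game.obs]
        rw [this]
        ring
      simp only [e, lexpect_const_mul]
      refine mul_le_of_le_one_right' ?_
      rw [lexpect_ofReal _ (Set.toFinite _) _ fun _ => Real.exp_nonneg _,
        ← ENNReal.ofReal_mul (Real.exp_nonneg _), ← ENNReal.ofReal_one]
      refine ENNReal.ofReal_le_ofReal ?_
      have hs : ∀ i, -1 ≤ sgn X i ∧ sgn X i ≤ 1 := fun i => by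
        rw [sgn]; split_ifs <;> norm_num
      have hb := expect_exp_le (G.P h s a b) (Set.toFinite _) (sgn X) 2 lam fun s' _ => by
        have h1 : expect (G.P h s a b) (sgn X) ≤ 1 := by
          rw [expect_fintype]; exact sum_toReal_mul_le _ _ _ fun i => (hs i).2
        have h2 : -1 ≤ expect (G.P h s a b) (sgn X) := by
          rw [expect_fintype]; exact le_sum_toReal_mul _ _ _ fun i => (hs i).1
        rw [abs_le]
        constructor <;> linarith [(hs s').1, (hs s').2]
      refine (mul_le_mul_of_nonneg_left hb (Real.exp_nonneg _)).trans ?_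
      rw [← Real.exp_add]
      simp
    · refine lexpect_le _ fun s' _ => le_of_eq ?_
      have e1 : (d.observe (G.obs h₁ s₁ a₁ b₁ s')).N h s a b = d.N h s a b := by
        exact Stats.observe_N_of_ne hc
      have e2 : ∀ s'', (d.observe (G.obs h₁ s₁ a₁ b₁ s')).Ntr h s a b s'' =
          d.Ntr h s a b s'' := fun s'' =>
        Stats.observe_Ntr_of_ne fun h' => hc ⟨h'.1, h'.2.1, h'.2.2.1, h'.2.2.2.1⟩
      simp only [deviation, e1, e2]
  · simp [statsOf, Stats.init, deviation]

/-- Fixing the visit count `t` makes the best parameter `lam = √(L / t) / 2` deterministic: the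
exponent is then at least `2 * L - L`. The price is a union bound over `t`. -/
theorem prob_deviation_le (h : ℕ) (s : Fin (D.nS h)) (a : Fin (D.nA h))
    (b : Fin (D.nB h)) (X : Finset (Fin (D.nS (h + 1)))) {t : ℕ} (ht : 0 < t) {L : ℝ}
    (hL : 0 ≤ L) (K : ℕ) :
    prob (law G alg adv K) (fun hist => (statsOf (allSteps hist)).N h s a b = t ∧
      4 * √(L * t) ≤ deviation G h s a b X (statsOf (allSteps hist))) ≤
      ENNReal.ofReal (Real.exp (-L)) := by
  have ht' : (0 : ℝ) < t := by exact_mod_cast ht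
  set lam := √(L / t) / 2 with hlam
  refine le_trans (prob_mono _ fun hist _ h => ?_)
    (prob_le_exp_neg _ _ L (lexpect_exp_deviation_le_one G alg adv h s a b X lam K))
  have hLt : √(L / t) * √(L * t) = L := by
    rw [← Real.sqrt_mul (by positivity), show L / t * (L * t) = L ^ 2 by field_simp,
      Real.sqrt_sq hL]
  have hsq : lam ^ 2 * t = L / 4 := by
    rw [hlam, div_pow, Real.sq_sqrt (by positivity)]
    field_simp
    norm_num
  have h1 := mul_le_mul_of_nonneg_left h.2 (show 0 ≤ lam by positivity)
  have h2 : lam * (4 * √(L * t)) = 2 * L := by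
    rw [hlam]
    linear_combination 2 * hLt
  rw [h.1]
  linarith

/-- The transition counts are close to their compensators. -/
def Stats.Concentrated (L : ℝ) (d : Stats) : Prop :=
  ∀ h < D.H, ∀ (s : Fin (D.nS h)) (a : Fin (D.nA h)) (b : Fin (D.nB h)),
    d.N h s a b ≠ 0 → ∑ s' : Fin (D.nS (h + 1)), |(d.Ntr h s a b s' : ℝ) -
      d.N h s a b * (G.P h s a b s').toReal| ≤ 4 * √(L * d.N h s a b)

theorem card_cell_le {S W : ℕ} (hS : ∀ h ≤ D.H, D.nS h ≤ S)
    (hW : ∀ h < D.H, D.nA h * D.nB h ≤ W) : Fintype.card (Cell D) ≤ D.H * (S * W) := by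
  rw [Fintype.card_sigma]
  refine (Finset.sum_le_card_nsmul _ _ (S * W) fun h _ => ?_).trans_eq (by simp)
  rw [Fintype.card_prod, Fintype.card_prod, Fintype.card_fin, Fintype.card_fin, Fintype.card_fin]
  exact Nat.mul_le_mul (hS h h.2.le) (hW h h.2)

theorem prob_not_concentrated_le {S W T k : ℕ} (hS : ∀ h ≤ D.H, D.nS h ≤ S)
    (hW : ∀ h < D.H, D.nA h * D.nB h ≤ W) (hT : k * D.H ≤ T) {L : ℝ} (hL : 0 ≤ L) :
    prob (law G alg adv k) (fun hist => ¬(statsOf (allSteps hist)).Concentrated G L) ≤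
      ((D.H * (S * W) * (2 ^ S * T) : ℕ) : ENNReal) * ENNReal.ofReal (Real.exp (-L)) := by
  -- The failure events are indexed by a cell, a sign set and a visit count; an element `j` of `Fin
  -- T` stands for the count `j + 1`.
  let κ : Type := (i : Cell D) × (Finset (Fin (D.nS (i.1 + 1))) × Fin T)
  let E : κ → List (Episode D) → Prop := fun j hist =>
    (statsOf (allSteps hist)).N j.1.1 j.1.2.1 j.1.2.2.1 j.1.2.2.2 = j.2.2 + 1 ∧
      4 * √(L * (j.2.2 + 1 : ℕ)) ≤
        deviation G j.1.1 j.1.2.1 j.1.2.2.1 j.1.2.2.2 j.2.1 (statsOf (allSteps hist))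
  have hcard : Fintype.card κ ≤ D.H * (S * W) * (2 ^ S * T) := by
    rw [Fintype.card_sigma]
    refine (Finset.sum_le_card_nsmul _ _ (2 ^ S * T) fun i _ => ?_).trans ?_
    · rw [Fintype.card_prod, Fintype.card_finset, Fintype.card_fin, Fintype.card_fin]
      exact Nat.mul_le_mul_right _ (Nat.pow_le_pow_right (by norm_num) (hS _ i.1.2))
    · rw [Finset.card_univ, smul_eq_mul]
      exact Nat.mul_le_mul_right _ (card_cell_le hS hW)
  calc prob (law G alg adv k) (fun hist => ¬(statsOf (allSteps hist)).Concentrated G L)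
      ≤ prob (law G alg adv k) (fun hist => ∃ j ∈ (Finset.univ : Finset κ), E j hist) := by
        refine prob_mono _ fun hist hh hc => ?_
        simp only [Stats.Concentrated, not_forall, not_le] at hc
        obtain ⟨h, hh', s, a, b, hN, hlt⟩ := hc
        obtain ⟨X, hX⟩ := sum_abs_eq_sum_sgn fun s' : Fin (D.nS (h + 1)) =>
          ((statsOf (allSteps hist)).Ntr h s a b s' : ℝ) -
            (statsOf (allSteps hist)).N h s a b * (G.P h s a b s').toReal
        rw [hX] at hlt
        have hle := N_statsOf_le_length (allSteps hist) h s a b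
        rw [length_allSteps_of_mem_law G alg adv hh] at hle
        -- The index is one less than the visit count. It is below `T` because the count is positive
        -- and at most the number `k * D.H` of observed steps.
        refine ⟨⟨⟨⟨h, hh'⟩, s, a, b⟩, X, ⟨(statsOf (allSteps hist)).N h s a b - 1, by omega⟩⟩,
          Finset.mem_univ _, ?_, ?_⟩
        · change _ = (statsOf (allSteps hist)).N h s a b - 1 + 1
          dsimp only
          omega
        · dsimp only
          rw [Nat.sub_add_cancel (Nat.pos_of_ne_zero hN)]
          exact hlt.le
    _ ≤ ∑ j : κ, prob (law G alg adv k) (E j) := prob_exists_le _ _ _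
    _ ≤ ∑ _j : κ, ENNReal.ofReal (Real.exp (-L)) := Finset.sum_le_sum fun j _ =>
        prob_deviation_le G alg adv _ _ _ _ _ (Nat.succ_pos _) hL k
    _ ≤ _ := by
        rw [Finset.sum_const, Finset.card_univ, nsmul_eq_mul]
        gcongr

end Law

/-! ## The regret bound -/

/-- The `max` gives the first visit, where `t = 0`, the weight `1`. -/
theorem sum_inv_sqrt_max_le (n : ℕ) :
    ∑ t ∈ Finset.range n, 1 / √(max (t : ℝ) 1) ≤ 3 * √n := by
  induction n with
  | zero => simp
  | succ n ih =>
    rw [Finset.sum_range_succ]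
    refine (add_le_add_left ih _).trans ?_
    rcases Nat.eq_zero_or_pos n with rfl | hn
    · norm_num
    · have hn1 : (1 : ℝ) ≤ n := by exact_mod_cast hn
      rw [max_eq_left hn1]
      have hx : 0 < √(n : ℝ) := Real.sqrt_pos.2 (by linarith)
      have hx2 : √(n : ℝ) ^ 2 = n := Real.sq_sqrt (by linarith)
      have hy2 : √((n + 1 : ℕ) : ℝ) ^ 2 = n + 1 := by
        rw [Real.sq_sqrt (Nat.cast_nonneg _)]; push_cast; ring
      have hy : 0 ≤ √((n + 1 : ℕ) : ℝ) := Real.sqrt_nonneg _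
      set x := √(n : ℝ)
      set y := √((n + 1 : ℕ) : ℝ)
      -- Since `y ≤ 2 * x`, the increment `3 * (y - x) = 3 / (x + y)` is at least `1 / x`.
      have hy2x : y ≤ 2 * x := by nlinarith
      rw [show 3 * x + 1 / x = (3 * x ^ 2 + 1) / x by field_simp, div_le_iff₀ hx]
      nlinarith

variable {D : Dims} (G : Game D) (adv : Adversary D)

/-- Cauchy-Schwarz over the cells, whose visit counts add up to `K * D.H`. -/
theorem sum_sqrt_visits_le {M : ℕ} (hM : Fintype.card (Cell D) ≤ M) (alg : Learner D) {K : ℕ}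
    {hist : List (Episode D)} (h : hist ∈ (law G alg adv K).support) :
    ∑ i : Cell D, √((statsOf (allSteps hist)).visits i : ℝ) ≤ √(M * (K * D.H)) := by
  refine Real.le_sqrt_of_sq_le (sq_sum_le_card_mul_sum_sq.trans ?_)
  rw [Finset.card_univ, ← sum_visits G alg adv h]
  simp only [Real.sq_sqrt (Nat.cast_nonneg _)]
  gcongr

theorem potential_le {M : ℕ} (hM : Fintype.card (Cell D) ≤ M) (alg : Learner D) {K : ℕ}
    {hist : List (Episode D)} (h : hist ∈ (law G alg adv K).support) {g : ℕ → ℝ} {Γ : ℝ}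
    (hΓ : 0 ≤ Γ) (hg : ∀ t : ℕ, g t ≤ Γ * (1 / √(max (t : ℝ) 1))) :
    (statsOf (allSteps hist)).potential D g ≤ 3 * Γ * √(M * (K * D.H)) := by
  refine le_trans ?_ (mul_le_mul_of_nonneg_left (sum_sqrt_visits_le G adv hM alg h)
    (by positivity))
  rw [Stats.potential, Finset.mul_sum]
  refine Finset.sum_le_sum fun i _ => ?_
  calc _ ≤ ∑ t ∈ Finset.range ((statsOf (allSteps hist)).visits i),
        Γ * (1 / √(max (t : ℝ) 1)) := Finset.sum_le_sum fun t _ => hg t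
    _ ≤ Γ * (3 * √((statsOf (allSteps hist)).visits i : ℝ)) := by
        rw [← Finset.mul_sum]
        exact mul_le_mul_of_nonneg_left (sum_inv_sqrt_max_le _) hΓ
    _ = _ := by ring

/-- The confidence width of a cell visited `t` times. -/
def width (H Γ : ℝ) (t : ℕ) : ℝ := min H (Γ * (1 / √(max (t : ℝ) 1)))

/-- The regret bound in the event that all statistics are concentrated and the realized widths
are not much smaller than the expected ones. -/
theorem regret_le_of_concentrated {nash : Subroutine} (hnash : SolvesVectorGames nash)
    (hD : D.TurnBased) {K M : ℕ} (hM : Fintype.card (Cell D) ≤ M) {β : ℕ → ℝ} {w c R : ℝ}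
    (hw : 1 / 4 ≤ w) (hc : 8 ≤ c) (hβ : ∀ t, β t = c * √((D.H : ℝ) ^ 2 * w / t))
    {hist : List (Episode D)} (hh : hist ∈ (law G (viULCB D β nash) adv K).support)
    (hconc : ∀ k < hist.length, (∀ x ∈ allSteps (hist.take k), G.Produces x) ∧
      (statsOf (allSteps (hist.take k))).Concentrated G (4 * w))
    (hR : pastSum (fun l e => expReturn G (viULCB D β nash (allSteps l)).1
      (viULCB D β nash (allSteps l)).2 (fun x => width D.H (3 * c * (D.H * √w))
        ((statsOf (allSteps l)).N x.h x.s x.a x.b)) D.H 0 e.s₁ -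
      (e.steps.map fun x => width D.H (3 * c * (D.H * √w))
        ((statsOf (allSteps l)).N x.h x.s x.a x.b)).sum) hist ≤ R) :
    regret G (viULCB D β nash) hist ≤
      9 * c * (D.H * √w) * √(M * (K * D.H)) + R := by
  have hw0 : 0 ≤ w := by linarith
  have hH : (0 : ℝ) < D.H := by exact_mod_cast D.H_pos
  set Γ : ℝ := 3 * c * (D.H * √w) with hΓ
  have hpot := potential_le G adv hM (viULCB D β nash) hh (g := width D.H Γ) (Γ := Γ)
    (by positivity) fun t => min_le_right _ _
  rw [← pastSum_eq_potential G (viULCB D β nash) adv (width D.H Γ) hh] at hpot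
  rw [pastSum_sub] at hR
  -- Together with `8 ≤ c` this gives `D.H ≤ Γ`, so that the width of an unvisited cell is really
  -- `H`.
  have hsw : 1 / 2 ≤ √w := by
    refine Real.le_sqrt_of_sq_le ?_
    norm_num
    linarith
  have hreg : regret G (viULCB D β nash) hist ≤ pastSum (fun l e => expReturn G
      (viULCB D β nash (allSteps l)).1 (viULCB D β nash (allSteps l)).2
      (fun x => width D.H Γ ((statsOf (allSteps l)).N x.h x.s x.a x.b)) D.H 0 e.s₁) hist := by
    rw [regret_eq_pastSum]
    refine pastSum_mono fun k hk e => ?_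
    refine regret_term_le G hnash hD _ ?_ _ ?_ ?_ _
    · obtain ⟨h1, h2⟩ := hconc k hk
      refine accurate_of_sum_abs_le G hw0 hc hβ (fun h s a b hN => rhat_statsOf G h1 h s a b hN)
        fun h hh' s a b hN => (h2 h hh' s a b hN).trans_eq ?_
      -- The level `4 * w` turns the concentration constant `4` into `8`.
      rw [mul_assoc 4 w, Real.sqrt_mul (by norm_num) (w * _),
        show (4 : ℝ) = 2 ^ 2 by norm_num, Real.sqrt_sq (by norm_num)]
      ring
    · refine le_min le_rfl ?_
      simp only [Nat.cast_zero, zero_le_one, max_eq_right, Real.sqrt_one, div_one, mul_one, hΓ]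
      nlinarith [mul_le_mul hc hsw (by norm_num) (by linarith)]
    · intro t ht
      have ht1 : (1 : ℝ) ≤ t := by exact_mod_cast Nat.pos_of_ne_zero ht
      rw [width, max_eq_left ht1, hβ, mul_div_assoc, Real.sqrt_mul (sq_nonneg (D.H : ℝ)),
        Real.sqrt_sq hH.le, Real.sqrt_div hw0, hΓ]
      exact le_of_eq (by ring_nf)
  calc _ ≤ _ := hreg
    _ ≤ 3 * Γ * √(M * (K * D.H)) + R := by linarith
    _ = _ := by rw [hΓ]; ring

theorem prob_exists_not_concentrated_le {S W K : ℕ} (alg : Learner D)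
    (hS : ∀ h ≤ D.H, D.nS h ≤ S) (hW : ∀ h < D.H, D.nA h * D.nB h ≤ W) {L : ℝ} (hL : 0 ≤ L) :
    prob (law G alg adv K) (fun hist => ∃ k < hist.length,
      ¬((∀ x ∈ allSteps (hist.take k), G.Produces x) ∧
        (statsOf (allSteps (hist.take k))).Concentrated G L)) ≤
      ENNReal.ofReal (K * (D.H * (S * W) * (2 ^ S * (K * D.H))) * Real.exp (-L)) := by
  refine (prob_law_exists_prefix_le G alg adv (fun hist => ¬((∀ x ∈ allSteps hist,
    G.Produces x) ∧ (statsOf (allSteps hist)).Concentrated G L)) K).trans ?_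
  calc _ ≤ ∑ _k ∈ Finset.range K, ((D.H * (S * W) * (2 ^ S * (K * D.H)) : ℕ) : ENNReal) *
        ENNReal.ofReal (Real.exp (-L)) := by
        refine Finset.sum_le_sum fun k hk => le_trans (prob_mono _ fun hist hh h hc => ?_)
          (prob_not_concentrated_le G alg adv hS hW
            (Nat.mul_le_mul_right _ (Finset.mem_range.1 hk).le) hL)
        exact h ⟨produces_of_mem_law G alg adv hh, hc⟩
    _ = _ := by
        rw [Finset.sum_const, Finset.card_range, nsmul_eq_mul, mul_assoc (K : ℝ),
          ENNReal.ofReal_mul (Nat.cast_nonneg K), ENNReal.ofReal_natCast]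
        congr 1
        rw [ENNReal.ofReal_mul (by positivity), ← ENNReal.ofReal_natCast]
        push_cast
        rfl

theorem ofReal_one_sub_le_prob {α : Type*} (P : PMF α) {E B₁ B₂ : α → Prop} {p : ℝ}
    (hp : 0 ≤ p) (hE : ∀ x ∈ P.support, ¬B₁ x → ¬B₂ x → E x)
    (h₁ : prob P B₁ ≤ ENNReal.ofReal (p / 2)) (h₂ : prob P B₂ ≤ ENNReal.ofReal (p / 2)) :
    ENNReal.ofReal (1 - p) ≤ prob P E := by
  rw [ENNReal.ofReal_sub 1 hp, ENNReal.ofReal_one, tsub_le_iff_right]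
  refine (one_le_prob_add_prob_not P E).trans ?_
  gcongr
  calc prob P (fun x => ¬E x) ≤ prob P fun x => B₁ x ∨ B₂ x :=
        prob_mono _ fun x hx hn => by
          by_contra hb
          rw [not_or] at hb
          exact hn (hE x hx hb.1 hb.2)
    _ ≤ ENNReal.ofReal (p / 2) + ENNReal.ofReal (p / 2) :=
        (prob_or_le _ _ _).trans (add_le_add h₁ h₂)
    _ = ENNReal.ofReal p := by
        rw [← ENNReal.ofReal_add (by positivity) (by positivity), add_halves]

/-- Write `Z = S * W * K * H`, so that the number of events is `2 ^ S * Z * (K * H)`, at most `2 ^ S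
* Z ^ 2`. Of the exponent `4 * S * ι`, one quarter cancels `2 ^ S` because `log 2 ≤ ι`, and the rest
gives at least `3 * ι`, a factor `(p / Z) ^ 3`. What is left is `p ^ 3 / Z ≤ p / 2`. -/
theorem mul_exp_neg_le_half {S W K H : ℕ} {p ι : ℝ} (hp : 0 < p) (hp1 : p < 1) (hS : 0 < S)
    (hW : 2 ≤ W) (hK : 0 < K) (hH : 0 < H) (hι : Real.log 2 ≤ ι)
    (hexp : Real.exp (-ι) = p / ((S : ℝ) * W * (K * H))) :
    K * (H * (S * W) * (2 ^ S * (K * H))) * Real.exp (-(4 * (S * ι))) ≤ p / 2 := by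
  have hS' : (1 : ℝ) ≤ S := by exact_mod_cast hS
  have hK' : (1 : ℝ) ≤ K := by exact_mod_cast hK
  have hH' : (1 : ℝ) ≤ H := by exact_mod_cast hH
  have hW' : (2 : ℝ) ≤ W := by exact_mod_cast hW
  have hlog : 0 < Real.log 2 := Real.log_pos (by norm_num)
  set Z : ℝ := S * W * (K * H) with hZ
  have hSW : 2 ≤ (S : ℝ) * W := by nlinarith
  have hKH : 1 ≤ (K : ℝ) * H := by nlinarith
  have hKHZ : (K : ℝ) * H ≤ Z := by nlinarith
  have hZ2 : 2 ≤ Z := by nlinarith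
  have e1 : Real.exp (-(4 * (S * ι))) ≤ (p / Z) ^ 3 * (2 ^ S)⁻¹ := by
    rw [← hexp, ← Real.exp_nat_mul, show (2 : ℝ) ^ S = Real.exp (S * Real.log 2) by
      rw [Real.exp_nat_mul, Real.exp_log (by norm_num)], ← Real.exp_neg, ← Real.exp_add]
    refine Real.exp_le_exp.2 ?_
    push_cast
    have : (S : ℝ) * Real.log 2 ≤ S * ι := by gcongr
    nlinarith
  calc K * (H * (S * W) * (2 ^ S * (K * H))) * Real.exp (-(4 * (S * ι)))
      ≤ K * (H * (S * W) * (2 ^ S * (K * H))) * ((p / Z) ^ 3 * (2 ^ S)⁻¹) := by gcongr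
    _ = Z * (K * H) * (p / Z) ^ 3 := by rw [hZ]; field_simp
    _ ≤ Z * Z * (p / Z) ^ 3 := by gcongr
    _ = p ^ 3 / Z := by field_simp
    _ ≤ p / 2 := by
        gcongr
        nlinarith [mul_pos hp hp]

theorem regret_bound {nash : Subroutine} (hnash : SolvesVectorGames nash) (hD : D.TurnBased)
    {S A B K : ℕ} (hSAB : D.BoundedBy S A B) (hK : 0 < K) {c p : ℝ} (hc : 8 ≤ c) (hp : 0 < p)
    (hp1 : p < 1) :
    ENNReal.ofReal (1 - p) ≤
      prob (law G (viULCB D (bonus D S A B K c p) nash) adv K) fun hist =>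
        regret G (viULCB D (bonus D S A B K c p) nash) hist ≤
          (9 * c + 2) * √((D.H : ℝ) ^ 3 * (S : ℝ) ^ 2 * ((A : ℝ) + B) * ((K : ℝ) * D.H) *
            iota D S A B K p) := by
  obtain ⟨hS, hA, hB⟩ := hSAB
  have hH := D.H_pos
  have hS0 : 0 < S := (D.nS_pos 0).trans_le (hS 0 (Nat.zero_le _))
  have hA0 : 0 < A := (D.nA_pos 0).trans_le (hA 0 hH)
  have hB0 : 0 < B := (D.nB_pos 0).trans_le (hB 0 hH)
  -- With `A = B = 1` the number `ι` may be arbitrarily close to `0`, too small for the union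
  -- bounds; but then nobody has a choice and there is no regret.
  rcases Nat.lt_or_ge (A * B) 2 with hAB | hAB
  · have hA1 : A = 1 := by nlinarith
    have hB1 : B = 1 := by nlinarith
    have hall : ∀ hist, regret G (viULCB D (bonus D S A B K c p) nash) hist ≤
          (9 * c + 2) * √((D.H : ℝ) ^ 3 * (S : ℝ) ^ 2 * ((A : ℝ) + B) * ((K : ℝ) * D.H) *
            iota D S A B K p) := fun hist =>
      (regret_nonpos_of_unique G
        (fun h hh => le_antisymm ((hA h hh).trans_eq hA1) (D.nA_pos h))
        (fun h hh => le_antisymm ((hB h hh).trans_eq hB1) (D.nB_pos h)) _ hist).trans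
        (by positivity)
    simp only [hall, prob, if_true, lexpect_const]
    rw [← ENNReal.ofReal_one]
    exact ENNReal.ofReal_le_ofReal (by linarith)
  set β := bonus D S A B K c p with hβ
  set ι := iota D S A B K p with hι
  have hS' : (1 : ℝ) ≤ S := by exact_mod_cast hS0
  have hK' : (1 : ℝ) ≤ K := by exact_mod_cast hK
  have hH' : (1 : ℝ) ≤ D.H := by exact_mod_cast hH
  have hA' : (1 : ℝ) ≤ A := by exact_mod_cast hA0
  have hB' : (1 : ℝ) ≤ B := by exact_mod_cast hB0
  have hW' : (2 : ℝ) ≤ (A * B : ℕ) := by exact_mod_cast hAB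
  have hZeq : (S : ℝ) * A * B * ((K : ℝ) * D.H) = S * (A * B : ℕ) * (K * D.H) := by
    push_cast; ring
  have hSW : 2 ≤ (S : ℝ) * (A * B : ℕ) := by nlinarith
  have hKH : 1 ≤ (K : ℝ) * D.H := by nlinarith
  have hZ2 : 2 ≤ (S : ℝ) * (A * B : ℕ) * (K * D.H) := by nlinarith
  have hι2 : Real.log 2 ≤ ι := by
    rw [hι, iota, hZeq]
    refine Real.log_le_log (by norm_num) ?_
    rw [le_div_iff₀ hp]
    nlinarith
  have hι4 : 1 / 4 ≤ ι := by linarith [Real.log_two_gt_d9]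
  have hexp : Real.exp (-ι) = p / ((S : ℝ) * (A * B : ℕ) * (K * D.H)) := by
    rw [hι, iota, Real.exp_neg, Real.exp_log (by positivity), inv_div, hZeq]
  have hw : 1 / 4 ≤ S * ι := by nlinarith
  have hβt : ∀ t, β t = c * √((D.H : ℝ) ^ 2 * (S * ι) / t) := fun t => by
    rw [hβ, bonus, ← mul_assoc]
  -- Here the turn-based structure yields `A + B` instead of `A * B`.
  have hM : Fintype.card (Cell D) ≤ D.H * (S * (A + B)) := by
    refine card_cell_le hS fun h hh => ?_
    rcases hD.eq_one_or_eq_one hh with h1 | h1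
    · rw [h1, one_mul]; exact (hB h hh).trans (Nat.le_add_left _ _)
    · rw [h1, mul_one]; exact (hA h hh).trans (Nat.le_add_right _ _)
  -- Each width is at most `H`, and the level `ι` makes the failure probability `p / (S * A * B *
  -- T)`, which is at most `p / 2`.
  have hazuma := prob_pastSum_expReturn_sub_ge_le G (viULCB D β nash) adv
    (fun l x => width D.H (3 * c * (D.H * √(S * ι))) ((statsOf l).N x.h x.s x.a x.b))
    D.H (by linarith) (fun l h s a b s' => ⟨le_min (by linarith) (by positivity),
      min_le_left _ _⟩) hK (L := ι) (by linarith)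
  refine ofReal_one_sub_le_prob _ hp.le (fun hist hh hB₁ hB₂ => ?_)
    -- In the union bound the crude count `A * B` of action pairs suffices: it enters only through
    -- the logarithm `ι`, which is defined with this product.
    ((prob_exists_not_concentrated_le G adv (W := A * B) _ hS
      (fun h hh => Nat.mul_le_mul (hA h hh) (hB h hh)) (L := 4 * (S * ι)) (by linarith)).trans
      (ENNReal.ofReal_le_ofReal
        (mul_exp_neg_le_half hp hp1 hS0 hAB hK hH hι2 hexp)))
    (hazuma.trans (ENNReal.ofReal_le_ofReal ?_))
  · have hconc : ∀ k < hist.length, (∀ x ∈ allSteps (hist.take k), G.Produces x) ∧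
        (statsOf (allSteps (hist.take k))).Concentrated G (4 * (S * ι)) := fun k hk => by
      by_contra hcon
      exact hB₁ ⟨k, hk, hcon⟩
    refine (regret_le_of_concentrated G adv hnash hD hM hw hc hβt hh hconc
      (not_le.1 hB₂).le).trans ?_
    have hι0 : 0 ≤ ι := by linarith
    set X : ℝ := (D.H : ℝ) ^ 3 * (S : ℝ) ^ 2 * ((A : ℝ) + B) * ((K : ℝ) * D.H) * ι with hX
    have e1 : (D.H : ℝ) * √(S * ι) * √((D.H * (S * (A + B)) : ℕ) * (K * D.H)) = √X := by
      rw [← Real.sqrt_sq (show (0 : ℝ) ≤ D.H by linarith), ← Real.sqrt_mul (sq_nonneg _),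
        ← Real.sqrt_mul (by positivity), Real.sqrt_sq (by linarith)]
      congr 1
      rw [hX]
      push_cast
      ring
    -- The Azuma remainder is of lower order: `H ^ 4 * K` is `H ^ 3 * T`, without the factors `S ^
    -- 2` and `A + B`.
    have e2 : (D.H : ℝ) * D.H * √(K * ι) ≤ √X := by
      rw [← Real.sqrt_sq (show (0 : ℝ) ≤ D.H * D.H by positivity),
        ← Real.sqrt_mul (sq_nonneg _)]
      refine Real.sqrt_le_sqrt ?_
      calc ((D.H : ℝ) * D.H) ^ 2 * (K * ι)
          = (D.H : ℝ) ^ 3 * 1 ^ 2 * 1 * ((K : ℝ) * D.H) * ι := by ring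
        _ ≤ X := by
            rw [hX]
            gcongr
            linarith
    calc _ = 9 * c * ((D.H : ℝ) * √(S * ι) * √((D.H * (S * (A + B)) : ℕ) * (K * D.H))) +
          2 * ((D.H : ℝ) * D.H * √(K * ι)) := by ring
      _ ≤ 9 * c * √X + 2 * √X := by rw [e1]; gcongr
      _ = _ := by ring
  · rw [hexp]
    gcongr

/-! ## Programs that do not interact with the game -/

namespace Prog

open Classical in
/-- The effect on the memory of a program that does not interact with the game. -/
def run : Prog → Mem → Mem
  | .skip, M => M
  | .nset arr idx e, M => M.setNat arr (M.index idx) (e.eval M)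
  | .rset arr idx e, M => M.setReal arr (M.index idx) (e.eval M)
  | .seq c d, M => run d (run c M)
  | .ite t c d, M => if t.holds M then run c M else run d M
  | .loop i e c, M =>
    (List.range (e.eval M)).foldl (fun M' j => run c (M'.setNat i [] j)) M
  | .start _, M => M
  | .play _ _ _ _, M => M

/-- The program does not interact with the game. -/
def Silent : Prog → Prop
  | .seq c d => c.Silent ∧ d.Silent
  | .ite _ c d => c.Silent ∧ d.Silent
  | .loop _ _ c => c.Silent
  | .start _ => False
  | .play _ _ _ _ => False
  | _ => True

/-- The names of the arrays of natural numbers that a silent program may change. -/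
def natWrites : Prog → List ℕ
  | .nset arr _ _ => [arr]
  | .seq c d => c.natWrites ++ d.natWrites
  | .ite _ c d => c.natWrites ++ d.natWrites
  | .loop i _ c => i :: c.natWrites
  | _ => []

/-- The names of the arrays of real numbers that a silent program may change. -/
def realWrites : Prog → List ℕ
  | .rset arr _ _ => [arr]
  | .seq c d => c.realWrites ++ d.realWrites
  | .ite _ c d => c.realWrites ++ d.realWrites
  | .loop _ _ c => c.realWrites
  | _ => []

/-- All array entries (except scalars) that the program changes have an index that begins with
the values of the scalars `p`, and these scalars are not changed. -/
def confined (p : List ℕ) : Prog → Bool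
  | .nset arr idx _ => (idx.isEmpty && !p.contains arr) || p.isPrefixOf idx && !idx.isEmpty
  | .rset _ idx _ => idx.isEmpty || p.isPrefixOf idx
  | .seq c d => c.confined p && d.confined p
  | .ite _ c d => c.confined p && d.confined p
  | .loop i _ c => !p.contains i && c.confined p
  | _ => true

end Prog

theorem Prog.run_seq (c d : Prog) (M : Mem) : (Prog.seq c d).run M = d.run (c.run M) := rfl

theorem foldl_range_induction {α : Type*} (I : ℕ → α → Prop) (f : α → ℕ → α) (n : ℕ) (x : α)
    (h0 : I 0 x) (hs : ∀ j < n, ∀ y, I j y → I (j + 1) (f y j)) :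
    I n ((List.range n).foldl f x) := by
  induction n with
  | zero => simpa using h0
  | succ n ih =>
    rw [List.range_succ, List.foldl_append]
    exact hs n (by omega) _ (ih fun j hj => hs j (by omega))

/-- The loop rule of the correctness proofs. The invariant at `j` speaks of the memory before the
loop variable is set to `j`. -/
theorem Prog.run_loop_induction (I : ℕ → Mem → Prop) {i : ℕ} {e : NExp} {c : Prog} {M : Mem}
    {n : ℕ} (hn : e.eval M = n) (h0 : I 0 M)
    (hs : ∀ j < n, ∀ M', I j M' → I (j + 1) (c.run (M'.setNat i [] j))) :
    I n ((Prog.loop i e c).run M) := by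
  rw [Prog.run, hn]
  exact foldl_range_induction I _ n M h0 hs

/-- Planning can be verified on the memory alone, apart from clock, log and environment. -/
theorem exec_of_silent (E : Env) {c : Prog} (hc : c.Silent) (σ : Config) :
    (exec E c σ).mem = c.run σ.mem ∧ (exec E c σ).cur = σ.cur ∧ (exec E c σ).step = σ.step ∧
      (exec E c σ).log = σ.log ∧ (exec E c σ).starts = σ.starts := by
  induction c generalizing σ with
  | skip => simp [exec, Prog.run]
  | nset => simp [exec, Prog.run]
  | rset => simp [exec, Prog.run]
  | seq c d ihc ihd =>
    simp only [exec, Prog.run]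
    have h1 := ihc hc.1 σ
    have h2 := ihd hc.2 (exec E c σ)
    simp only [h1] at h2
    exact h2
  | ite t c d ihc ihd =>
    simp only [exec, Prog.run]
    split_ifs
    · exact ihc hc.1 _
    · exact ihd hc.2 _
  | loop i e c ih =>
    simp only [exec, Prog.run]
    generalize e.eval σ.mem = n
    induction n with
    | zero => simp
    | succ n ihn =>
      rw [List.range_succ, List.foldl_append, List.foldl_append]
      simp only [List.foldl_cons, List.foldl_nil]
      generalize (List.range n).foldl _ { σ with time := _ } = σ' at ihn ⊢
      have h1 := ih hc { σ' with mem := σ'.mem.setNat i [] n, time := σ'.time + 1 }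
      simp only [ihn] at h1 ⊢
      exact h1
  | start => exact hc.elim
  | play => exact hc.elim

/-! ### Frame rules: what a silent program leaves unchanged. -/

theorem Mem.setNat_nat_of_ne (M : Mem) {arr arr' : ℕ} (h : arr' ≠ arr) (i : List ℕ) (v : ℕ) :
    (M.setNat arr i v).nat arr' = M.nat arr' := by
  funext i'
  simp [Mem.setNat, h]

theorem Mem.setReal_real_of_ne (M : Mem) {arr arr' : ℕ} (h : arr' ≠ arr) (i : List ℕ) (v : ℝ) :
    (M.setReal arr i v).real arr' = M.real arr' := by
  funext i'
  simp [Mem.setReal, h]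

theorem Prog.run_nat {c : Prog} {arr : ℕ} (h : arr ∉ c.natWrites) (M : Mem) :
    (c.run M).nat arr = M.nat arr := by
  induction c generalizing M with
  | skip => rfl
  | nset arr' idx e => exact Mem.setNat_nat_of_ne _ (by simpa [natWrites] using h) _ _
  | rset => rfl
  | seq c d ihc ihd =>
    simp only [natWrites, List.mem_append, not_or] at h
    rw [run, ihd h.2, ihc h.1]
  | ite t c d ihc ihd =>
    simp only [natWrites, List.mem_append, not_or] at h
    rw [run]
    split_ifs
    · exact ihc h.1 M
    · exact ihd h.2 M
  | loop i e c ih =>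
    simp only [natWrites, List.mem_cons, not_or] at h
    refine run_loop_induction (fun _ M' => M'.nat arr = M.nat arr) rfl rfl fun j _ M' hM' => ?_
    rw [ih h.2, Mem.setNat_nat_of_ne _ h.1, hM']
  | start => rfl
  | play => rfl

theorem Prog.run_real {c : Prog} {arr : ℕ} (h : arr ∉ c.realWrites) (M : Mem) :
    (c.run M).real arr = M.real arr := by
  induction c generalizing M with
  | skip => rfl
  | nset => rfl
  | rset arr' idx e => exact Mem.setReal_real_of_ne _ (by simpa [realWrites] using h) _ _
  | seq c d ihc ihd =>
    simp only [realWrites, List.mem_append, not_or] at h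
    rw [run, ihd h.2, ihc h.1]
  | ite t c d ihc ihd =>
    simp only [realWrites, List.mem_append, not_or] at h
    rw [run]
    split_ifs
    · exact ihc h.1 M
    · exact ihd h.2 M
  | loop i e c ih =>
    refine run_loop_induction (fun _ M' => M'.real arr = M.real arr) rfl rfl fun j _ M' hM' => ?_
    rw [ih h]
    exact hM'
  | start => rfl
  | play => rfl

/-- The memories have the same scalars `p`, and the same array entries outside the part of the
arrays where the index begins with the values of these scalars. -/
structure Mem.SameOff (p : List ℕ) (M M' : Mem) : Prop where
  index_eq : M'.index p = M.index p
  nat_eq : ∀ arr i, i ≠ [] → ¬M.index p <+: i → M'.nat arr i = M.nat arr i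
  real_eq : ∀ arr i, i ≠ [] → ¬M.index p <+: i → M'.real arr i = M.real arr i

theorem Mem.SameOff.refl (p : List ℕ) (M : Mem) : Mem.SameOff p M M :=
  ⟨rfl, fun _ _ _ _ => rfl, fun _ _ _ _ => rfl⟩

theorem Mem.SameOff.trans {p : List ℕ} {M M' M'' : Mem} (h : Mem.SameOff p M M')
    (h' : Mem.SameOff p M' M'') : Mem.SameOff p M M'' :=
  ⟨h'.1.trans h.1, fun arr i h0 hi => (h'.2 arr i h0 (h.1 ▸ hi)).trans (h.2 arr i h0 hi),
    fun arr i h0 hi => (h'.3 arr i h0 (h.1 ▸ hi)).trans (h.3 arr i h0 hi)⟩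

theorem Mem.sameOff_setNat_scalar {p : List ℕ} (M : Mem) {x : ℕ} (hx : x ∉ p) (v : ℕ) :
    Mem.SameOff p M (M.setNat x [] v) := by
  refine ⟨List.map_congr_left fun y hy => ?_, fun arr i h0 _ => ?_, fun _ _ _ _ => rfl⟩
  · rw [Mem.scalar, Mem.setNat_nat_of_ne _ (fun h => hx (by rwa [← h])), Mem.scalar]
  · simp [Mem.setNat, h0]

/-- The scalars in the prefix are never written, so one prefix is valid during the whole run. This
protects entries of an array that the program does write, for instance the rows of other steps or
states. Confinement is a Boolean, so concrete programs are checked by `decide`. -/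
theorem Prog.sameOff_run {p : List ℕ} {c : Prog} (h : c.confined p = true) (M : Mem) :
    Mem.SameOff p M (c.run M) := by
  induction c generalizing M with
  | skip => exact Mem.SameOff.refl p M
  | nset arr idx e =>
    simp only [confined, Bool.or_eq_true, Bool.and_eq_true, List.isEmpty_iff, Bool.not_eq_true',
      List.contains_eq_mem, decide_eq_false_iff_not, List.isPrefixOf_iff_prefix] at h
    rcases h with ⟨rfl, h⟩ | ⟨h, h'⟩
    · exact Mem.sameOff_setNat_scalar M h _
    · have hne : M.index idx ≠ [] := by
        cases idx with
        | nil => simp at h'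
        | cons => simp [Mem.index]
      refine ⟨List.map_congr_left fun y _ => ?_, fun arr' i _ hi => ?_, fun _ _ _ _ => rfl⟩
      · simp [run, Mem.scalar, Mem.setNat, hne.symm]
      · have : i ≠ M.index idx := by
          rintro rfl
          exact hi (h.map _)
        simp [run, Mem.setNat, this]
  | rset arr idx e =>
    simp only [confined, Bool.or_eq_true, List.isEmpty_iff, List.isPrefixOf_iff_prefix] at h
    refine ⟨rfl, fun _ _ _ _ => rfl, fun arr' i h0 hi => ?_⟩
    have : i ≠ M.index idx := by
      rintro rfl
      rcases h with rfl | h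
      · exact h0 rfl
      · exact hi (h.map _)
    simp [run, Mem.setReal, this]
  | seq c d ihc ihd =>
    simp only [confined, Bool.and_eq_true] at h
    exact (ihc h.1 M).trans (ihd h.2 _)
  | ite t c d ihc ihd =>
    simp only [confined, Bool.and_eq_true] at h
    rw [run]
    split_ifs
    · exact ihc h.1 M
    · exact ihd h.2 M
  | loop i e c ih =>
    simp only [confined, Bool.and_eq_true, Bool.not_eq_true', List.contains_eq_mem,
      decide_eq_false_iff_not] at h
    refine run_loop_induction (fun _ M' => Mem.SameOff p M M') rfl (Mem.SameOff.refl p M)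
      fun j _ M' hM' => ?_
    exact (hM'.trans (Mem.sameOff_setNat_scalar M' h.1 j)).trans (ih h.2 _)
  | start => exact Mem.SameOff.refl p M
  | play => exact Mem.SameOff.refl p M

/-! ## Running times -/

/-- An upper bound for the running time if all loops have length at most `U`. -/
def Prog.timeBound {R : Type*} [CommSemiring R] (U : R) : Prog → R
  | .skip => 1
  | .nset _ idx e => ((1 + idx.length + e.cost : ℕ) : R)
  | .rset _ idx e => ((1 + idx.length + e.cost : ℕ) : R)
  | .seq c d => c.timeBound U + d.timeBound U
  | .ite t c d => ((1 + t.cost : ℕ) : R) + (c.timeBound U + d.timeBound U)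
  | .loop _ e c => ((1 + e.cost : ℕ) : R) + U * (1 + c.timeBound U)
  | .start _ => 1
  | .play _ _ _ _ => 1

/-- The same recursion is read in `ℕ`, as a bound for actual runs, and in a polynomial ring, as a
polynomial; evaluation carries the second to the first. -/
theorem Prog.map_timeBound {R R' : Type*} [CommSemiring R] [CommSemiring R'] (f : R →+* R')
    (U : R) (c : Prog) : f (c.timeBound U) = c.timeBound (f U) := by
  induction c with
  | seq c d ihc ihd => simp [timeBound, ihc, ihd]
  | ite t c d ihc ihd => simp [timeBound, ihc, ihd]
  | loop i e c ih => simp [timeBound, ih]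
  | _ => simp [timeBound]

/-- The lengths of all loops are read from the arrays `0, …, n - 1` of natural numbers, which are
not changed. -/
def Prog.LoopsBelow (n : ℕ) : Prog → Prop
  | .nset arr _ _ => n ≤ arr
  | .seq c d => c.LoopsBelow n ∧ d.LoopsBelow n
  | .ite _ c d => c.LoopsBelow n ∧ d.LoopsBelow n
  | .loop i (.get arr _) c => n ≤ i ∧ arr < n ∧ c.LoopsBelow n
  | .loop _ _ _ => False
  | .start x => n ≤ x
  | .play _ _ _ x => n ≤ x
  | _ => True

/-- The arrays holding loop lengths are not written, even by `start` and `play`, so the bound `U`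
survives every instruction. It is carried along with the time estimate in one induction. -/
theorem exec_time_le (E : Env) {n U : ℕ} {c : Prog} (hc : c.LoopsBelow n) (σ : Config)
    (hσ : ∀ arr < n, ∀ i, σ.mem.nat arr i ≤ U) :
    (∀ arr < n, ∀ i, (exec E c σ).mem.nat arr i ≤ U) ∧
      (exec E c σ).time ≤ σ.time + c.timeBound U := by
  have hset : ∀ (M : Mem) (x : ℕ) (i : List ℕ) (v : ℕ), n ≤ x →
      (∀ arr < n, ∀ i, M.nat arr i ≤ U) → ∀ arr < n, ∀ i', (M.setNat x i v).nat arr i' ≤ U :=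
    fun M x i v hx hM arr harr i' => by
      rw [Mem.setNat_nat_of_ne _ (by omega)]
      exact hM arr harr i'
  induction c generalizing σ with
  | skip => exact ⟨hσ, le_rfl⟩
  | nset arr idx e =>
    refine ⟨hset _ _ _ _ hc hσ, ?_⟩
    simp only [exec, Prog.timeBound, Nat.cast_id]
    omega
  | rset arr idx e =>
    refine ⟨hσ, ?_⟩
    simp only [exec, Prog.timeBound, Nat.cast_id]
    omega
  | seq c d ihc ihd =>
    obtain ⟨h1, h2⟩ := ihc hc.1 σ hσ
    obtain ⟨h3, h4⟩ := ihd hc.2 _ h1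
    refine ⟨h3, ?_⟩
    simp only [exec, Prog.timeBound]
    omega
  | ite t c d ihc ihd =>
    simp only [exec, Prog.timeBound, Nat.cast_id]
    split_ifs
    · obtain ⟨h1, h2⟩ := ihc hc.1 { σ with time := σ.time + 1 + t.cost } hσ
      exact ⟨h1, by dsimp only at h2; omega⟩
    · obtain ⟨h1, h2⟩ := ihd hc.2 { σ with time := σ.time + 1 + t.cost } hσ
      exact ⟨h1, by dsimp only at h2; omega⟩
  | loop i e c ih =>
    cases e with
    | get arr idx =>
      obtain ⟨h1, h2, h3⟩ := hc
      have hU : (NExp.get arr idx).eval σ.mem ≤ U := hσ arr h2 _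
      have := foldl_range_induction (fun j (σ' : Config) =>
          (∀ arr < n, ∀ i, σ'.mem.nat arr i ≤ U) ∧
          σ'.time ≤ σ.time + 1 + (NExp.get arr idx).cost + j * (1 + c.timeBound U))
        (fun σ' j => exec E c { σ' with mem := σ'.mem.setNat i [] j, time := σ'.time + 1 })
        ((NExp.get arr idx).eval σ.mem) { σ with time := σ.time + 1 + (NExp.get arr idx).cost }
        ⟨hσ, by simp⟩ fun j _ σ' hσ' => by
          obtain ⟨h4, h5⟩ := ih h3
            { σ' with mem := σ'.mem.setNat i [] j, time := σ'.time + 1 }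
            (hset _ _ _ _ h1 hσ'.1)
          refine ⟨h4, h5.trans ?_⟩
          have := hσ'.2
          dsimp only
          rw [add_mul, one_mul]
          omega
      refine ⟨this.1, this.2.trans ?_⟩
      have h6 := Nat.mul_le_mul_right (1 + c.timeBound U) hU
      simp only [Prog.timeBound, Nat.cast_id]
      omega
    | const => exact hc.elim
    | add => exact hc.elim
    | sub => exact hc.elim
  | start x => exact ⟨hset _ _ _ _ hc hσ, le_rfl⟩
  | play a b y x => exact ⟨hset _ _ _ _ hc hσ, le_rfl⟩

/-! ## The program

Natural scalars and arrays: `0, …, 9` input and policies, `10` visit counts, `11` transition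
counts, `12` the number zero, `13` episode, `14` loop counter, `15` step, `16` next step,
`17` state, `18`, `19` actions, `20` next state, `21`, `22` best actions, `23` current state,
`24` next state, `26`, `27` actions played. Real scalars and arrays: `0, …, 5` input, `Q` and `V`,
`6` observed rewards, `7` the number `ι`, `8`, `9` sums, `10` bonus, `11` reward. -/

/-- Computes `Q^up` and `Q^low` at one cell. -/
def cellProg : Prog :=
  .ite (.nle (.get 10 [15, 17, 18, 19]) (.const 0))
    (.seq (.rset 2 [15, 17, 18, 19] (.ofNat (.get 0 [])))
      (.rset 3 [15, 17, 18, 19] (.ofNat (.const 0))))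
    (.seq (.rset 8 [] (.ofNat (.const 0)))
    (.seq (.rset 9 [] (.ofNat (.const 0)))
    (.seq (.loop 20 (.get 5 [16])
      (.seq (.rset 8 [] (.add (.get 8 []) (.mul (.div (.ofNat (.get 11 [15, 17, 18, 19, 20]))
          (.ofNat (.get 10 [15, 17, 18, 19]))) (.get 4 [16, 20]))))
        (.rset 9 [] (.add (.get 9 []) (.mul (.div (.ofNat (.get 11 [15, 17, 18, 19, 20]))
          (.ofNat (.get 10 [15, 17, 18, 19]))) (.get 5 [16, 20]))))))
    (.seq (.rset 10 [] (.mul (.get 0 []) (.sqrt (.div (.mul (.mul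
        (.mul (.ofNat (.get 0 [])) (.ofNat (.get 0 []))) (.ofNat (.get 2 []))) (.get 7 []))
        (.ofNat (.get 10 [15, 17, 18, 19]))))))
    (.seq (.rset 8 [] (.add (.add (.get 6 [15, 17, 18, 19]) (.get 8 [])) (.get 10 [])))
    (.seq (.rset 9 [] (.sub (.add (.get 6 [15, 17, 18, 19]) (.get 9 [])) (.get 10 [])))
    (.seq (.ite (.rle (.get 8 []) (.ofNat (.get 0 [])))
        (.rset 2 [15, 17, 18, 19] (.get 8 []))
        (.rset 2 [15, 17, 18, 19] (.ofNat (.get 0 []))))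
      (.ite (.rle (.get 9 []) (.ofNat (.const 0)))
        (.rset 3 [15, 17, 18, 19] (.ofNat (.const 0)))
        (.rset 3 [15, 17, 18, 19] (.get 9 []))))))))))

/-- Puts into the scalar `best` the first of the indices below `e` that is best according to
the test `t`, which compares the candidate `i` with `best`. -/
def scanProg (i best : ℕ) (e : NExp) (t : Test) : Prog :=
  .seq (.nset best [] (.const 0)) (.loop i e (.ite t .skip (.nset best [] (.get i []))))

/-- Computes `Q^up` and `Q^low` for all actions of the min-player. -/
def rowProg : Prog := .loop 19 (.get 7 [15]) cellProg

/-- Computes `Q^up` and `Q^low` at one state. -/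
def matrixProg : Prog := .loop 18 (.get 6 [15]) rowProg

/-- Computes `Q`, `V` and the policies at one state. -/
def stateProg : Prog :=
  .seq matrixProg
  (.seq (scanProg 18 21 (.get 6 [15]) (.rle (.get 2 [15, 17, 18, 12]) (.get 2 [15, 17, 21, 12])))
  (.seq (scanProg 19 22 (.get 7 [15]) (.rle (.get 3 [15, 17, 12, 22]) (.get 3 [15, 17, 12, 19])))
  (.seq (.nset 8 [15, 17] (.get 21 []))
  (.seq (.nset 9 [15, 17] (.get 22 []))
  (.seq (.rset 4 [15, 17] (.get 2 [15, 17, 21, 22]))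
    (.rset 5 [15, 17] (.get 3 [15, 17, 21, 22])))))))

/-- Computes `Q`, `V` and the policies at all states of one step. -/
def levelProg : Prog := .loop 17 (.get 5 [15]) stateProg

/-- Computes all that VI-ULCB computes before an episode. -/
def planProg : Prog :=
  .loop 14 (.get 0 []) (.seq (.nset 15 [] (.sub (.sub (.get 0 []) (.const 1)) (.get 14 [])))
    (.seq (.nset 16 [] (.add (.get 15 []) (.const 1))) levelProg))

/-- The memory holds the input and the statistics. -/
structure Loaded (D : Dims) (S : ℕ) (c ι : ℝ) (d : Stats) (M : Mem) : Prop where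
  horizon : M.nat 0 [] = D.H
  bound : M.nat 2 [] = S
  nS : ∀ h ≤ D.H, M.nat 5 [h] = D.nS h
  nA : ∀ h < D.H, M.nat 6 [h] = D.nA h
  nB : ∀ h < D.H, M.nat 7 [h] = D.nB h
  N : ∀ h s a b, M.nat 10 [h, s, a, b] = d.N h s a b
  Ntr : ∀ h s a b s', M.nat 11 [h, s, a, b, s'] = d.Ntr h s a b s'
  zero : M.nat 12 [] = 0
  coeff : M.real 0 [] = c
  rhat : ∀ h s a b, M.real 6 [h, s, a, b] = d.rhat h s a b
  iota : M.real 7 [] = ι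

/-- The bonus as a function of `ι`. -/
def bonusOf (D : Dims) (S : ℕ) (c ι : ℝ) (t : ℕ) : ℝ :=
  c * √((D.H : ℝ) ^ 2 * S * ι / t)

/-! ### Correctness of the planning phase. -/

section Plan

variable {D : Dims} {S : ℕ} {c ι : ℝ} {d : Stats}

theorem Loaded.congr {M M' : Mem} (hM : Loaded D S c ι d M)
    (hn : ∀ arr ∈ [0, 2, 5, 6, 7, 10, 11, 12], M'.nat arr = M.nat arr)
    (hr : ∀ arr ∈ [0, 6, 7], M'.real arr = M.real arr) : Loaded D S c ι d M' := by
  simp only [List.mem_cons, List.not_mem_nil, or_false, forall_eq_or_imp, forall_eq] at hn hr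
  obtain ⟨n0, n2, n5, n6, n7, n10, n11, n12⟩ := hn
  obtain ⟨r0, r6, r7⟩ := hr
  exact ⟨n0 ▸ hM.1, n2 ▸ hM.2, n5 ▸ hM.3, n6 ▸ hM.4, n7 ▸ hM.5, n10 ▸ hM.6, n11 ▸ hM.7,
    n12 ▸ hM.8, r0 ▸ hM.9, r6 ▸ hM.10, r7 ▸ hM.11⟩

theorem Loaded.setNat {M : Mem} (hM : Loaded D S c ι d M) {x : ℕ} (hx : 13 ≤ x) (i : List ℕ)
    (v : ℕ) : Loaded D S c ι d (M.setNat x i v) := by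
  refine hM.congr (fun arr harr => Mem.setNat_nat_of_ne _ ?_ _ _) fun _ _ => rfl
  rintro rfl
  simp at harr
  omega

theorem Loaded.run {M : Mem} (hM : Loaded D S c ι d M) {prog : Prog}
    (hn : ∀ arr ∈ [0, 2, 5, 6, 7, 10, 11, 12], arr ∉ prog.natWrites)
    (hr : ∀ arr ∈ [0, 6, 7], arr ∉ prog.realWrites) : Loaded D S c ι d (prog.run M) :=
  hM.congr (fun arr harr => Prog.run_nat (hn arr harr) M)
    fun arr harr => Prog.run_real (hr arr harr) M

/-- The situation in which `Q` is computed at step `h`. -/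
structure AtLevel (D : Dims) (S : ℕ) (c ι : ℝ) (d : Stats) (h : ℕ)
    (V W : Fin (D.nS (h + 1)) → ℝ) (M : Mem) : Prop where
  loaded : Loaded D S c ι d M
  lt : h < D.H
  step : M.nat 15 [] = h
  next : M.nat 16 [] = h + 1
  up : ∀ s' : Fin (D.nS (h + 1)), M.real 4 [h + 1, s'] = V s'
  low : ∀ s' : Fin (D.nS (h + 1)), M.real 5 [h + 1, s'] = W s'

variable {h : ℕ} {V W : Fin (D.nS (h + 1)) → ℝ}

theorem AtLevel.setNat {M : Mem} (hM : AtLevel D S c ι d h V W M) {x : ℕ} (hx : 17 ≤ x)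
    (i : List ℕ) (v : ℕ) : AtLevel D S c ι d h V W (M.setNat x i v) :=
  ⟨hM.1.setNat (by omega) i v, hM.2, by rw [Mem.setNat_nat_of_ne _ (by omega)]; exact hM.3,
    by rw [Mem.setNat_nat_of_ne _ (by omega)]; exact hM.4, hM.5, hM.6⟩

/-- A program confined to indices that begin with `h` cannot disturb the values stored for step `h +
1`. -/
theorem AtLevel.run {M : Mem} (hM : AtLevel D S c ι d h V W M) {prog : Prog}
    (hn : ∀ arr ∈ [0, 2, 5, 6, 7, 10, 11, 12, 15, 16], arr ∉ prog.natWrites)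
    (hr : ∀ arr ∈ [0, 6, 7], arr ∉ prog.realWrites) (hp : prog.confined [15] = true) :
    AtLevel D S c ι d h V W (prog.run M) := by
  have hs := Prog.sameOff_run hp M
  refine ⟨hM.1.run (fun arr harr => hn arr ?_) hr, hM.2, ?_, ?_, fun s' => ?_, fun s' => ?_⟩
  · simp only [List.mem_cons, List.not_mem_nil, or_false] at harr ⊢
    omega
  · rw [Prog.run_nat (hn 15 (by simp))]; exact hM.3
  · rw [Prog.run_nat (hn 16 (by simp))]; exact hM.4
  · rw [hs.3 _ _ (by simp) (by simp [Mem.index, Mem.scalar, hM.step])]; exact hM.5 s'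
  · rw [hs.3 _ _ (by simp) (by simp [Mem.index, Mem.scalar, hM.step])]; exact hM.6 s'

/-- Symbolic execution: after each instruction the new memory is generalized to a variable, and only
the few facts needed later are kept, so that terms stay small. -/
theorem run_cellProg {M : Mem} (hM : AtLevel D S c ι d h V W M) (s : Fin (D.nS h))
    (a : Fin (D.nA h)) (b : Fin (D.nB h)) (hs : M.nat 17 [] = s) (ha : M.nat 18 [] = a)
    (hb : M.nat 19 [] = b) :
    (cellProg.run M).real 2 [h, s, a, b] = updUp D (bonusOf D S c ι) d h V s a b ∧
      (cellProg.run M).real 3 [h, s, a, b] = updLow D (bonusOf D S c ι) d h W s a b := by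
  have hstep := hM.step
  rw [cellProg, Prog.run]
  by_cases h0 : d.N h s a b = 0
  · have ht : (Test.nle (.get 10 [15, 17, 18, 19]) (.const 0)).holds M := by
      simp [Test.holds, NExp.eval, Mem.index, Mem.scalar, hstep, hs, ha, hb, hM.loaded.N, h0]
    rw [if_pos ht, updUp, updLow, if_pos h0, if_pos h0]
    simp [Prog.run, Mem.index, Mem.scalar, Mem.setReal, hstep, hs, ha, hb, RExp.eval, NExp.eval,
      hM.loaded.horizon]
  · have ht : ¬(Test.nle (.get 10 [15, 17, 18, 19]) (.const 0)).holds M := by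
      simp [Test.holds, NExp.eval, Mem.index, Mem.scalar, hstep, hs, ha, hb, hM.loaded.N, h0]
    rw [if_neg ht]
    simp only [Prog.run_seq]
    set M₁ := (Prog.rset 9 [] (.ofNat (.const 0))).run
      ((Prog.rset 8 [] (.ofNat (.const 0))).run M) with hM₁
    generalize hM₂ : Prog.run (.loop 20 _ _) M₁ = M₂
    have key : (∀ arr, arr ≠ 20 → M₂.nat arr = M.nat arr) ∧
        (∀ arr, arr ≠ 8 → arr ≠ 9 → M₂.real arr = M.real arr) ∧
        M₂.real 8 [] = ∑ s' : Fin (D.nS (h + 1)), d.Phat h s a b s' * V s' ∧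
        M₂.real 9 [] = ∑ s' : Fin (D.nS (h + 1)), d.Phat h s a b s' * W s' := by
      have hn : (NExp.get 5 [16]).eval M₁ = D.nS (h + 1) := by
        rw [← hM.loaded.nS (h + 1) hM.lt, ← hM.next]
        rfl
      -- Sums over `Fin` are turned into sums over a range, of which the loop invariant can state
      -- the partial sums.
      have hext : ∀ f : ℕ → ℝ, ∑ s' : Fin (D.nS (h + 1)), f s' =
          ∑ j ∈ Finset.range (D.nS (h + 1)), f j := fun f => (Finset.sum_range f).symm
      have hV : ∀ (F : Fin (D.nS (h + 1)) → ℝ) (arr : ℕ),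
          (∀ s' : Fin (D.nS (h + 1)), M.real arr [h + 1, s'] = F s') →
          ∑ s' : Fin (D.nS (h + 1)), d.Phat h s a b s' * F s' =
          ∑ j ∈ Finset.range (D.nS (h + 1)), d.Phat h s a b j * M.real arr [h + 1, j] :=
        fun F arr hF => by rw [← hext]; simp only [hF]
      rw [hV V 4 hM.up, hV W 5 hM.low, ← hM₂]
      refine Prog.run_loop_induction (fun j M' =>
        (∀ arr, arr ≠ 20 → M'.nat arr = M.nat arr) ∧
        (∀ arr, arr ≠ 8 → arr ≠ 9 → M'.real arr = M.real arr) ∧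
        M'.real 8 [] = ∑ j ∈ Finset.range j, d.Phat h s a b j * M.real 4 [h + 1, j] ∧
        M'.real 9 [] = ∑ j ∈ Finset.range j, d.Phat h s a b j * M.real 5 [h + 1, j]) hn ?_ ?_
      · refine ⟨fun arr _ => rfl, fun arr h8 h9 => ?_, ?_, ?_⟩
        · funext i
          simp [hM₁, Prog.run, Mem.setReal, h8, h9]
        · simp [hM₁, Prog.run, Mem.setReal, RExp.eval, NExp.eval, Mem.index]
        · simp [hM₁, Prog.run, Mem.setReal, RExp.eval, NExp.eval, Mem.index]
      · rintro j - M' ⟨h1, h2, h3, h4⟩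
        refine ⟨fun arr harr => ?_, fun arr h8 h9 => ?_, ?_, ?_⟩
        · rw [Prog.run_nat (by simp [Prog.natWrites]), Mem.setNat_nat_of_ne _ harr, h1 arr harr]
        · rw [Prog.run_real (by simp [Prog.realWrites, h8, h9])]
          exact h2 arr h8 h9
        · rw [Finset.sum_range_succ, ← h3]
          simp [Prog.run, Mem.setReal, Mem.setNat, RExp.eval, NExp.eval, Mem.index, Mem.scalar,
            h1, h2, hstep, hM.next, hs, ha, hb, hM.loaded.N, hM.loaded.Ntr, Stats.Phat]
        · rw [Finset.sum_range_succ, ← h4]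
          simp [Prog.run, Mem.setReal, Mem.setNat, RExp.eval, NExp.eval, Mem.index, Mem.scalar,
            h1, h2, hstep, hM.next, hs, ha, hb, hM.loaded.N, hM.loaded.Ntr, Stats.Phat]
    obtain ⟨k1, k2, k3, k4⟩ := key
    clear_value M₁
    rw [updUp, updLow, if_neg h0, if_neg h0, ← k3, ← k4]
    have e15 : M₂.nat 15 [] = h := by rw [k1 _ (by norm_num)]; exact hstep
    have e17 : M₂.nat 17 [] = s := by rw [k1 _ (by norm_num)]; exact hs
    have e18 : M₂.nat 18 [] = a := by rw [k1 _ (by norm_num)]; exact ha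
    have e19 : M₂.nat 19 [] = b := by rw [k1 _ (by norm_num)]; exact hb
    have e0 : M₂.nat 0 [] = D.H := by rw [k1 _ (by norm_num)]; exact hM.loaded.horizon
    have e2 : M₂.nat 2 [] = S := by rw [k1 _ (by norm_num)]; exact hM.loaded.bound
    have e10 : M₂.nat 10 [h, s, a, b] = d.N h s a b := by
      rw [k1 _ (by norm_num)]; exact hM.loaded.N _ _ _ _
    have r0 : M₂.real 0 [] = c := by rw [k2 _ (by norm_num) (by norm_num)]; exact hM.loaded.coeff
    have r7 : M₂.real 7 [] = ι := by rw [k2 _ (by norm_num) (by norm_num)]; exact hM.loaded.iota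
    have r6 : M₂.real 6 [h, s, a, b] = d.rhat h s a b := by
      rw [k2 _ (by norm_num) (by norm_num)]; exact hM.loaded.rhat _ _ _ _
    clear k1 k2 k3 k4 hM₂
    generalize hM₃ : Prog.run (.rset 10 _ _) M₂ = M₃
    have n3 : M₃.nat = M₂.nat := by rw [← hM₃]; rfl
    have o3 : ∀ arr, arr ≠ 10 → M₃.real arr = M₂.real arr := fun arr harr => by
      rw [← hM₃]; exact Mem.setReal_real_of_ne _ harr _ _
    have v3 : M₃.real 10 [] = bonusOf D S c ι (d.N h s a b) := by
      simp [← hM₃, Prog.run, Mem.setReal, RExp.eval, NExp.eval, Mem.index, Mem.scalar,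
        e15, e17, e18, e19, e0, e2, e10, r0, r7, bonusOf, ← pow_two]
    clear hM₃
    generalize hM₄ : Prog.run (.rset 8 _ _) M₃ = M₄
    have n4 : M₄.nat = M₂.nat := by rw [← hM₄]; exact n3
    have o4 : ∀ arr, arr ≠ 8 → M₄.real arr = M₃.real arr := fun arr harr => by
      rw [← hM₄]; exact Mem.setReal_real_of_ne _ harr _ _
    have v4 : M₄.real 8 [] = d.rhat h s a b + M₂.real 8 [] +
        bonusOf D S c ι (d.N h s a b) := by
      simp [← hM₄, Prog.run, Mem.setReal, RExp.eval, Mem.index, Mem.scalar,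
        n3, e15, e17, e18, e19, r6, o3, v3]
    clear hM₄
    generalize hM₅ : Prog.run (.rset 9 _ _) M₄ = M₅
    have n5 : M₅.nat = M₂.nat := by rw [← hM₅]; exact n4
    have o5 : ∀ arr, arr ≠ 9 → M₅.real arr = M₄.real arr := fun arr harr => by
      rw [← hM₅]; exact Mem.setReal_real_of_ne _ harr _ _
    have v5 : M₅.real 9 [] = d.rhat h s a b + M₂.real 9 [] -
        bonusOf D S c ι (d.N h s a b) := by
      simp [← hM₅, Prog.run, Mem.setReal, RExp.eval, Mem.index, Mem.scalar,
        n4, e15, e17, e18, e19, r6, o4, o3, v3]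
    rw [← o5 8 (by norm_num)] at v4
    rw [← v4, ← v5]
    clear hM₅ v3 v4 v5 o3 o4 o5
    -- The real scalars `8` and `9` now hold the untruncated bounds; what remains are the two
    -- comparisons, matched with `min_def` and `max_def`.
    rw [Prog.run_real (arr := 2) (by simp [Prog.realWrites])]
    constructor
    · rw [min_def]
      simp only [Prog.run, Test.holds, RExp.eval, NExp.eval, Mem.index, List.map_nil, n5, e0]
      split_ifs <;> simp [Mem.setReal, Mem.scalar, n5, e15, e17, e18, e19]
    · rw [max_def]
      generalize hM₆ : Prog.run (.ite (.rle (.get 8 []) _) _ _) M₅ = M₆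
      have n6 : M₆.nat = M₂.nat := by
        rw [← hM₆, Prog.run]
        split_ifs <;> exact n5
      have o6 : M₆.real 9 = M₅.real 9 := by
        rw [← hM₆]
        exact Prog.run_real (by simp [Prog.realWrites]) _
      simp only [Prog.run, Test.holds, RExp.eval, NExp.eval, Mem.index, List.map_nil,
        Nat.cast_zero, o6]
      split_ifs <;> simp [Mem.setReal, Mem.scalar, n6, e15, e17, e18, e19]

end Plan

section Plan

variable {D : Dims} {S : ℕ} {c ι : ℝ} {d : Stats} {h : ℕ} {V W : Fin (D.nS (h + 1)) → ℝ}

/-- Iteration `j` writes array entries only at indices that begin with `h, s, a, j`, so the entries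
of earlier iterations persist. -/
theorem run_rowProg {M : Mem} (hM : AtLevel D S c ι d h V W M) (s : Fin (D.nS h))
    (a : Fin (D.nA h)) (hs : M.nat 17 [] = s) (ha : M.nat 18 [] = a) (b : Fin (D.nB h)) :
    (rowProg.run M).real 2 [h, s, a, b] = updUp D (bonusOf D S c ι) d h V s a b ∧
      (rowProg.run M).real 3 [h, s, a, b] = updLow D (bonusOf D S c ι) d h W s a b := by
  have hn : (NExp.get 7 [15]).eval M = D.nB h := by
    rw [← hM.loaded.nB h hM.lt, ← hM.step]; rfl
  refine (Prog.run_loop_induction (fun j M' => AtLevel D S c ι d h V W M' ∧ M'.nat 17 [] = s ∧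
    M'.nat 18 [] = a ∧ ∀ b : Fin (D.nB h), (b : ℕ) < j →
      M'.real 2 [h, s, a, b] = updUp D (bonusOf D S c ι) d h V s a b ∧
      M'.real 3 [h, s, a, b] = updLow D (bonusOf D S c ι) d h W s a b) hn
    ⟨hM, hs, ha, by simp⟩ ?_).2.2.2 b b.2
  rintro j hj M' ⟨h1, h2, h3, h4⟩
  have h1' := h1.setNat (x := 19) (by norm_num) [] j
  have e17 : (M'.setNat 19 [] j).nat 17 [] = s := h2
  have e18 : (M'.setNat 19 [] j).nat 18 [] = a := h3
  have e19 : (M'.setNat 19 [] j).nat 19 [] = j := by simp [Mem.setNat]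
  generalize hM₁ : M'.setNat 19 [] j = M₁ at h1' e17 e18 e19
  have hsame := Prog.sameOff_run (p := [15, 17, 18, 19]) (c := cellProg) (by decide) M₁
  have hidx : M₁.index [15, 17, 18, 19] = [h, (s : ℕ), (a : ℕ), j] := by
    simp [Mem.index, Mem.scalar, h1'.step, e17, e18, e19]
  refine ⟨h1'.run (by decide) (by decide) (by decide), ?_, ?_, fun b hb => ?_⟩
  · rw [Prog.run_nat (by decide), e17]
  · rw [Prog.run_nat (by decide), e18]
  · rcases Nat.lt_succ_iff_lt_or_eq.1 hb with hb | hb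
    · have hne : ¬M₁.index [15, 17, 18, 19] <+: [h, (s : ℕ), (a : ℕ), (b : ℕ)] := by
        rw [hidx]
        simp
        omega
      rw [hsame.3 _ _ (by simp) hne, hsame.3 _ _ (by simp) hne, ← hM₁]
      exact h4 b hb
    · exact run_cellProg h1' s a b e17 e18 (by rw [e19, hb])

theorem run_matrixProg {M : Mem} (hM : AtLevel D S c ι d h V W M) (s : Fin (D.nS h))
    (hs : M.nat 17 [] = s) (a : Fin (D.nA h)) (b : Fin (D.nB h)) :
    (matrixProg.run M).real 2 [h, s, a, b] = updUp D (bonusOf D S c ι) d h V s a b ∧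
      (matrixProg.run M).real 3 [h, s, a, b] = updLow D (bonusOf D S c ι) d h W s a b := by
  have hn : (NExp.get 6 [15]).eval M = D.nA h := by
    rw [← hM.loaded.nA h hM.lt, ← hM.step]; rfl
  refine (Prog.run_loop_induction (fun j M' => AtLevel D S c ι d h V W M' ∧ M'.nat 17 [] = s ∧
    ∀ (a : Fin (D.nA h)) (b : Fin (D.nB h)), (a : ℕ) < j →
      M'.real 2 [h, s, a, b] = updUp D (bonusOf D S c ι) d h V s a b ∧
      M'.real 3 [h, s, a, b] = updLow D (bonusOf D S c ι) d h W s a b) hn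
    ⟨hM, hs, by simp⟩ ?_).2.2 a b a.2
  rintro j hj M' ⟨h1, h2, h4⟩
  have h1' := h1.setNat (x := 18) (by norm_num) [] j
  have e17 : (M'.setNat 18 [] j).nat 17 [] = s := h2
  have e18 : (M'.setNat 18 [] j).nat 18 [] = j := by simp [Mem.setNat]
  generalize hM₁ : M'.setNat 18 [] j = M₁ at h1' e17 e18
  have hsame := Prog.sameOff_run (p := [15, 17, 18]) (c := rowProg) (by decide) M₁
  have hidx : M₁.index [15, 17, 18] = [h, (s : ℕ), j] := by
    simp [Mem.index, Mem.scalar, h1'.step, e17, e18]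
  refine ⟨h1'.run (by decide) (by decide) (by decide), ?_, fun a b ha => ?_⟩
  · rw [Prog.run_nat (by decide), e17]
  · rcases Nat.lt_succ_iff_lt_or_eq.1 ha with ha | ha
    · have hne : ¬M₁.index [15, 17, 18] <+: [h, (s : ℕ), (a : ℕ), (b : ℕ)] := by
        rw [hidx]
        simp
        omega
      rw [hsame.3 _ _ (by simp) hne, hsame.3 _ _ (by simp) hne, ← hM₁]
      exact h4 a b ha
    · exact run_rowProg h1' s a e17 (by rw [e18, ha]) b

theorem argmax_eq_of_first {n : ℕ} [NeZero n] (f : Fin n → ℝ) (m : Fin n)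
    (hmax : ∀ a, f a ≤ f m) (hfirst : ∀ a < m, f a < f m) : argmax f = m := by
  classical
  refine le_antisymm (Finset.min'_le _ _ (Finset.mem_filter.2 ⟨Finset.mem_univ m, hmax⟩)) ?_
  by_contra hlt
  exact absurd (hfirst _ (not_le.1 hlt)) (not_lt.2 (argmax_spec f m))

/-- After `j` rounds `best` is the first maximizer among the indices below `j`. A candidate replaces
it only if strictly better, which is the tie-breaking rule of `argmax`. The test has to be
understood only on memories that differ from `M` in the names `i` and `best`. -/
theorem run_scanProg {M : Mem} {i best n : ℕ} [NeZero n] {e : NExp} {t : Test} (f : Fin n → ℝ)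
    (hne : i ≠ best) (he : e.eval (M.setNat best [] 0) = n)
    (ht : ∀ M' : Mem, (∀ arr, arr ≠ i → arr ≠ best → M'.nat arr = M.nat arr) →
      M'.real = M.real → ∀ x y : Fin n, M'.nat i [] = x → M'.nat best [] = y →
      (t.holds M' ↔ f x ≤ f y)) :
    ((scanProg i best e t).run M).nat best [] = argmax f := by
  have key := Prog.run_loop_induction (i := i) (c := .ite t .skip (.nset best [] (.get i [])))
    (fun j M' => (∀ arr, arr ≠ i → arr ≠ best → M'.nat arr = M.nat arr) ∧ M'.real = M.real ∧
      -- The `max` covers the start, when `best` is already `0` and nothing has been compared.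
      ∃ m : Fin n, M'.nat best [] = m ∧ (m : ℕ) < max j 1 ∧
        ∀ a : Fin n, (a : ℕ) < j → f a ≤ f m ∧ (a < m → f a < f m)) he
    ⟨fun arr _ h' => Mem.setNat_nat_of_ne _ h' _ _, rfl, 0, by simp [Mem.setNat], by simp,
      by simp⟩ ?_
  · obtain ⟨-, -, m, h1, -, h3⟩ := key
    rw [argmax_eq_of_first f m (fun a => (h3 a a.2).1) fun a ha => (h3 a a.2).2 ha]
    exact h1
  · rintro j hj M' ⟨h1, h2, m, h3, h4, h5⟩
    have g1 : ∀ arr, arr ≠ i → arr ≠ best → (M'.setNat i [] j).nat arr = M.nat arr :=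
      fun arr ha hb => by rw [Mem.setNat_nat_of_ne _ ha, h1 arr ha hb]
    have g3 : (M'.setNat i [] j).nat best [] = m := by
      rw [Mem.setNat_nat_of_ne _ hne.symm, h3]
    have g4 : (M'.setNat i [] j).nat i [] = j := by simp [Mem.setNat]
    have hiff := ht (M'.setNat i [] j) g1 h2 ⟨j, hj⟩ m g4 g3
    rw [Prog.run]
    split_ifs with hc
    · refine ⟨g1, h2, m, g3, by omega, fun a ha => ?_⟩
      rcases Nat.lt_succ_iff_lt_or_eq.1 ha with ha | ha
      · exact h5 a ha
      · obtain rfl : a = ⟨j, hj⟩ := Fin.ext ha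
        refine ⟨hiff.1 hc, fun hlt => ?_⟩
        have : j < (m : ℕ) := hlt
        omega
    · have hlt : f m < f ⟨j, hj⟩ := not_le.1 fun hle => hc (hiff.2 hle)
      refine ⟨fun arr ha hb => ?_, h2, ⟨j, hj⟩, ?_, by simp, fun a ha => ?_⟩
      · rw [Prog.run, Mem.setNat_nat_of_ne _ hb, g1 arr ha hb]
      · simp [Prog.run, Mem.setNat, NExp.eval, Mem.index]
      · rcases Nat.lt_succ_iff_lt_or_eq.1 ha with ha | ha
        · have := (h5 a ha).1.trans_lt hlt
          exact ⟨this.le, fun _ => this⟩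
        · obtain rfl : a = ⟨j, hj⟩ := Fin.ext ha
          exact ⟨le_rfl, fun h => absurd h (lt_irrefl _)⟩

/-- The memory holds what VI-ULCB computes at one state. -/
def HoldsAt (D : Dims) (β : ℕ → ℝ) (l : List Obs) (h : ℕ) (s : Fin (D.nS h)) (M : Mem) : Prop :=
  (∀ (a : Fin (D.nA h)) (b : Fin (D.nB h)),
    M.real 2 [h, s, a, b] = Qup D β vectorNash (statsOf l) h s a b ∧
    M.real 3 [h, s, a, b] = Qlow D β vectorNash (statsOf l) h s a b) ∧
  M.real 4 [h, s] = Vup D β vectorNash (statsOf l) h s ∧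
  M.real 5 [h, s] = Vlow D β vectorNash (statsOf l) h s ∧
  (∃ a : Fin (D.nA h), (viULCB D β vectorNash l).1 h s = PMF.pure a ∧ M.nat 8 [h, s] = a) ∧
  (∃ b : Fin (D.nB h), (viULCB D β vectorNash l).2 h s = PMF.pure b ∧ M.nat 9 [h, s] = b)

theorem HoldsAt.congr {β : ℕ → ℝ} {l : List Obs} {s : Fin (D.nS h)} {M M' : Mem}
    (hM : HoldsAt D β l h s M)
    (hn : ∀ arr i, M'.nat arr (h :: (s : ℕ) :: i) = M.nat arr (h :: (s : ℕ) :: i))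
    (hr : ∀ arr i, M'.real arr (h :: (s : ℕ) :: i) = M.real arr (h :: (s : ℕ) :: i)) :
    HoldsAt D β l h s M' := by
  simpa only [HoldsAt, hn, hr] using hM

theorem Vup_vectorNash (β : ℕ → ℝ) (d : Stats) (hh : h < D.H) (s : Fin (D.nS h)) :
    Vup D β vectorNash d h s = Qup D β vectorNash d h s
      (argmax fun a => Qup D β vectorNash d h s a 0)
      (argmin fun b => Qlow D β vectorNash d h s 0 b) := by
  rw [Vup, show D.H - h = D.H - (h + 1) + 1 by omega]
  exact payoff_pure_pure _ _ _

theorem Vlow_vectorNash (β : ℕ → ℝ) (d : Stats) (hh : h < D.H) (s : Fin (D.nS h)) :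
    Vlow D β vectorNash d h s = Qlow D β vectorNash d h s
      (argmax fun a => Qup D β vectorNash d h s a 0)
      (argmin fun b => Qlow D β vectorNash d h s 0 b) := by
  rw [Vlow, show D.H - h = D.H - (h + 1) + 1 by omega]
  exact payoff_pure_pure _ _ _

/-- The natural scalar `12` is always zero and supplies the index `0` of the column of the upper
matrix, or the row of the lower one, that is scanned. The argmin is a scan of the negated row. -/
theorem run_stateProg {M : Mem} {l : List Obs}
    (hM : AtLevel D S c ι (statsOf l) h (Vup D (bonusOf D S c ι) vectorNash (statsOf l) (h + 1))
      (Vlow D (bonusOf D S c ι) vectorNash (statsOf l) (h + 1)) M) (s : Fin (D.nS h))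
    (hs : M.nat 17 [] = s) :
    HoldsAt D (bonusOf D S c ι) l h s (stateProg.run M) := by
  set β := bonusOf D S c ι with hβ
  set Qu := Qup D β vectorNash (statsOf l) h s with hQu
  set Ql := Qlow D β vectorNash (statsOf l) h s with hQl
  have hlt := hM.lt
  have hQ := run_matrixProg hM s hs
  have hM₁ := hM.run (prog := matrixProg) (by decide) (by decide) (by decide)
  have e17 : (matrixProg.run M).nat 17 [] = s := by rw [Prog.run_nat (by decide), hs]
  simp only [stateProg, Prog.run_seq]
  generalize matrixProg.run M = M₁ at hM₁ hQ e17
  have hQ2 : ∀ (a : Fin (D.nA h)) (b : Fin (D.nB h)), M₁.real 2 [h, s, a, b] = Qu a b :=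
    fun a b => (hQ a b).1
  have hQ3 : ∀ (a : Fin (D.nA h)) (b : Fin (D.nB h)), M₁.real 3 [h, s, a, b] = Ql a b :=
    fun a b => (hQ a b).2
  have e15 := hM₁.step
  have e12 := hM₁.loaded.zero
  have e6 := hM₁.loaded.nA h hlt
  have e7 := hM₁.loaded.nB h hlt
  clear hQ hM₁ hM hs
  have hbest := run_scanProg (M := M₁) (i := 18) (best := 21) (e := .get 6 [15])
    (t := .rle (.get 2 [15, 17, 18, 12]) (.get 2 [15, 17, 21, 12])) (fun a => Qu a 0)
    (by norm_num) (by simp [NExp.eval, Mem.setNat, Mem.index, Mem.scalar, e15, e6])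
    (fun M' h1 h2 x y hx hy => by
      have := hQ2 x 0
      have := hQ2 y 0
      simp_all [Test.holds, RExp.eval, Mem.index, Mem.scalar])
  have f1 : ∀ arr, arr ≠ 18 → arr ≠ 21 → ((scanProg 18 21 (.get 6 [15])
      (.rle (.get 2 [15, 17, 18, 12]) (.get 2 [15, 17, 21, 12]))).run M₁).nat arr = M₁.nat arr :=
    fun arr h1 h2 => Prog.run_nat (by simp [scanProg, Prog.natWrites, h1, h2]) _
  have f2 : ∀ arr, ((scanProg 18 21 (.get 6 [15])
      (.rle (.get 2 [15, 17, 18, 12]) (.get 2 [15, 17, 21, 12]))).run M₁).real arr =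
        M₁.real arr := fun arr => Prog.run_real (by simp [scanProg, Prog.realWrites]) _
  generalize (scanProg 18 21 (.get 6 [15])
      (.rle (.get 2 [15, 17, 18, 12]) (.get 2 [15, 17, 21, 12]))).run M₁ = M₂ at hbest f1 f2
  have hbest' := run_scanProg (M := M₂) (i := 19) (best := 22) (e := .get 7 [15])
    (t := .rle (.get 3 [15, 17, 12, 22]) (.get 3 [15, 17, 12, 19])) (fun b => -Ql 0 b)
    (by norm_num) (by simp [NExp.eval, Mem.setNat, Mem.index, Mem.scalar, f1, e15, e7])
    (fun M' h1 h2 x y hx hy => by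
      have := hQ3 0 x
      have := hQ3 0 y
      simp_all [Test.holds, RExp.eval, Mem.index, Mem.scalar])
  have g1 : ∀ arr, arr ≠ 19 → arr ≠ 22 → ((scanProg 19 22 (.get 7 [15])
      (.rle (.get 3 [15, 17, 12, 22]) (.get 3 [15, 17, 12, 19]))).run M₂).nat arr = M₂.nat arr :=
    fun arr h1 h2 => Prog.run_nat (by simp [scanProg, Prog.natWrites, h1, h2]) _
  have g2 : ∀ arr, ((scanProg 19 22 (.get 7 [15])
      (.rle (.get 3 [15, 17, 12, 22]) (.get 3 [15, 17, 12, 19]))).run M₂).real arr =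
        M₂.real arr := fun arr => Prog.run_real (by simp [scanProg, Prog.realWrites]) _
  generalize (scanProg 19 22 (.get 7 [15])
      (.rle (.get 3 [15, 17, 12, 22]) (.get 3 [15, 17, 12, 19]))).run M₂ = M₃ at hbest' g1 g2
  have m15 : M₃.nat 15 [] = h := by rw [g1 _ (by norm_num) (by norm_num),
    f1 _ (by norm_num) (by norm_num), e15]
  have m17 : M₃.nat 17 [] = s := by rw [g1 _ (by norm_num) (by norm_num),
    f1 _ (by norm_num) (by norm_num), e17]
  have m21 : M₃.nat 21 [] = argmax fun a => Qu a 0 := by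
    rw [g1 _ (by norm_num) (by norm_num), hbest]
  have m22 : M₃.nat 22 [] = argmin fun b => Ql 0 b := hbest'
  have r2 : ∀ (a : Fin (D.nA h)) (b : Fin (D.nB h)), M₃.real 2 [h, s, a, b] = Qu a b :=
    fun a b => by rw [g2, f2, hQ2]
  have r3 : ∀ (a : Fin (D.nA h)) (b : Fin (D.nB h)), M₃.real 3 [h, s, a, b] = Ql a b :=
    fun a b => by rw [g2, f2, hQ3]
  clear hbest hbest' f1 f2 g1 g2 hQ2 hQ3
  refine ⟨fun a b => ⟨?_, ?_⟩, ?_, ?_, ⟨_, rfl, ?_⟩, ⟨_, rfl, ?_⟩⟩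
  · refine Eq.trans ?_ (r2 a b)
    simp [Prog.run, Mem.setNat, Mem.setReal]
  · refine Eq.trans ?_ (r3 a b)
    simp [Prog.run, Mem.setNat, Mem.setReal]
  · rw [Vup_vectorNash β _ hlt, ← hQu, ← hQl, ← r2]
    simp [Prog.run, Mem.setNat, Mem.setReal, NExp.eval, RExp.eval, Mem.index, Mem.scalar, m15,
      m17, m21, m22]
  · rw [Vlow_vectorNash β _ hlt, ← hQu, ← hQl, ← r3]
    simp [Prog.run, Mem.setNat, Mem.setReal, NExp.eval, RExp.eval, Mem.index, Mem.scalar, m15,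
      m17, m21, m22]
  · simp [Prog.run, Mem.setNat, Mem.setReal, NExp.eval, Mem.index, Mem.scalar, m15,
      m17, m21, hQu]
  · simp [Prog.run, Mem.setNat, Mem.setReal, NExp.eval, Mem.index, Mem.scalar, m15,
      m17, m22, hQl]

theorem run_levelProg {M : Mem} {l : List Obs}
    (hM : AtLevel D S c ι (statsOf l) h (Vup D (bonusOf D S c ι) vectorNash (statsOf l) (h + 1))
      (Vlow D (bonusOf D S c ι) vectorNash (statsOf l) (h + 1)) M) (s : Fin (D.nS h)) :
    HoldsAt D (bonusOf D S c ι) l h s (levelProg.run M) := by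
  have hn : (NExp.get 5 [15]).eval M = D.nS h := by
    rw [← hM.loaded.nS h hM.lt.le, ← hM.step]; rfl
  refine (Prog.run_loop_induction (fun j M' => AtLevel D S c ι (statsOf l) h
      (Vup D (bonusOf D S c ι) vectorNash (statsOf l) (h + 1))
      (Vlow D (bonusOf D S c ι) vectorNash (statsOf l) (h + 1)) M' ∧
    ∀ s : Fin (D.nS h), (s : ℕ) < j → HoldsAt D (bonusOf D S c ι) l h s M') hn
    ⟨hM, by simp⟩ ?_).2 s s.2
  rintro j hj M' ⟨h1, h2⟩
  have h1' := h1.setNat (x := 17) (by norm_num) [] j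
  have e17 : (M'.setNat 17 [] j).nat 17 [] = j := by simp [Mem.setNat]
  refine ⟨h1'.run (by decide) (by decide) (by decide), fun s hs => ?_⟩
  rcases Nat.lt_succ_iff_lt_or_eq.1 hs with hs | hs
  · have hsame := Prog.sameOff_run (p := [15, 17]) (c := stateProg) (by decide)
      (M'.setNat 17 [] j)
    have hne : ∀ i, ¬(M'.setNat 17 [] j).index [15, 17] <+: h :: (s : ℕ) :: i := fun i => by
      have : (M'.setNat 17 [] j).index [15, 17] = [h, j] := by
        simp [Mem.index, Mem.scalar, e17, h1'.step]
      rw [this]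
      simp
      omega
    refine (h2 s hs).congr (fun arr i => ?_) fun arr i => ?_
    · rw [hsame.2 _ _ (by simp) (hne i)]
      simp [Mem.setNat]
    · rw [hsame.3 _ _ (by simp) (hne i)]
      rfl
  · exact run_stateProg h1' s (by rw [e17, hs])

/-- The values after the last step. -/
def Mem.Terminal (D : Dims) (M : Mem) : Prop :=
  ∀ s, M.real 4 [D.H, s] = 0 ∧ M.real 5 [D.H, s] = 0

theorem Vup_terminal (β : ℕ → ℝ) (nash : Subroutine) (d : Stats) :
    Vup D β nash d D.H = fun _ => 0 := by
  rw [Vup, Nat.sub_self]; rfl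

theorem Vlow_terminal (β : ℕ → ℝ) (nash : Subroutine) (d : Stats) :
    Vlow D β nash d D.H = fun _ => 0 := by
  rw [Vlow, Nat.sub_self]; rfl

/-- After `j` rounds the last `j` steps are done, and later rounds write only rows of smaller steps.
Row `H` of the value arrays is never written, so its zeros serve as terminal values in every
episode. -/
theorem run_planProg {M : Mem} {l : List Obs} (hM : Loaded D S c ι (statsOf l) M)
    (hT : M.Terminal D) :
    Loaded D S c ι (statsOf l) (planProg.run M) ∧ (planProg.run M).Terminal D ∧
      Holds D (bonusOf D S c ι) vectorNash l (planProg.run M) := by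
  have hn : (NExp.get 0 []).eval M = D.H := hM.horizon
  have key := Prog.run_loop_induction (fun j M' => Loaded D S c ι (statsOf l) M' ∧
    M'.Terminal D ∧ ∀ h < D.H, D.H ≤ h + j → ∀ s : Fin (D.nS h),
      HoldsAt D (bonusOf D S c ι) l h s M') (i := 14)
    (c := .seq (.nset 15 [] (.sub (.sub (.get 0 []) (.const 1)) (.get 14 [])))
      (.seq (.nset 16 [] (.add (.get 15 []) (.const 1))) levelProg)) hn
    ⟨hM, hT, fun h h1 h2 => by omega⟩ ?_
  · exact ⟨key.1, key.2.1, fun h hh => key.2.2 h hh (by omega)⟩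
  rintro j hj M' ⟨h1, h2, h3⟩
  set h := D.H - 1 - j with hh
  have hlt : h < D.H := by omega
  have h1' := h1.setNat (x := 14) (by norm_num) [] j
  simp only [Prog.run_seq]
  generalize hM₁ : Prog.run (.nset 16 [] _) _ = M₁
  have hM₁' : M₁ = ((M'.setNat 14 [] j).setNat 15 [] h).setNat 16 [] (h + 1) := by
    simp [← hM₁, Prog.run, Mem.index, NExp.eval, Mem.setNat, h1.horizon, hh]
  have hnat : ∀ arr x i, M₁.nat arr (x :: i) = M'.nat arr (x :: i) := fun arr x i => by
    simp [hM₁', Mem.setNat]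
  have hreal : M₁.real = M'.real := by rw [hM₁']; rfl
  have hat : AtLevel D S c ι (statsOf l) h
      (Vup D (bonusOf D S c ι) vectorNash (statsOf l) (h + 1))
      (Vlow D (bonusOf D S c ι) vectorNash (statsOf l) (h + 1)) M₁ := by
    have hrow : (∀ s' : Fin (D.nS (h + 1)), M'.real 4 [h + 1, s'] =
        Vup D (bonusOf D S c ι) vectorNash (statsOf l) (h + 1) s') ∧
        ∀ s' : Fin (D.nS (h + 1)), M'.real 5 [h + 1, s'] =
        Vlow D (bonusOf D S c ι) vectorNash (statsOf l) (h + 1) s' := by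
      -- The row below is either the terminal one or the one finished in the previous round.
      rcases Nat.eq_or_lt_of_le hlt with he | hlt'
      · have : h + 1 = D.H := he
        rw [this, Vup_terminal, Vlow_terminal]
        exact ⟨fun s => (h2 s).1, fun s => (h2 s).2⟩
      · have := h3 (h + 1) hlt' (by omega)
        exact ⟨fun s => (this s).2.1, fun s => (this s).2.2.1⟩
    rw [← hreal] at hrow
    refine ⟨?_, hlt, by simp [hM₁', Mem.setNat], by simp [hM₁', Mem.setNat], hrow.1, hrow.2⟩
    rw [hM₁']
    exact (h1'.setNat (by norm_num) _ _).setNat (by norm_num) _ _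
  have hsame := Prog.sameOff_run (p := [15]) (c := levelProg) (by decide) M₁
  have hidx : M₁.index [15] = [h] := by simp [Mem.index, Mem.scalar, hat.step]
  refine ⟨(hat.run (by decide) (by decide) (by decide)).loaded, fun s => ?_,
    fun h' hh' hle s => ?_⟩
  · have hne : ¬M₁.index [15] <+: [D.H, s] := by
      rw [hidx]
      simp
      omega
    rw [hsame.3 _ _ (by simp) hne, hsame.3 _ _ (by simp) hne, hreal]
    exact h2 s
  · rcases eq_or_ne h' h with rfl | hne
    · exact run_levelProg hat s
    · have hne' : ∀ i, ¬M₁.index [15] <+: h' :: i := fun i => by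
        rw [hidx]
        simpa using hne.symm
      refine (h3 h' hh' (by omega) s).congr (fun arr i => ?_) fun arr i => ?_
      · rw [hsame.2 _ _ (by simp) (hne' _), hnat]
      · rw [hsame.3 _ _ (by simp) (hne' _), hreal]

end Plan

/-- Plays one step and updates the statistics. -/
def stepProg : Prog :=
  .seq (.nset 26 [] (.get 8 [15, 23]))
  (.seq (.nset 27 [] (.get 9 [15, 23]))
  (.seq (.play 26 27 11 24)
  (.seq (.nset 10 [15, 23, 26, 27] (.add (.get 10 [15, 23, 26, 27]) (.const 1)))
  (.seq (.nset 11 [15, 23, 26, 27, 24] (.add (.get 11 [15, 23, 26, 27, 24]) (.const 1)))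
  (.seq (.rset 6 [15, 23, 26, 27] (.get 11 []))
    (.nset 23 [] (.get 24 [])))))))

/-- Plays one episode. -/
def playProg : Prog := .seq (.start 23) (.loop 15 (.get 0 []) stepProg)

/-- Carries out VI-ULCB. -/
def mainProg : Prog :=
  .seq (.rset 7 [] (.log (.div (.mul (.mul (.mul (.ofNat (.get 2 [])) (.ofNat (.get 3 [])))
      (.ofNat (.get 4 []))) (.mul (.ofNat (.get 1 [])) (.ofNat (.get 0 [])))) (.get 1 []))))
    (.loop 13 (.get 1 []) (.seq planProg playProg))

theorem exec_seq (E : Env) (c d : Prog) (σ : Config) :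
    exec E (.seq c d) σ = exec E d (exec E c σ) := rfl

theorem Mem.nat_setNat (M : Mem) (arr : ℕ) (i : List ℕ) (v : ℕ) (arr' : ℕ) (i' : List ℕ) :
    (M.setNat arr i v).nat arr' i' = if arr' = arr ∧ i' = i then v else M.nat arr' i' := rfl

theorem Mem.real_setReal (M : Mem) (arr : ℕ) (i : List ℕ) (v : ℝ) (arr' : ℕ) (i' : List ℕ) :
    (M.setReal arr i v).real arr' i' = if arr' = arr ∧ i' = i then v else M.real arr' i' := by
  simp only [Mem.setReal]

theorem Mem.nat_setReal (M : Mem) (arr : ℕ) (i : List ℕ) (v : ℝ) :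
    (M.setReal arr i v).nat = M.nat := rfl

theorem Mem.real_setNat (M : Mem) (arr : ℕ) (i : List ℕ) (v : ℕ) :
    (M.setNat arr i v).real = M.real := rfl

/-! ### Correctness of the interaction with the game, and the total running time. -/

section Play

variable {D : Dims} {S : ℕ} {c ι : ℝ} {d : Stats}

/-- The memory after an observed step. -/
def Mem.record (M : Mem) (x : Obs) : Mem :=
  (((((((M.setNat 26 [] x.a).setNat 27 [] x.b).setReal 11 [] x.r).setNat 24 [] x.s').setNat 10
    [x.h, x.s, x.a, x.b] (M.nat 10 [x.h, x.s, x.a, x.b] + 1)).setNat 11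
    [x.h, x.s, x.a, x.b, x.s'] (M.nat 11 [x.h, x.s, x.a, x.b, x.s'] + 1)).setReal 6
    [x.h, x.s, x.a, x.b] x.r).setNat 23 [] x.s'

theorem Mem.record_nat_of_ne (M : Mem) (x : Obs) {arr : ℕ}
    (h : arr ∉ [10, 11, 23, 24, 26, 27]) : (M.record x).nat arr = M.nat arr := by
  simp only [List.mem_cons, List.not_mem_nil, or_false, not_or] at h
  funext i
  simp [record, nat_setNat, nat_setReal, h]

theorem Mem.record_real_of_ne (M : Mem) (x : Obs) {arr : ℕ} (h : arr ∉ [6, 11]) :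
    (M.record x).real arr = M.real arr := by
  simp only [List.mem_cons, List.not_mem_nil, or_false, not_or] at h
  funext i
  simp [record, real_setReal, real_setNat, h]

theorem Loaded.record {M : Mem} (hM : Loaded D S c ι d M) (x : Obs) :
    Loaded D S c ι (d.observe x) (M.record x) := by
  have hn : ∀ arr, arr ∉ [10, 11, 23, 24, 26, 27] → (M.record x).nat arr = M.nat arr :=
    fun arr h => M.record_nat_of_ne x h
  have hr : ∀ arr, arr ∉ [6, 11] → (M.record x).real arr = M.real arr :=
    fun arr h => M.record_real_of_ne x h
  obtain ⟨h1, h2, h3, h4, h5, h6, h7, h8, h9, h10, h11⟩ := hM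
  refine ⟨?_, ?_, ?_, ?_, ?_, fun h s a b => ?_, fun h s a b s' => ?_, ?_, ?_,
    fun h s a b => ?_, ?_⟩
  · rwa [hn _ (by decide)]
  · rwa [hn _ (by decide)]
  · rwa [hn _ (by decide)]
  · rwa [hn _ (by decide)]
  · rwa [hn _ (by decide)]
  · simp only [Mem.record, Mem.nat_setNat, Mem.nat_setReal, Stats.observe, ← h6]
    by_cases hc : h = x.h ∧ s = x.s ∧ a = x.a ∧ b = x.b
    · obtain ⟨rfl, rfl, rfl, rfl⟩ := hc
      simp
    · simp [hc]
  · simp only [Mem.record, Mem.nat_setNat, Mem.nat_setReal, Stats.observe, ← h7]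
    by_cases hc : h = x.h ∧ s = x.s ∧ a = x.a ∧ b = x.b ∧ s' = x.s'
    · obtain ⟨rfl, rfl, rfl, rfl, rfl⟩ := hc
      simp
    · simp [hc]
  · rwa [hn _ (by decide)]
  · rwa [hr _ (by decide)]
  · simp only [Mem.record, Mem.real_setReal, Mem.real_setNat, Stats.observe, ← h10]
    by_cases hc : h = x.h ∧ s = x.s ∧ a = x.a ∧ b = x.b
    · obtain ⟨rfl, rfl, rfl, rfl⟩ := hc
      simp
    · simp [hc]
  · rwa [hr _ (by decide)]

theorem exec_stepProg (E : Env) {σ : Config} {a b : ℕ} {r : ℝ} {s' : ℕ}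
    (hh : σ.mem.nat 15 [] = σ.step) (hs : σ.mem.nat 23 [] = σ.cur)
    (ha : σ.mem.nat 8 [σ.step, σ.cur] = a) (hb : σ.mem.nat 9 [σ.step, σ.cur] = b)
    (hE : E.next σ.log σ.step σ.cur a b = (r, s')) :
    (exec E stepProg σ).mem = σ.mem.record ⟨σ.step, σ.cur, a, b, r, s'⟩ ∧
      (exec E stepProg σ).cur = s' ∧ (exec E stepProg σ).step = σ.step + 1 ∧
      (exec E stepProg σ).log = σ.log ++ [⟨σ.step, σ.cur, a, b, r, s'⟩] ∧
      (exec E stepProg σ).starts = σ.starts := by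
  simp [stepProg, exec, Mem.record, NExp.eval, RExp.eval, Mem.index, Mem.scalar, Mem.nat_setNat,
    Mem.nat_setReal, Mem.real_setNat, Mem.real_setReal, hh, hs, ha, hb, hE]

/-- The memory holds the (deterministic) policies. -/
def PlansHeld (D : Dims) (β : ℕ → ℝ) (l : List Obs) (M : Mem) : Prop :=
  ∀ h < D.H, ∀ s : Fin (D.nS h),
    (∃ a : Fin (D.nA h), (viULCB D β vectorNash l).1 h s = PMF.pure a ∧ M.nat 8 [h, s] = a) ∧
    (∃ b : Fin (D.nB h), (viULCB D β vectorNash l).2 h s = PMF.pure b ∧ M.nat 9 [h, s] = b)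

/-- The step `i` of the episode that began when `l` had been observed was played according to
VI-ULCB. -/
def PlayedAt (D : Dims) (β : ℕ → ℝ) (l log : List Obs) (i : ℕ) : Prop :=
  ∃ (s : Fin (D.nS i)) (a : Fin (D.nA i)) (b : Fin (D.nB i)) (r : ℝ) (s' : ℕ),
    log[l.length + i]? = some ⟨i, s, a, b, r, s'⟩ ∧
    (viULCB D β vectorNash l).1 i s = PMF.pure a ∧ (viULCB D β vectorNash l).2 i s = PMF.pure b

theorem PlayedAt.append {β : ℕ → ℝ} {l log : List Obs} {i : ℕ} (h : PlayedAt D β l log i)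
    (log' : List Obs) : PlayedAt D β l (log ++ log') i := by
  obtain ⟨s, a, b, r, s', h1, h2⟩ := h
  refine ⟨s, a, b, r, s', ?_, h2⟩
  rw [List.getElem?_append_left (List.getElem?_eq_some_iff.1 h1).1, h1]

/-- The situation after `j` steps of an episode that began when `l` had been observed. -/
structure Playing (D : Dims) (S : ℕ) (c ι : ℝ) (l : List Obs) (starts : List Mem) (j : ℕ)
    (σ : Config) : Prop where
  log : ∃ l', l'.length = j ∧ σ.log = l ++ l'
  step : σ.step = j
  cur : σ.mem.nat 23 [] = σ.cur
  lt : σ.cur < D.nS j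
  loaded : Loaded D S c ι (statsOf σ.log) σ.mem
  terminal : σ.mem.Terminal D
  plans : PlansHeld D (bonusOf D S c ι) l σ.mem
  starts_eq : σ.starts = starts
  played : ∀ i < j, PlayedAt D (bonusOf D S c ι) l σ.log i

/-- Recording an observation does not touch the stored policies, so the whole episode follows the
plan made before it, although the statistics change at each step. -/
theorem exec_playProg {E : Env} (hE : E.Legal D) {σ : Config} (hM : Loaded D S c ι (statsOf σ.log)
    σ.mem) (hT : σ.mem.Terminal D) (hP : PlansHeld D (bonusOf D S c ι) σ.log σ.mem) :
    Playing D S c ι σ.log (σ.starts ++ [σ.mem]) D.H (exec E playProg σ) := by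
  have hn : (NExp.get 0 []).eval (σ.mem.setNat 23 [] (E.first σ.log)) = D.H := hM.horizon
  simp only [playProg, exec, hn]
  refine foldl_range_induction
    (fun j σ' => Playing D S c ι σ.log (σ.starts ++ [σ.mem]) j σ') _ _ _ ?_ ?_
  · refine ⟨⟨[], rfl, by simp⟩, rfl, by simp [Mem.nat_setNat], hE.1 _,
      hM.setNat (by norm_num) _ _, hT, ?_, rfl, by simp⟩
    simpa [PlansHeld, Mem.nat_setNat] using hP
  · rintro j hj σ₁ ⟨⟨l', hl', hlog⟩, hstep, hcur, hlt, hload, hterm, hplans, hst, hplayed⟩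
    obtain ⟨⟨a, ha, ha'⟩, ⟨b, hb, hb'⟩⟩ := hplans j hj ⟨σ₁.cur, hlt⟩
    dsimp only at ha' hb'
    set σ₂ : Config := { σ₁ with mem := σ₁.mem.setNat 15 [] j, time := σ₁.time + 1 } with hσ₂
    obtain ⟨r, s', hrs⟩ : ∃ r s', E.next σ₂.log σ₂.step σ₂.cur a b = (r, s') := ⟨_, _, rfl⟩
    obtain ⟨e1, e2, e3, e4, e5⟩ := exec_stepProg E (σ := σ₂) (a := a) (b := b) (r := r)
      (s' := s') (by simp [hσ₂, Mem.nat_setNat, hstep]) (by simp [hσ₂, Mem.nat_setNat, hcur])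
      (by simp [hσ₂, Mem.nat_setNat, hstep, ha']) (by simp [hσ₂, Mem.nat_setNat, hstep, hb'])
      hrs
    -- Legality of the environment keeps the state in range, so that a policy entry exists for the
    -- next step.
    have hs' : s' < D.nS (j + 1) := by
      have := hE.2 σ₂.log j hj σ₂.cur a b
      have hst2 : σ₂.step = j := hstep
      rw [hst2] at hrs
      rwa [hrs] at this
    have hload₂ : Loaded D S c ι (statsOf σ₂.log) σ₂.mem :=
      hload.setNat (by norm_num) _ _
    refine ⟨⟨l' ++ [⟨σ₂.step, σ₂.cur, a, b, r, s'⟩], by simp [hl'], ?_⟩, ?_, ?_, ?_, ?_, ?_, ?_,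
      ?_, ?_⟩
    · rw [e4, ← List.append_assoc, ← hlog]
    · rw [e3]; exact congrArg (· + 1) hstep
    · rw [e1, e2]; simp [Mem.record, Mem.nat_setNat]
    · rw [e2]; exact hs'
    · rw [e1, e4, statsOf_append_singleton]
      exact hload₂.record _
    · intro s
      rw [e1, Mem.record_real_of_ne _ _ (by decide), Mem.record_real_of_ne _ _ (by decide)]
      exact hterm s
    · intro h hh s
      rw [e1, Mem.record_nat_of_ne _ _ (by decide), Mem.record_nat_of_ne _ _ (by decide)]
      exact hplans h hh s
    · rw [e5]; exact hst
    · intro i hi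
      rw [e4]
      rcases Nat.lt_succ_iff_lt_or_eq.1 hi with hi | rfl
      · exact (hplayed i hi).append _
      · refine ⟨⟨σ₁.cur, hlt⟩, a, b, r, s', ?_, ha, hb⟩
        have hlen : σ₂.log.length = σ.log.length + i := by
          change σ₁.log.length = _
          rw [hlog, List.length_append, hl']
        rw [← hlen, List.getElem?_concat_length]
        simp [hσ₂, hstep]

/-- The situation after `k` episodes. -/
structure Played (D : Dims) (S : ℕ) (c ι : ℝ) (k : ℕ) (σ : Config) : Prop where
  length_log : σ.log.length = k * D.H
  length_starts : σ.starts.length = k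
  loaded : Loaded D S c ι (statsOf σ.log) σ.mem
  terminal : σ.mem.Terminal D
  episodes : ∀ i < k,
    (∃ M, σ.starts[i]? = some M ∧
      Holds D (bonusOf D S c ι) vectorNash (σ.log.take (i * D.H)) M) ∧
    ∀ h < D.H, PlayedAt D (bonusOf D S c ι) (σ.log.take (i * D.H)) σ.log h

/-- The instruction `start` records the memory before changing it, which is exactly the memory that
planning has left. -/
theorem exec_episode {E : Env} (hE : E.Legal D) {k : ℕ} {σ : Config}
    (hσ : Played D S c ι k σ) : Played D S c ι (k + 1) (exec E (.seq planProg playProg) σ) := by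
  obtain ⟨h1, h2, h3, h4, h5⟩ := hσ
  obtain ⟨q1, q2, q3⟩ := run_planProg h3 h4
  obtain ⟨e1, -, -, e4, e5⟩ := exec_of_silent E (c := planProg)
    (by simp [planProg, levelProg, stateProg, matrixProg, rowProg, cellProg, scanProg,
      Prog.Silent]) σ
  rw [exec]
  generalize exec E planProg σ = σ₁ at e1 e4 e5
  rw [← e1] at q1 q2 q3
  rw [← e4] at q1 q3 h1 h5
  rw [← e5] at h2 h5
  obtain ⟨⟨l', hl', hlog⟩, -, -, -, p5, p6, -, p8, p9⟩ := exec_playProg hE q1 q2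
    fun h hh s => ⟨(q3 h hh s).2.2.2.1, (q3 h hh s).2.2.2.2⟩
  refine ⟨?_, ?_, p5, p6, fun i hi => ?_⟩
  · rw [hlog, List.length_append, h1, hl']; ring
  · rw [p8, List.length_append, h2, List.length_singleton]
  · rcases Nat.lt_succ_iff_lt_or_eq.1 hi with hi | rfl
    · obtain ⟨⟨M, hM, hM'⟩, hplay⟩ := h5 i hi
      have htake : (exec E playProg σ₁).log.take (i * D.H) = σ₁.log.take (i * D.H) := by
        rw [hlog, List.take_append_of_le_length]
        rw [h1]
        exact Nat.mul_le_mul_right _ hi.le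
      rw [htake]
      refine ⟨⟨M, ?_, hM'⟩, fun h hh => ?_⟩
      · rw [p8, List.getElem?_append_left (by omega), hM]
      · rw [hlog]
        exact (hplay h hh).append l'
    · have htake : (exec E playProg σ₁).log.take (i * D.H) = σ₁.log := by
        rw [hlog, ← h1, List.take_left]
      rw [htake]
      refine ⟨⟨σ₁.mem, ?_, q3⟩, p9⟩
      rw [p8, ← h2, List.getElem?_concat_length]

theorem runsVIULCB_mainProg {E : Env} (hE : E.Legal D) (S A B K : ℕ) (c p : ℝ) :
    RunsVIULCB D (bonus D S A B K c p) vectorNash K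
      (exec E mainProg (inputConfig D S A B K c p)) := by
  have hplayed : Played D S c (iota D S A B K p) K
      (exec E mainProg (inputConfig D S A B K c p)) := by
    rw [mainProg, exec_seq]
    generalize hσ : exec E (.rset _ _ _) (inputConfig D S A B K c p) = σ
    have hmem : σ.mem = (inputMem D S A B K c p).setReal 7 [] (iota D S A B K p) := by
      rw [← hσ]
      rfl
    have hn : (NExp.get 1 []).eval σ.mem = K := by rw [hmem]; rfl
    rw [exec, hn]
    refine foldl_range_induction (fun k σ' => Played D S c (iota D S A B K p) k σ') _ _ _ ?_ ?_
    · have hlog : σ.log = [] := by rw [← hσ]; rfl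
      have hstarts : σ.starts = [] := by rw [← hσ]; rfl
      refine ⟨by simp [hlog], by simp [hstarts], ?_, fun s => ?_, by simp⟩
      · dsimp only
        rw [hlog, hmem]
        constructor <;> simp +contextual [inputMem, Mem.nat_setReal, Mem.real_setReal, statsOf,
          Stats.init]
      · dsimp only
        rw [hmem]
        simp [Mem.real_setReal, inputMem]
    · rintro k - σ' ⟨h1, h2, h3, h4, h5⟩
      exact exec_episode hE ⟨h1, h2, h3.setNat (by norm_num) _ _, h4, h5⟩
  obtain ⟨h1, h2, -, -, h5⟩ := hplayed
  refine ⟨h1, h2, fun k hk => ⟨(h5 k hk).1, fun h hh => ?_⟩⟩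
  have hlen : ((exec E mainProg (inputConfig D S A B K c p)).log.take (k * D.H)).length =
      k * D.H := by
    rw [List.length_take, h1, min_eq_left (Nat.mul_le_mul_right _ hk.le)]
  have := (h5 k hk).2 h hh
  rw [PlayedAt, hlen] at this
  exact this

/-- Since `H` and `K` are positive, each is at most `T = K * H`, and `S`, `A`, `B` bound the other
entries. -/
theorem inputMem_nat_le {S A B K : ℕ} (hD : D.BoundedBy S A B) (hK : 0 < K) (c p : ℝ)
    {arr : ℕ} (harr : arr < 8) (i : List ℕ) :
    (inputMem D S A B K c p).nat arr i ≤ S + A + B + 2 * (K * D.H) := by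
  obtain ⟨hS, hA, hB⟩ := hD
  have h1 : D.H ≤ K * D.H := Nat.le_mul_of_pos_left _ hK
  have h2 : K ≤ K * D.H := Nat.le_mul_of_pos_right _ D.H_pos
  simp only [inputMem]
  split
  · omega
  · omega
  · omega
  · omega
  · omega
  · split_ifs with h
    · have := hS _ h; omega
    · omega
  · split_ifs with h
    · have := hA _ h; omega
    · omega
  · split_ifs with h
    · have := hB _ h; omega
    · omega
  · omega

/-- A polynomial bound for the running time of VI-ULCB in terms of `S`, `A`, `B`, `T`. -/
def timePolynomial : MvPolynomial (Fin 4) ℕ :=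
  mainProg.timeBound (.X 0 + .X 1 + .X 2 + 2 * .X 3)

theorem time_mainProg_le (E : Env) {S A B K : ℕ} (hD : D.BoundedBy S A B) (hK : 0 < K)
    (c p : ℝ) : (exec E mainProg (inputConfig D S A B K c p)).time ≤
      MvPolynomial.eval ![S, A, B, K * D.H] timePolynomial := by
  have h := (exec_time_le E (n := 8) (U := S + A + B + 2 * (K * D.H)) (c := mainProg)
    (by simp [mainProg, planProg, playProg, stepProg, levelProg, stateProg, matrixProg, rowProg,
      cellProg, scanProg, Prog.LoopsBelow]) (inputConfig D S A B K c p)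
    fun arr harr i => inputMem_nat_le hD hK c p harr i).2
  rw [timePolynomial, Prog.map_timeBound]
  simpa [inputConfig] using h

end Play

end

end MG

theorem corollary3 :
    -- for vector games the subroutine reduces to an argmax (argmin) over a vector
    ((∀ (m : ℕ) (P Q : Fin m → Fin 1 → ℝ) (φ : PMF (Fin m)) (ψ : PMF (Fin 1)),
        MG.IsNash P Q φ ψ ↔ ∀ φ', MG.payoff φ' P ψ ≤ MG.payoff φ P ψ) ∧
      (∀ (m : ℕ) (P Q : Fin m → Fin 1 → ℝ) (a : Fin m), (∀ a', P a' 0 ≤ P a 0) →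
        MG.IsNash P Q (PMF.pure a) (PMF.pure 0)) ∧
      (∀ (n : ℕ) (P Q : Fin 1 → Fin n → ℝ) (φ : PMF (Fin 1)) (ψ : PMF (Fin n)),
        MG.IsNash P Q φ ψ ↔ ∀ ψ', MG.payoff φ Q ψ ≤ MG.payoff φ Q ψ') ∧
      (∀ (n : ℕ) (P Q : Fin 1 → Fin n → ℝ) (b : Fin n), (∀ b', Q 0 b ≤ Q 0 b') →
        MG.IsNash P Q (PMF.pure 0) (PMF.pure b)) ∧
      MG.SolvesVectorGames MG.vectorNash) ∧
    -- VI-ULCB with this subroutine runs in polynomial time on turn-based games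
    (∃ (prog : MG.Prog) (q : MvPolynomial (Fin 4) ℕ),
      ∀ (D : MG.Dims), D.TurnBased → ∀ (S A B K : ℕ), D.BoundedBy S A B → 0 < K →
      ∀ (c p : ℝ), 0 < c → 0 < p → p < 1 → ∀ (E : MG.Env), E.Legal D →
        MG.RunsVIULCB D (MG.bonus D S A B K c p) MG.vectorNash K
          (MG.exec E prog (MG.inputConfig D S A B K c p)) ∧
        (MG.exec E prog (MG.inputConfig D S A B K c p)).time ≤
          MvPolynomial.eval ![S, A, B, K * D.H] q) ∧
    -- the regret bound
    (∃ c₀ : ℝ, 0 < c₀ ∧ ∀ c : ℝ, c₀ ≤ c → ∃ C : ℝ, 0 < C ∧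
      ∀ (nash : MG.Subroutine), MG.SolvesVectorGames nash →
      ∀ (D : MG.Dims), D.TurnBased → ∀ (S A B K : ℕ), D.BoundedBy S A B → 0 < K →
      ∀ (p : ℝ), 0 < p → p < 1 →
      ∀ (G : MG.Game D) (adv : MG.Adversary D),
        ENNReal.ofReal (1 - p) ≤
          (MG.law G (MG.viULCB D (MG.bonus D S A B K c p) nash) adv K).toOuterMeasure
            {hist | MG.regret G (MG.viULCB D (MG.bonus D S A B K c p) nash) hist ≤
              C * Real.sqrt ((D.H : ℝ) ^ 3 * (S : ℝ) ^ 2 * ((A : ℝ) + B) * ((K : ℝ) * D.H) *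
                MG.iota D S A B K p)}) := by
  refine ⟨⟨fun _ => MG.isNash_column_iff, fun _ => MG.isNash_pure_column,
    fun _ => MG.isNash_row_iff, fun _ => MG.isNash_pure_row, MG.solvesVectorGames_vectorNash⟩,
    ⟨MG.mainProg, MG.timePolynomial, fun D _ S A B K hSAB hK c p _ _ _ E hE =>
      ⟨MG.runsVIULCB_mainProg hE S A B K c p, MG.time_mainProg_le E hSAB hK c p⟩⟩,
    -- The threshold `8` makes the bonus dominate the ℓ¹ error; in `9 * c + 2` the first term comes
    -- from the sum of widths, the second from Azuma's inequality.
    8, by norm_num, fun c hc => ⟨9 * c + 2, by linarith, ?_⟩⟩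
  intro nash hnash D hD S A B K hSAB hK p hp hp1 G adv
  rw [MG.toOuterMeasure_eq_prob]
  exact MG.regret_bound G adv hnash hD hSAB hK hc hp hp1
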